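/- Let $\Bbbk$ be a commutative ring (all quivers are small and $\mathbb Z$-graded, differentials have degree $1$, operators act from the right, so that $(x\otimes y)(f\otimes g)=(-1)^{\deg y\cdot\deg f}\,xf\otimes yg$). For a graded module $P$ let $P[k]^d=P^{d+k}$, $sP=P[1]$, and $(M\otimes N)[k]=M\otimes (N[k])$. A differential graded quiver $\mathcal Q$ is a set $\operatorname{Ob}\mathcal Q$ with complexes of $\Bbbk$-modules $\mathcal Q(X,Y)$; a morphism of such is a map of objects together with chain maps. An $A_\infty$-category is a graded quiver $\mathcal A$ with $\Bbbk$-linear maps $b_n:s\mathcal A(X_0,X_1)\otimes\dots\otimes s\mathcal A(X_{n-1},X_n)\to s\mathcal A(X_0,X_n)$, $n\ge1$, of degree $1$ with $\sum_{r+n+t=k}(1^{\otimes r}\otimes b_n\otimes 1^{\otimes t})b_{r+1+t}=0$ for all $k\ge1$; it has the underlying differential graded quiver $(\mathcal A,m_1)$, $m_1s=sb_1$. An $A_\infty$-functor $f:\mathcal A\to\mathcal B$ is a map of objects $X\mapsto Xf$ with $\Bbbk$-linear maps $f_n:s\mathcal A(X_0,X_1)\otimes\dots\otimes s\mathcal A(X_{n-1},X_n)\to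 s\mathcal B(X_0f,X_nf)$, $n\ge1$, of degree $0$ with $\sum_{l>0,\,i_1+\dots+i_l=k}(f_{i_1}\otimes\dots\otimes f_{i_l})b_l=\sum_{r+n+t=k}(1^{\otimes r}\otimes b_n\otimes1^{\otimes t})f_{r+1+t}$ for all $k\ge1$; it is strict if $f_n=0$ for $n>1$. For a differential graded quiver $\mathcal Q$, with $s\mathcal Q$ carrying the differential $d=s^{-1}d_{\mathcal Q}s$, let $\mathcal F\mathcal Q$ be the graded quiver with $\operatorname{Ob}\mathcal F\mathcal Q=\operatorname{Ob}\mathcal Q$ and $s\mathcal F\mathcal Q(X,Y)=\bigoplus_{t}s\mathcal F_t\mathcal Q(X,Y)$, where $t$ runs over all plane rooted trees in which every internal vertex has at least two inputs, and, with $n$ the number of inputs and $|t|$ the number of internal vertices of $t$, $$s\mathcal F_t\mathcal Q(X,Y)=\bigoplus_{X=X_0,X_1,\dots,X_n=Y}s\mathcal Q(X_0,X_1)\otimes\dots\otimes s\mathcal Q(X_{n-1},X_n)\,[-|t|].$$ Its operations are: for $k\ge2$, the direct sum of the maps $b_k=s^{|t_1|}\otimes\dots\otimes s^{|t_{k-1}|}\otimes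 s^{|t_k|-|t|}:s\mathcal F_{t_1}\mathcal Q\otimes\dots\otimes s\mathcal F_{t_k}\mathcal Q\to s\mathcal F_t\mathcal Q$, where $t$ is obtained by grafting $t_1,\dots,t_k$ in this order onto the inputs of a new lowest vertex; and $b_1$, which on $s\mathcal F_t\mathcal Q$ is the differential of this (shifted) tensor product, that is, $(-1)^{|t|}$ times the tensor product differential of $s\mathcal Q\otimes\dots\otimes s\mathcal Q$ under the identification of the underlying modules, plus the sum of the maps $(-1)^{1+h(t',e)}s^{-1}:s\mathcal F_t\mathcal Q\to s\mathcal F_{t'}\mathcal Q$ over all trees $t'$ (with all internal vertices having at least two inputs) with a distinguished internal edge $e$ whose contraction gives $t$; here $h(t',e)$ is the position, starting from $1$, of the highest vertex of $e$ in the linear order of the internal vertices of $t'$ in which every vertex precedes the vertices above it and vertices of a left branch precede those of a right branch. The quiver $\mathcal Q$ is embedded in $\mathcal F\mathcal Q$ as the summand of the trivial tree. Then $\mathcal F\mathcal Q$ is an $A_\infty$-category, and for every $A_\infty$-category $\mathcal A$: every morphism of differential graded quivers $f:\mathcal Q\to(\mathcal A,m_1)$ extends to a unique strict $A_\infty$-functor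 $\widehat f:\mathcal F\mathcal Q\to\mathcal A$, and the maps $f\mapsto\widehat f$ and $g\mapsto(\operatorname{Ob}g,\,g_1|_{s\mathcal Q})$ are mutually inverse bijections between the set of morphisms of differential graded quivers $\mathcal Q\to(\mathcal A,m_1)$ and the set of strict $A_\infty$-functors $\mathcal F\mathcal Q\to\mathcal A$. -/

import Mathlib

open DirectSum

universe u

noncomputable section

namespace FreeAInf

/-! ### Composable strings -/

/-- `Str M X Y`: composable strings `x₁, …, xₙ` (`n ≥ 0`) with `xᵢ ∈ M Xᵢ₋₁ Xᵢ`, `X₀ = X`, `Xₙ = Y`. -/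
inductive Str {O : Type u} (M : O → O → Type u) (X : O) : O → Type u
  | nil : Str M X X
  | snoc {Y Z : O} (p : Str M X Y) (x : M Y Z) : Str M X Z

namespace Str

variable {O : Type u} {M : O → O → Type u}

def length {X : O} : {Y : O} → Str M X Y → ℕ
  | _, nil => 0
  | _, snoc p _ => p.length + 1

def append {X Y : O} (p : Str M X Y) : {Z : O} → Str M Y Z → Str M X Z
  | _, nil => p
  | _, snoc q x => snoc (append p q) x

/-- The string with the single entry `x`. -/
def one {X Y : O} (x : M X Y) : Str M X Y := snoc nil x

/-- Apply a family of maps (over a map of objects) to every entry of a string. -/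
def map {O' : Type u} {N : O' → O' → Type u} (φ : O → O')
    (f : ∀ X Y, M X Y → N (φ X) (φ Y)) {X : O} : {Y : O} → Str M X Y → Str N (φ X) (φ Y)
  | _, nil => nil
  | _, snoc p x => snoc (map φ f p) (f _ _ x)

/-- All ways to write a string as `l · r`. -/
def splits {X : O} : {Y : O} → Str M X Y → List (Σ Z : O, Str M X Z × Str M Z Y)
  | _, nil => [⟨X, nil, nil⟩]
  | Y, snoc p x => (splits p).map (fun s => ⟨s.1, s.2.1, s.2.2.snoc x⟩) ++ [⟨Y, snoc p x, nil⟩]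

/-- All ways to write a string as `l · m · r` with `m` non-empty. -/
def infixes {X : O} : {Y : O} → Str M X Y → List (Σ Z W : O, Str M X Z × Str M Z W × Str M W Y)
  | _, nil => []
  | Y, snoc p x =>
      (infixes p).map (fun s => ⟨s.1, s.2.1, s.2.2.1, s.2.2.2.1, s.2.2.2.2.snoc x⟩) ++
      (splits p).map (fun s => ⟨s.1, Y, s.2.1, s.2.2.snoc x, nil⟩)

/-- For a family `f` of functions on strings and a non-empty string `p`, the list of all ways to cut
`p = p₁ ⋯ pₗ` into `l ≥ 1` non-empty pieces; the cut is recorded as the pair consisting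
of the string `f p₁, …, f pₗ₋₁` and the last piece `pₗ`. -/
def blocks {O' : Type u} {N : O' → O' → Type u} (φ : O → O')
    (f : ∀ {X Y : O}, Str M X Y → N (φ X) (φ Y)) {X : O} :
    {Y : O} → Str M X Y → List (Σ Z : O, Str N (φ X) (φ Z) × Str M Z Y)
  | _, nil => [⟨X, nil, nil⟩]
  | _, snoc (Y := Y) p x =>
      (blocks φ f p).map (fun s => ⟨s.1, s.2.1, s.2.2.snoc x⟩) ++
      (if p.length = 0 then []
        else (blocks φ f p).map (fun s => ⟨Y, s.2.1.snoc (f s.2.2), one x⟩))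

lemma length_append {X Y Z : O} (p : Str M X Y) (q : Str M Y Z) :
    (p.append q).length = p.length + q.length := by
  induction q with
  | nil => rfl
  | snoc q x ih => simp only [append, length, ih]; omega

lemma append_assoc {X Y Z W : O} (p : Str M X Y) (q : Str M Y Z) (r : Str M Z W) :
    (p.append q).append r = p.append (q.append r) := by
  induction r with
  | nil => rfl
  | snoc r x ih => simp only [append, ih]

variable {k : Type u} [CommRing k] [∀ X Y, AddCommGroup (M X Y)] [∀ X Y, Module k (M X Y)]

/-- All entries are homogeneous and the degrees add up to `e`. -/
def IsHomog (gr : ∀ X Y, ℤ → Submodule k (M X Y)) {X : O} : {Y : O} → Str M X Y → ℤ → Prop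
  | _, nil, e => e = 0
  | _, snoc p x, e => ∃ a b : ℤ, IsHomog gr p a ∧ x ∈ gr _ _ b ∧ a + b = e

variable (k) in
/-- A function of strings from `X` to `Y` which is `k`-linear in every entry of the string, i.e. a
system of `k`-linear maps `M X X₁ ⊗ M X₁ X₂ ⊗ ⋯ ⊗ M Xₙ₋₁ Y → N`. -/
structure IsMultilinear {N : Type u} [AddCommGroup N] [Module k N] {X Y : O}
    (φ : Str M X Y → N) : Prop where
  map_add : ∀ {Z W : O} (l : Str M X Z) (x y : M Z W) (r : Str M W Y),
    φ ((l.snoc (x + y)).append r) = φ ((l.snoc x).append r) + φ ((l.snoc y).append r)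
  map_smul : ∀ {Z W : O} (l : Str M X Z) (c : k) (x : M Z W) (r : Str M W Y),
    φ ((l.snoc (c • x)).append r) = c • φ ((l.snoc x).append r)

end Str

/-! ### Graded modules -/

section Graded

variable {k : Type u} [CommRing k] {M : Type u} [AddCommGroup M] [Module k M]

/-- The parity involution `x ↦ (-1)^{deg x} x` of a graded module. It encodes the Koszul sign rule. -/
def parity (gr : ℤ → Submodule k M) (h : DirectSum.IsInternal gr) : M →ₗ[k] M :=
  (DirectSum.toModule k ℤ M (fun d => ((Int.negOnePow d : ℤˣ) : ℤ) • (gr d).subtype)) ∘ₗ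
    (LinearEquiv.ofBijective (DirectSum.coeLinearMap gr) h).symm.toLinearMap

lemma isInternal_of_split (gr : ℤ → Submodule k M) (f : M →ₗ[k] (ℤ →₀ M))
    (hf : ∀ i, ∀ x ∈ gr i, f x = Finsupp.single i x) (htop : ⨆ i, gr i = ⊤) :
    DirectSum.IsInternal gr := by
  classical
  have key : ∀ z : ⨁ i, gr i, ∀ i, f (DirectSum.coeLinearMap gr z) i = z i := by
    intro z i
    induction z using DirectSum.induction_on with
    | zero => simp
    | of j x =>
      rw [← DirectSum.lof_eq_of k, DirectSum.coeLinearMap_lof, hf j _ x.2,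
        DirectSum.lof_eq_of, DirectSum.coe_of_apply, Finsupp.single_apply]
      split_ifs <;> simp
    | add a b ha hb => simp [ha, hb]
  have hinj : Function.Injective (DirectSum.coeLinearMap gr) := by
    intro a b hab
    ext i
    rw [← key a i, ← key b i, hab]
  refine ⟨hinj, ?_⟩
  have : LinearMap.range (DirectSum.coeLinearMap gr) = ⊤ := by
    rw [DirectSum.range_coeLinearMap, htop]
  exact LinearMap.range_eq_top.1 this

lemma exists_split (gr : ℤ → Submodule k M) (h : DirectSum.IsInternal gr) :
    ∃ f : M →ₗ[k] (ℤ →₀ M), ∀ i, ∀ x ∈ gr i, f x = Finsupp.single i x := by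
  refine ⟨(DirectSum.toModule k ℤ (ℤ →₀ M) (fun d => Finsupp.lsingle d ∘ₗ (gr d).subtype)) ∘ₗ
    (LinearEquiv.ofBijective (DirectSum.coeLinearMap gr) h).symm.toLinearMap, ?_⟩
  intro i x hx
  have : (LinearEquiv.ofBijective (DirectSum.coeLinearMap gr) h).symm x
      = DirectSum.lof k ℤ (fun i => gr i) i ⟨x, hx⟩ := by
    rw [LinearEquiv.symm_apply_eq]
    exact (DirectSum.coeLinearMap_lof gr i ⟨x, hx⟩).symm
  simp [this]

lemma isInternal_shift {gr : ℤ → Submodule k M} (h : DirectSum.IsInternal gr) (n : ℤ) :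
    DirectSum.IsInternal (fun d => gr (d + n)) := by
  rw [DirectSum.isInternal_submodule_iff_iSupIndep_and_iSup_eq_top] at h ⊢
  refine ⟨h.1.comp (add_left_injective n), ?_⟩
  rw [← h.2]
  exact (Equiv.addRight n).iSup_comp (g := gr)

end Graded

/-! ### Quivers -/

/-- A `ℤ`-graded `k`-quiver; the graded module of morphisms `X → Y` is represented by its total module
`Hom X Y` together with the submodules `gr X Y d` of its homogeneous elements. -/
structure GradedQuiver (k : Type u) [CommRing k] where
  Ob : Type u
  Hom : Ob → Ob → Type u
  [addCommGroup : ∀ X Y, AddCommGroup (Hom X Y)]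
  [module : ∀ X Y, Module k (Hom X Y)]
  gr : ∀ X Y, ℤ → Submodule k (Hom X Y)
  internal : ∀ X Y, DirectSum.IsInternal (gr X Y)

attribute [instance] GradedQuiver.addCommGroup GradedQuiver.module

namespace GradedQuiver

variable {k : Type u} [CommRing k] (Q : GradedQuiver k)

/-- The grading of the suspension `sQ`, `(sQ)^d = Q^{d+1}`. The quivers `Q` and `sQ` have the same total
modules of morphisms, and `s : Q → sQ` is the identity map of these modules. -/
def sgr (X Y : Q.Ob) (d : ℤ) : Submodule k (Q.Hom X Y) := Q.gr X Y (d + 1)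

lemma sgr_internal (X Y : Q.Ob) : DirectSum.IsInternal (Q.sgr X Y) :=
  isInternal_shift (Q.internal X Y) 1

/-- The map `x ↦ (-1)^{deg x} x`, where `deg` is the degree in `sQ`. -/
def sσ (X Y : Q.Ob) : Q.Hom X Y →ₗ[k] Q.Hom X Y := parity (Q.sgr X Y) (Q.sgr_internal X Y)

end GradedQuiver

/-- A differential graded `k`-quiver (the differential has degree `1`). -/
structure DGQuiver (k : Type u) [CommRing k] extends GradedQuiver k where
  d : ∀ X Y, Hom X Y →ₗ[k] Hom X Y
  d_mem : ∀ X Y (e : ℤ), ∀ x ∈ gr X Y e, d X Y x ∈ gr X Y (e + 1)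
  d_d : ∀ X Y (x : Hom X Y), d X Y (d X Y x) = 0

/-- A morphism of differential graded quivers: a map of objects and chain maps. -/
structure DGQuiverHom {k : Type u} [CommRing k] (Q R : DGQuiver k) where
  obj : Q.Ob → R.Ob
  map : ∀ X Y, Q.Hom X Y →ₗ[k] R.Hom (obj X) (obj Y)
  map_mem : ∀ X Y (e : ℤ), ∀ x ∈ Q.gr X Y e, map X Y x ∈ R.gr (obj X) (obj Y) e
  map_d : ∀ X Y (x : Q.Hom X Y), map X Y (Q.d X Y x) = R.d (obj X) (obj Y) (map X Y x)

/-! ### A∞-categories and A∞-functors -/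

/-- A graded quiver `A` with operations `bₙ` on `sA`; the value of `b` on a string of length `n`
is the value of `bₙ`. -/
structure PreAInf (k : Type u) [CommRing k] extends GradedQuiver k where
  b : ∀ {X Y : Ob}, Str Hom X Y → Hom X Y

/-- The operations `bₙ`, `n ≥ 1`, are `k`-linear maps `sA(X₀,X₁) ⊗ ⋯ ⊗ sA(Xₙ₋₁,Xₙ) → sA(X₀,Xₙ)` of
degree `1` (and there is no `b₀`), such that
`∑_{r+n+t=k} (1^{⊗r} ⊗ bₙ ⊗ 1^{⊗t}) b_{r+1+t} = 0` for all `k ≥ 1`. Operators act from the right, so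
that `bₙ` passes through the last `t` arguments, which produces the sign `(-1)` to the sum of
their degrees. -/
structure PreAInf.IsAInf {k : Type u} [CommRing k] (A : PreAInf k) : Prop where
  b_nil : ∀ X : A.Ob, A.b (Str.nil : Str A.Hom X X) = 0
  b_multilinear : ∀ X Y, Str.IsMultilinear k (fun p : Str A.Hom X Y => A.b p)
  b_mem : ∀ {X Y : A.Ob} (p : Str A.Hom X Y) (e : ℤ), p.IsHomog A.sgr e →
    A.b p ∈ A.sgr X Y (e + 1)
  b_b : ∀ {X Y : A.Ob} (p : Str A.Hom X Y),
    (p.infixes.map (fun s =>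
      A.b ((s.2.2.1.snoc (A.b s.2.2.2.1)).append
        (s.2.2.2.2.map id (fun X Y => A.sσ X Y))))).sum = 0

/-- An A∞-category. -/
structure AInfCategory (k : Type u) [CommRing k] extends PreAInf k where
  isAInf : toPreAInf.IsAInf

/-- The differential graded quiver `(A, m₁)` underlying an A∞-category, `m₁ s = s b₁`. -/
abbrev AInfCategory.toDG {k : Type u} [CommRing k] (A : AInfCategory k) : DGQuiver k where
  toGradedQuiver := A.toGradedQuiver
  d X Y :=
    { toFun := fun x => A.b (Str.one x)
      map_add' := fun x y => (A.isAInf.b_multilinear X Y).map_add Str.nil x y Str.nil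
      map_smul' := fun c x => (A.isAInf.b_multilinear X Y).map_smul Str.nil c x Str.nil }
  d_mem X Y e x hx := by
    have h := A.isAInf.b_mem (Str.one x) (e - 1)
      ⟨0, e - 1, rfl, by simpa [GradedQuiver.sgr] using hx, by omega⟩
    rw [sub_add_cancel] at h
    exact h
  d_d X Y x := by
    have h := A.isAInf.b_b (Str.one x)
    simpa [Str.one, Str.infixes, Str.splits, Str.append, Str.map] using h

/-- An A∞-functor `A → B`: a map of objects and `k`-linear maps
`fₙ : sA(X₀,X₁) ⊗ ⋯ ⊗ sA(Xₙ₋₁,Xₙ) → sB(X₀f,Xₙf)`, `n ≥ 1`, of degree `0` (`comp` gives the value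
of `fₙ` on strings of length `n`, and `f₀ = 0`), such that
`∑_{l>0, i₁+⋯+iₗ=k} (f_{i₁} ⊗ ⋯ ⊗ f_{iₗ}) bₗ = ∑_{r+n+t=k} (1^{⊗r} ⊗ bₙ ⊗ 1^{⊗t}) f_{r+1+t}` for all
`k ≥ 1`. -/
structure AInfFunctor {k : Type u} [CommRing k] (A B : AInfCategory k) where
  obj : A.Ob → B.Ob
  comp : ∀ {X Y : A.Ob}, Str A.Hom X Y → B.Hom (obj X) (obj Y)
  comp_nil : ∀ X : A.Ob, comp (Str.nil : Str A.Hom X X) = 0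
  comp_multilinear : ∀ X Y, Str.IsMultilinear k (fun p : Str A.Hom X Y => comp p)
  comp_mem : ∀ {X Y : A.Ob} (p : Str A.Hom X Y) (e : ℤ), p.IsHomog A.sgr e →
    comp p ∈ B.sgr (obj X) (obj Y) e
  comp_b : ∀ {X Y : A.Ob} (p : Str A.Hom X Y), 1 ≤ p.length →
    ((p.blocks obj comp).map (fun s => B.b (s.2.1.snoc (comp s.2.2)))).sum =
    (p.infixes.map (fun s =>
      comp ((s.2.2.1.snoc (A.b s.2.2.2.1)).append
        (s.2.2.2.2.map id (fun X Y => A.sσ X Y))))).sum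

/-- A strict A∞-functor: `fₙ = 0` for `n > 1`. -/
structure StrictAInfFunctor {k : Type u} [CommRing k] (A B : AInfCategory k)
    extends AInfFunctor A B where
  strict : ∀ {X Y : A.Ob} (p : Str A.Hom X Y), 2 ≤ p.length → comp p = 0

/-! ### Tensor powers of a quiver -/

section Tensor

variable {k : Type u} [CommRing k] {O : Type u} {M : O → O → Type u}
  [∀ X Y, AddCommGroup (M X Y)] [∀ X Y, Module k (M X Y)]

/-- The relations of multilinearity on formal linear combinations of strings of length `n`. -/
def tensorRel (k : Type u) [CommRing k] {O : Type u} (M : O → O → Type u)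
    [∀ X Y, AddCommGroup (M X Y)] [∀ X Y, Module k (M X Y)] (n : ℕ) (X Y : O) :
    Submodule k ({p : Str M X Y // p.length = n} →₀ k) :=
  Submodule.span k
    ({ρ | ∃ (Z W : O) (l : Str M X Z) (x y : M Z W) (r : Str M W Y)
        (p p₁ p₂ : {p : Str M X Y // p.length = n}),
        p.1 = (l.snoc (x + y)).append r ∧ p₁.1 = (l.snoc x).append r ∧
        p₂.1 = (l.snoc y).append r ∧
        ρ = Finsupp.single p 1 - Finsupp.single p₁ 1 - Finsupp.single p₂ 1} ∪
     {ρ | ∃ (Z W : O) (l : Str M X Z) (c : k) (x : M Z W) (r : Str M W Y)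
        (p p₁ : {p : Str M X Y // p.length = n}),
        p.1 = (l.snoc (c • x)).append r ∧ p₁.1 = (l.snoc x).append r ∧
        ρ = Finsupp.single p 1 - Finsupp.single p₁ c})

/-- The tensor power `TⁿM (X, Y) = ⨁_{X = X₀, X₁, …, Xₙ = Y} M X₀ X₁ ⊗ ⋯ ⊗ M Xₙ₋₁ Xₙ`, that is, the free
`k`-module on the composable strings `x₁ ⊗ ⋯ ⊗ xₙ` of length `n` from `X` to `Y` (with arbitrary
intermediate objects), modulo linearity in each entry. -/
def TPow (k : Type u) [CommRing k] {O : Type u} (M : O → O → Type u)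
    [∀ X Y, AddCommGroup (M X Y)] [∀ X Y, Module k (M X Y)] (n : ℕ) (X Y : O) : Type u :=
  ({p : Str M X Y // p.length = n} →₀ k) ⧸ tensorRel k M n X Y

instance (n : ℕ) (X Y : O) : AddCommGroup (TPow k M n X Y) :=
  inferInstanceAs (AddCommGroup (_ ⧸ tensorRel k M n X Y))

instance (n : ℕ) (X Y : O) : Module k (TPow k M n X Y) :=
  inferInstanceAs (Module k (_ ⧸ tensorRel k M n X Y))

namespace TPow

/-- The pure tensor `x₁ ⊗ ⋯ ⊗ xₙ`. -/
def mk {n : ℕ} {X Y : O} (p : Str M X Y) (h : p.length = n) : TPow k M n X Y :=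
  (tensorRel k M n X Y).mkQ (Finsupp.single ⟨p, h⟩ 1)

variable (k) in
/-- Functions of strings of fixed length, linear in every entry. -/
structure IsMultilinear {N : Type u} [AddCommGroup N] [Module k N] {n : ℕ} {X Y : O}
    (φ : ∀ p : Str M X Y, p.length = n → N) : Prop where
  map_add : ∀ {Z W : O} (l : Str M X Z) (x y : M Z W) (r : Str M W Y)
    (h : ((l.snoc (x + y)).append r).length = n) (h₁ : ((l.snoc x).append r).length = n)
    (h₂ : ((l.snoc y).append r).length = n), φ _ h = φ _ h₁ + φ _ h₂
  map_smul : ∀ {Z W : O} (l : Str M X Z) (c : k) (x : M Z W) (r : Str M W Y)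
    (h : ((l.snoc (c • x)).append r).length = n) (h₁ : ((l.snoc x).append r).length = n),
    φ _ h = c • φ _ h₁

/-- The linear map on the tensor power defined by a multilinear function. -/
def lift {N : Type u} [AddCommGroup N] [Module k N] {n : ℕ} {X Y : O}
    (φ : ∀ p : Str M X Y, p.length = n → N) (hφ : IsMultilinear k φ) : TPow k M n X Y →ₗ[k] N :=
  (tensorRel k M n X Y).liftQ (Finsupp.linearCombination k (fun p => φ p.1 p.2)) (by
    rw [tensorRel, Submodule.span_le]
    rintro ρ (⟨Z, W, l, x, y, r, ⟨p, hp⟩, ⟨p₁, hp₁⟩, ⟨p₂, hp₂⟩, rfl, rfl, rfl, rfl⟩ |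
      ⟨Z, W, l, c, x, r, ⟨p, hp⟩, ⟨p₁, hp₁⟩, rfl, rfl, rfl⟩)
    · simp [hφ.map_add l x y r hp hp₁ hp₂]
    · simp [hφ.map_smul l c x r hp hp₁])

@[simp]
lemma lift_mk {N : Type u} [AddCommGroup N] [Module k N] {n : ℕ} {X Y : O}
    (φ : ∀ p : Str M X Y, p.length = n → N) (hφ : IsMultilinear k φ) (p : Str M X Y)
    (h : p.length = n) : lift φ hφ (mk p h) = φ p h := by
  refine (Submodule.liftQ_apply _ _ _).trans ?_
  simp

lemma mk_multilinear {n : ℕ} {X Y : O} :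
    IsMultilinear k (fun (p : Str M X Y) (h : p.length = n) => (mk p h : TPow k M n X Y)) where
  map_add l x y r h h₁ h₂ := by
    have : (Finsupp.single ⟨_, h⟩ 1 - Finsupp.single ⟨_, h₁⟩ 1 - Finsupp.single ⟨_, h₂⟩ 1 :
        {p : Str M X Y // p.length = n} →₀ k) ∈ tensorRel k M n X Y :=
      Submodule.subset_span (Or.inl ⟨_, _, l, x, y, r, _, _, _, rfl, rfl, rfl, rfl⟩)
    rw [← Submodule.ker_mkQ (tensorRel k M n X Y), LinearMap.mem_ker, map_sub, map_sub,
      sub_sub, sub_eq_zero] at this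
    exact this
  map_smul l c x r h h₁ := by
    have : (Finsupp.single ⟨_, h⟩ 1 - Finsupp.single ⟨_, h₁⟩ c :
        {p : Str M X Y // p.length = n} →₀ k) ∈ tensorRel k M n X Y :=
      Submodule.subset_span (Or.inr ⟨_, _, l, c, x, r, _, _, rfl, rfl, rfl⟩)
    rw [← Submodule.ker_mkQ (tensorRel k M n X Y), LinearMap.mem_ker, map_sub,
      sub_eq_zero] at this
    refine Eq.trans this ?_
    have h2 : (Finsupp.single ⟨_, h₁⟩ c : {p : Str M X Y // p.length = n} →₀ k) =
      c • Finsupp.single ⟨_, h₁⟩ 1 := by simp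
    rw [h2]
    exact map_smul _ _ _

lemma span_mk {n : ℕ} {X Y : O} :
    Submodule.span k {t : TPow k M n X Y | ∃ p h, t = mk p h} = ⊤ := by
  rw [eq_top_iff]
  rintro t -
  obtain ⟨f, rfl⟩ := (tensorRel k M n X Y).mkQ_surjective t
  induction f using Finsupp.induction_linear with
  | zero => rw [map_zero]; exact Submodule.zero_mem _
  | add f g hf hg => rw [map_add]; exact Submodule.add_mem _ hf hg
  | single p c =>
    have : (Finsupp.single p c : _ →₀ k) = c • Finsupp.single p 1 := by simp
    rw [this, map_smul]
    exact Submodule.smul_mem _ _ (Submodule.subset_span ⟨p.1, p.2, rfl⟩)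

/-- The identity map `TⁿM → TᵐM` for `n = m`. -/
def cast {n m : ℕ} (h : n = m) (X Y : O) : TPow k M n X Y →ₗ[k] TPow k M m X Y :=
  lift (fun p hp => mk p (hp.trans h))
    ⟨fun l x y r _ _ _ => mk_multilinear.map_add l x y r _ _ _,
     fun l c x r _ _ => mk_multilinear.map_smul l c x r _ _⟩

/-- `(x₁ ⊗ ⋯ ⊗ xₙ, x) ↦ x₁ ⊗ ⋯ ⊗ xₙ ⊗ x`. -/
def snoc (n : ℕ) (X Y Z : O) : TPow k M n X Y →ₗ[k] M Y Z →ₗ[k] TPow k M (n + 1) X Z :=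
  lift (fun p h =>
    { toFun := fun x => mk (p.snoc x) (congrArg (· + 1) h)
      map_add' := fun x y => mk_multilinear.map_add p x y Str.nil _ _ _
      map_smul' := fun c x => mk_multilinear.map_smul p c x Str.nil _ _ })
    ⟨fun l x y r _ _ _ => LinearMap.ext fun z => mk_multilinear.map_add l x y (r.snoc z) _ _ _,
     fun l c x r _ _ => LinearMap.ext fun z => mk_multilinear.map_smul l c x (r.snoc z) _ _⟩

@[simp]
lemma snoc_mk {n : ℕ} {X Y Z : O} (p : Str M X Y) (h : p.length = n) (x : M Y Z) :
    snoc (k := k) n X Y Z (mk p h) x = mk (p.snoc x) (congrArg (· + 1) h) := by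
  rw [snoc, lift_mk]
  rfl

/-- Concatenation `TⁿM (X, Y) ⊗ TᵐM (Y, Z) → Tⁿ⁺ᵐM (X, Z)`. -/
def mul (n m : ℕ) (X Y Z : O) :
    TPow k M n X Y →ₗ[k] TPow k M m Y Z →ₗ[k] TPow k M (n + m) X Z :=
  lift (fun p hp =>
    lift (fun q hq => mk (p.append q) (by rw [Str.length_append, hp, hq]))
      ⟨fun l x y r h h₁ h₂ => by
        have := mk_multilinear (k := k) (n := n + m) |>.map_add (p.append l) x y r
        simp only [← Str.append_assoc, Str.append] at this ⊢
        exact this _ _ _,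
       fun l c x r h h₁ => by
        have := mk_multilinear (k := k) (n := n + m) |>.map_smul (p.append l) c x r
        simp only [← Str.append_assoc, Str.append] at this ⊢
        exact this _ _⟩)
    ⟨fun l x y r h h₁ h₂ => by
      refine LinearMap.ext_on span_mk ?_
      rintro _ ⟨q, hq, rfl⟩
      have := mk_multilinear (k := k) (n := n + m) |>.map_add l x y (r.append q)
      simp only [lift_mk, LinearMap.add_apply, Str.append_assoc] at this ⊢
      exact this _ _ _,
     fun l c x r h h₁ => by
      refine LinearMap.ext_on span_mk ?_
      rintro _ ⟨q, hq, rfl⟩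
      have := mk_multilinear (k := k) (n := n + m) |>.map_smul l c x (r.append q)
      simp only [lift_mk, LinearMap.smul_apply, Str.append_assoc] at this ⊢
      exact this _ _⟩

/-- The grading of the tensor power. -/
def gr (g : ∀ X Y, ℤ → Submodule k (M X Y)) (n : ℕ) (X Y : O) (e : ℤ) :
    Submodule k (TPow k M n X Y) :=
  Submodule.span k {t | ∃ (p : Str M X Y) (h : p.length = n), p.IsHomog g e ∧ t = mk p h}

lemma snoc_mem_gr (g : ∀ X Y, ℤ → Submodule k (M X Y)) {n : ℕ} {X Y Z : O} {a b : ℤ}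
    {t : TPow k M n X Y} (ht : t ∈ gr g n X Y a) {x : M Y Z} (hx : x ∈ g Y Z b) :
    snoc n X Y Z t x ∈ gr g (n + 1) X Z (a + b) := by
  have : gr g n X Y a ≤
      (gr g (n + 1) X Z (a + b)).comap ((snoc (k := k) n X Y Z).flip x) := by
    refine Submodule.span_le.2 ?_
    rintro _ ⟨p, h, hp, rfl⟩
    exact Submodule.subset_span ⟨p.snoc x, congrArg (· + 1) h, ⟨a, b, hp, hx, rfl⟩, by simp⟩
  exact this ht


/-- Auxiliary: the convolution defined by a bilinear map. -/
def conv {A B C : Type u} [AddCommGroup A] [AddCommGroup B] [AddCommGroup C] [Module k A]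
    [Module k B] [Module k C] (β : A →ₗ[k] B →ₗ[k] C) :
    (ℤ →₀ A) →ₗ[k] (ℤ →₀ B) →ₗ[k] (ℤ →₀ C) :=
  Finsupp.lsum k (fun a : ℤ =>
    (Finsupp.lsum k (fun b : ℤ => (β.compr₂ (Finsupp.lsingle (a + b))).flip)).flip)

lemma conv_single {A B C : Type u} [AddCommGroup A] [AddCommGroup B] [AddCommGroup C] [Module k A]
    [Module k B] [Module k C] (β : A →ₗ[k] B →ₗ[k] C) (a b : ℤ) (x : A) (y : B) :
    conv β (Finsupp.single a x) (Finsupp.single b y) = Finsupp.single (a + b) (β x y) := by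
  simp [conv]

/-- Auxiliary: the homogeneous components of a pure tensor. -/
def splitStr (f : ∀ X Y, M X Y →ₗ[k] (ℤ →₀ M X Y)) {X : O} :
    {Y : O} → (p : Str M X Y) → (n : ℕ) → p.length = n → (ℤ →₀ TPow k M n X Y)
  | _, Str.nil, _, h => Finsupp.single 0 (mk Str.nil h)
  | _, Str.snoc p x, n + 1, h =>
      conv (snoc n _ _ _) (splitStr f p n (Nat.succ.inj h)) (f _ _ x)
  | _, Str.snoc _ _, 0, h => nomatch h

lemma splitStr_multilinear (f : ∀ X Y, M X Y →ₗ[k] (ℤ →₀ M X Y)) {n : ℕ} {X Y : O} :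
    IsMultilinear k (fun (p : Str M X Y) (h : p.length = n) => splitStr f p n h) where
  map_add l x y r h h₁ h₂ := by
    induction r generalizing n with
    | nil =>
      cases n with
      | zero => nomatch h
      | succ n => simp [Str.append, splitStr]
    | snoc r z ih =>
      cases n with
      | zero => nomatch h
      | succ n =>
        simp only [Str.append, splitStr]
        rw [ih (Nat.succ.inj h) (Nat.succ.inj h₁) (Nat.succ.inj h₂)]
        simp
  map_smul l c x r h h₁ := by
    induction r generalizing n with
    | nil =>
      cases n with
      | zero => nomatch h
      | succ n => simp [Str.append, splitStr]
    | snoc r z ih =>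
      cases n with
      | zero => nomatch h
      | succ n =>
        simp only [Str.append, splitStr]
        rw [ih (Nat.succ.inj h) (Nat.succ.inj h₁)]
        simp

lemma gr_internal {g : ∀ X Y, ℤ → Submodule k (M X Y)}
    (hg : ∀ X Y, DirectSum.IsInternal (g X Y)) (n : ℕ) (X Y : O) :
    DirectSum.IsInternal (gr g n X Y) := by
  choose f hf using fun X Y => exists_split (g X Y) (hg X Y)
  refine isInternal_of_split _ (lift (fun p h => splitStr f p n h) (splitStr_multilinear f)) ?_ ?_
  · intro e
    suffices h : ∀ {X Y : O} (p : Str M X Y) (n : ℕ) (h : p.length = n) (e : ℤ), p.IsHomog g e →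
        splitStr f p n h = Finsupp.single e (mk p h) by
      intro t ht
      induction ht using Submodule.span_induction with
      | mem t ht => obtain ⟨p, hp, hh, rfl⟩ := ht; rw [lift_mk, h p n hp e hh]
      | zero => simp
      | add x y _ _ hx hy => rw [map_add, hx, hy, Finsupp.single_add]
      | smul c x _ hx => rw [map_smul, hx, Finsupp.smul_single]
    intro X Y p
    induction p with
    | nil => intro n h e he; rw [show e = 0 from he]; simp [splitStr]
    | snoc p x ih =>
      rintro n h e ⟨a, b, ha, hb, rfl⟩
      cases n with
      | zero => nomatch h
      | succ n =>
        simp only [splitStr]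
        rw [ih n (Nat.succ.inj h) a ha, hf _ _ b x hb, conv_single, snoc_mk]
  · rw [eq_top_iff, ← span_mk, Submodule.span_le]
    rintro _ ⟨p, h, rfl⟩
    induction p generalizing n with
    | nil =>
      exact Submodule.mem_iSup_of_mem 0 (Submodule.subset_span ⟨Str.nil, h, rfl, rfl⟩)
    | @snoc Y Z p x ih =>
      cases n with
      | zero => nomatch h
      | succ n =>
        have h1 := ih n (Nat.succ.inj h)
        rw [← snoc_mk (k := k) p (Nat.succ.inj h) x]
        have h2 : x ∈ ⨆ b, g Y Z b := by
          rw [(hg Y Z).submodule_iSup_eq_top]; trivial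
        generalize (mk p (Nat.succ.inj h) : TPow k M n X Y) = t at h1
        induction h1 using Submodule.iSup_induction' with
        | mem a t ht =>
          induction h2 using Submodule.iSup_induction' with
          | mem b x hx => exact Submodule.mem_iSup_of_mem (a + b) (snoc_mem_gr g ht hx)
          | zero => simp
          | add x y _ _ hx hy =>
            rw [map_add]; exact Submodule.add_mem _ (hx h) (hy h)
        | zero => simp
        | add t t' _ _ ht ht' =>
          rw [map_add, LinearMap.add_apply]; exact Submodule.add_mem _ ht ht'

end TPow

/-- Auxiliary: shifted direct sums of graded modules are graded. -/
lemma isInternal_directSum {S : Type} {N : S → Type u} [DecidableEq S] [∀ s, AddCommGroup (N s)]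
    [∀ s, Module k (N s)] (g : ∀ s, ℤ → Submodule k (N s))
    (hg : ∀ s, DirectSum.IsInternal (g s)) (w : S → ℤ) :
    DirectSum.IsInternal
      (fun d => ⨆ s, (g s (d - w s)).map (DirectSum.lof k S N s)) := by
  choose f hf using fun s => exists_split (g s) (hg s)
  refine isInternal_of_split _ (DirectSum.toModule k S _ (fun s =>
    (Finsupp.lsum k (fun a : ℤ => Finsupp.lsingle (a + w s) ∘ₗ DirectSum.lof k S N s)) ∘ₗ f s)) ?_ ?_
  · intro d x hx
    induction hx using Submodule.iSup_induction' with
    | mem s x hx =>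
      obtain ⟨y, hy, rfl⟩ := hx
      rw [DirectSum.toModule_lof, LinearMap.comp_apply, hf s _ y hy]
      simp
    | zero => simp
    | add x y _ _ hx hy => rw [map_add, hx, hy, Finsupp.single_add]
  · rw [eq_top_iff]
    rintro x -
    induction x using DirectSum.induction_on with
    | zero => exact Submodule.zero_mem _
    | add x y hx hy => exact Submodule.add_mem _ hx hy
    | of s y =>
      have hy : y ∈ ⨆ a, g s a := by rw [(hg s).submodule_iSup_eq_top]; trivial
      rw [← DirectSum.lof_eq_of k]
      induction hy using Submodule.iSup_induction' with
      | mem a y hy =>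
        refine Submodule.mem_iSup_of_mem (a + w s) (Submodule.mem_iSup_of_mem s ⟨y, ?_, rfl⟩)
        rwa [add_sub_cancel_right]
      | zero => simp
      | add x y _ _ hx hy => rw [map_add]; exact Submodule.add_mem _ hx hy

end Tensor

/-- The differential `∑ 1 ⊗ ⋯ ⊗ 1 ⊗ d ⊗ 1 ⊗ ⋯ ⊗ 1` on pure tensors of elements of `sQ`, where
`d = s⁻¹ d s` is the differential of `sQ`. Operators act from the right, so that
`(y ⊗ x) d = (-1)^{deg x} (y) d ⊗ x + y ⊗ (x) d`, the degrees being those of `sQ`. -/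
def dStr {k : Type u} [CommRing k] (Q : DGQuiver k) {X : Q.Ob} :
    {Y : Q.Ob} → (p : Str Q.Hom X Y) → (n : ℕ) → p.length = n → TPow k Q.Hom n X Y
  | _, Str.nil, _, _ => 0
  | _, Str.snoc p x, n + 1, h =>
      TPow.snoc n _ _ _ (dStr Q p n (Nat.succ.inj h)) (Q.sσ _ _ x) +
      TPow.mk (p.snoc (Q.d _ _ x)) h
  | _, Str.snoc _ _, 0, h => nomatch h

lemma dStr_multilinear {k : Type u} [CommRing k] (Q : DGQuiver k) {n : ℕ} {X Y : Q.Ob} :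
    TPow.IsMultilinear k (fun (p : Str Q.Hom X Y) (h : p.length = n) => dStr Q p n h) where
  map_add l x y r h h₁ h₂ := by
    induction r generalizing n with
    | nil =>
      cases n with
      | zero => nomatch h
      | succ n =>
        have h3 := (TPow.mk_multilinear (k := k)).map_add l (Q.d _ _ x) (Q.d _ _ y)
          Str.nil h h₁ h₂
        simp only [Str.append] at h3
        simp only [Str.append, dStr, map_add]
        rw [h3]; abel
    | snoc r z ih =>
      cases n with
      | zero => nomatch h
      | succ n =>
        have h3 := (TPow.mk_multilinear (k := k)).map_add l x y
          (r.snoc (Q.d _ _ z)) h h₁ h₂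
        simp only [Str.append] at h3
        simp only [Str.append, dStr]
        rw [ih (Nat.succ.inj h) (Nat.succ.inj h₁) (Nat.succ.inj h₂), h3, map_add,
          LinearMap.add_apply]
        abel
  map_smul l c x r h h₁ := by
    induction r generalizing n with
    | nil =>
      cases n with
      | zero => nomatch h
      | succ n =>
        have h3 := (TPow.mk_multilinear (k := k)).map_smul l c (Q.d _ _ x)
          Str.nil h h₁
        simp only [Str.append] at h3
        simp only [Str.append, dStr, map_smul]
        rw [h3, smul_add]
    | snoc r z ih =>
      cases n with
      | zero => nomatch h
      | succ n =>
        have h3 := (TPow.mk_multilinear (k := k)).map_smul l c x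
          (r.snoc (Q.d _ _ z)) h h₁
        simp only [Str.append] at h3
        simp only [Str.append, dStr]
        rw [ih (Nat.succ.inj h) (Nat.succ.inj h₁), h3, map_smul,
          LinearMap.smul_apply, smul_add]

/-- The differential of `TⁿsQ (X, Y)`. -/
def tensorD {k : Type u} [CommRing k] (Q : DGQuiver k) (n : ℕ) (X Y : Q.Ob) :
    TPow k Q.Hom n X Y →ₗ[k] TPow k Q.Hom n X Y :=
  TPow.lift (fun p h => dStr Q p n h) (dStr_multilinear Q)

/-! ### Trees -/

/-- Plane rooted trees: the trivial tree `|` without internal vertices, or the tree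
`(t₁ ⊔ ⋯ ⊔ tₖ) · 𝔱ₖ` with trees `t₁, …, tₖ` grafted onto the inputs of a lowest vertex. -/
inductive PTree : Type
  | leaf : PTree
  | node : List PTree → PTree

namespace PTree

mutual
/-- The number `n` of input vertices. -/
def leaves : PTree → ℕ
  | leaf => 1
  | node ts => leavesL ts
/-- The number of input vertices of a forest. -/
def leavesL : List PTree → ℕ
  | [] => 0
  | t :: ts => leaves t + leavesL ts
end

mutual
/-- The number `|t|` of internal vertices. -/
def size : PTree → ℕ
  | leaf => 0
  | node ts => 1 + sizeL ts
/-- The number of internal vertices of a forest. -/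
def sizeL : List PTree → ℕ
  | [] => 0
  | t :: ts => size t + sizeL ts
end

mutual
/-- Every internal vertex has at least two inputs (that is, at least three adjacent edges). -/
def Good : PTree → Prop
  | leaf => True
  | node ts => 2 ≤ ts.length ∧ GoodL ts
/-- All trees of the forest are good. -/
def GoodL : List PTree → Prop
  | [] => True
  | t :: ts => Good t ∧ GoodL ts
end

/-- All ways to write a list as `l ++ q`. -/
def cuts {α : Type} : List α → List (List α × List α)
  | [] => [([], [])]
  | a :: l => ([], a :: l) :: (cuts l).map (fun s => (a :: s.1, s.2))

/-- All ways to write a list as `l ++ m ++ r` with `m` of length at least two and not the whole list. -/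
def innerCuts {α : Type} (ts : List α) : List (List α × List α × List α) :=
  (cuts ts).flatMap (fun s =>
    ((cuts s.2).filter (fun s' => 2 ≤ s'.1.length ∧ s'.1.length < ts.length)).map
      (fun s' => (s.1, s'.1, s'.2)))

mutual
/-- For a good tree `t`, the list of all `t'` with a distinguished internal edge `e`
such that contracting `e` yields `t` and such that all internal vertices of `t'` have at least two inputs. It
is given as a list of pairs `(h, t')`, with `h` the height of the highest vertex of `e`, i.e. the position
(starting from `1`) of that vertex in the linear order of the internal vertices of `t'`, in which each
vertex precedes the vertices above it, and the vertices of a left branch precede those of a right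
branch. Either `e` contracts to the root vertex `v` of `t`, and `t'` is
obtained by collecting at least two but not all consecutive branches of `v` in a new vertex, or `e` is
in one of the branches of `v`. -/
def expand : PTree → List (ℕ × PTree)
  | leaf => []
  | node ts =>
      (innerCuts ts).map (fun s => (1 + sizeL s.1 + 1, node (s.1 ++ node s.2.1 :: s.2.2))) ++
      (expandL ts).map (fun s => (1 + s.1, node s.2))
/-- The same for forests, the edge being in one of the trees of the forest. -/
def expandL : List PTree → List (ℕ × List PTree)
  | [] => []
  | t :: ts =>
      (expand t).map (fun s => (s.1, s.2 :: ts)) ++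
      (expandL ts).map (fun s => (size t + s.1, t :: s.2))
end

lemma leavesL_append (l m : List PTree) : leavesL (l ++ m) = leavesL l + leavesL m := by
  induction l with
  | nil => simp [leavesL]
  | cons t l ih => simp only [List.cons_append, leavesL, ih]; omega

lemma goodL_append (l m : List PTree) : GoodL (l ++ m) ↔ GoodL l ∧ GoodL m := by
  induction l with
  | nil => simp [GoodL]
  | cons t l ih => simp only [List.cons_append, GoodL, ih]; tauto

lemma mem_cuts {α : Type} {ts : List α} {s : List α × List α} (h : s ∈ cuts ts) :
    s.1 ++ s.2 = ts := by
  induction ts generalizing s with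
  | nil => simp only [cuts, List.mem_singleton] at h; simp [h]
  | cons a l ih =>
    simp only [cuts, List.mem_cons, List.mem_map] at h
    rcases h with rfl | ⟨s', hs', rfl⟩
    · simp
    · simp [ih hs']

lemma mem_innerCuts {α : Type} {ts : List α} {s : List α × List α × List α}
    (h : s ∈ innerCuts ts) :
    s.1 ++ (s.2.1 ++ s.2.2) = ts ∧ 2 ≤ s.2.1.length ∧ s.2.1.length < ts.length := by
  simp only [innerCuts, List.mem_flatMap, List.mem_map, List.mem_filter, decide_eq_true_eq] at h
  obtain ⟨a, ha, b, ⟨hb, hb'⟩, rfl⟩ := h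
  exact ⟨by rw [mem_cuts hb, mem_cuts ha], hb'⟩

mutual
lemma expand_spec : (t : PTree) → t.Good → ∀ s ∈ expand t, s.2.Good ∧ s.2.leaves = t.leaves
  | leaf, _, s, hs => by simp [expand] at hs
  | node ts, ht, s, hs => by
      simp only [expand, List.mem_append, List.mem_map] at hs
      rw [Good] at ht
      rcases hs with ⟨c, hc, rfl⟩ | ⟨c, hc, rfl⟩
      · obtain ⟨h1, h2, h3⟩ := mem_innerCuts hc
        have h4 := ht.2
        rw [← h1, goodL_append, goodL_append] at h4
        have h5 : c.1.length + (c.2.1.length + c.2.2.length) = ts.length := by simp [← h1]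
        simp only [Good, goodL_append, GoodL, leaves, leavesL_append, leavesL, ← h1,
          List.length_append, List.length_cons]
        refine ⟨⟨by omega, h4.1, ⟨h2, h4.2.1⟩, h4.2.2⟩, trivial⟩
      · obtain ⟨h1, h2, h3⟩ := expandL_spec ts ht.2 c hc
        simp only [Good, leaves]
        exact ⟨⟨h3 ▸ ht.1, h1⟩, h2⟩
lemma expandL_spec : (ts : List PTree) → GoodL ts → ∀ s ∈ expandL ts,
    GoodL s.2 ∧ leavesL s.2 = leavesL ts ∧ s.2.length = ts.length
  | [], _, s, hs => by simp [expandL] at hs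
  | t :: ts, ht, s, hs => by
      simp only [expandL, List.mem_append, List.mem_map] at hs
      rw [GoodL] at ht
      rcases hs with ⟨c, hc, rfl⟩ | ⟨c, hc, rfl⟩
      · obtain ⟨h1, h2⟩ := expand_spec t ht.1 c hc
        simp only [GoodL, leavesL, List.length_cons]
        exact ⟨⟨h1, ht.2⟩, by rw [h2], trivial⟩
      · obtain ⟨h1, h2, h3⟩ := expandL_spec ts ht.2 c hc
        simp only [GoodL, leavesL, List.length_cons]
        exact ⟨⟨ht.1, h1⟩, by rw [h2], by rw [h3]⟩
end

end PTree

/-- The trees all of whose internal vertices have at least two inputs. -/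
def GTree : Type := {t : PTree // t.Good}

/-- Sequences of `j` such trees. -/
def GForest (j : ℕ) : Type := {ts : List PTree // ts.length = j ∧ PTree.GoodL ts}

instance : DecidableEq GTree := Classical.decEq _
instance (j : ℕ) : DecidableEq (GForest j) := Classical.decEq _

/-- The trivial tree. -/
def GTree.leaf : GTree := ⟨PTree.leaf, by simp [PTree.Good]⟩

def GForest.empty : GForest 0 := ⟨[], rfl, by simp [PTree.GoodL]⟩

def GForest.snoc {j : ℕ} (F : GForest j) (t : GTree) : GForest (j + 1) :=
  ⟨F.1 ++ [t.1], by simp [F.2.1], by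
    rw [PTree.goodL_append]; simpa [PTree.GoodL] using ⟨F.2.2, t.2⟩⟩

/-- `(t₁ ⊔ ⋯ ⊔ tⱼ) · 𝔱ⱼ` for `j ≥ 2`. -/
def GForest.node {j : ℕ} (hj : 2 ≤ j) (F : GForest j) : GTree :=
  ⟨PTree.node F.1, by rw [PTree.Good]; exact ⟨by rw [F.2.1]; exact hj, F.2.2⟩⟩

/-! ### The free A∞-category -/

section Free

variable {k : Type u} [CommRing k] (Q : DGQuiver k)

/-- The total module of `s𝓕Q (X, Y) = ⨁ₜ TⁿsQ (X, Y)[-|t|]`, where `t` runs over the plane rooted trees with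
all internal vertices of arity at least two and `n` is the number of inputs of `t`. -/
abbrev FreeHom (X Y : Q.Ob) : Type u := ⨁ t : GTree, TPow k Q.Hom t.1.leaves X Y

/-- The grading of `s𝓕Q (X, Y)`: the summand of `t` is shifted by `-|t|`. -/
def freeSGr (X Y : Q.Ob) (d : ℤ) : Submodule k (FreeHom Q X Y) :=
  ⨆ t : GTree, (TPow.gr Q.sgr t.1.leaves X Y (d - t.1.size)).map
    (DirectSum.lof k GTree (fun t => TPow k Q.Hom t.1.leaves X Y) t)

lemma freeSGr_internal (X Y : Q.Ob) : DirectSum.IsInternal (freeSGr Q X Y) :=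
  isInternal_directSum (fun t : GTree => TPow.gr Q.sgr t.1.leaves X Y)
    (fun t => TPow.gr_internal Q.sgr_internal t.1.leaves X Y) (fun t => (t.1.size : ℤ))

/-- The map `x ↦ (-1)^{deg x} x` of `s𝓕Q`. -/
def freeSσ (X Y : Q.Ob) : FreeHom Q X Y →ₗ[k] FreeHom Q X Y :=
  parity (freeSGr Q X Y) (freeSGr_internal Q X Y)

/-- The operation `b₁` of `s𝓕Q`. On the summand of `t` it is the differential of `TⁿsQ[-|t|]`, which is
`(-1)^{|t|}` times that of `TⁿsQ`, plus the sum of the maps `(-1)^{1+h} s⁻¹` to the summands of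
all trees `t'` with a distinguished edge whose contraction gives `t`, where `h` is the height in `t'` of
the highest vertex of that edge. -/
def freeB1 (X Y : Q.Ob) : FreeHom Q X Y →ₗ[k] FreeHom Q X Y :=
  DirectSum.toModule k GTree _ (fun t =>
    (-1 : k) ^ t.1.size • (DirectSum.lof k GTree _ t ∘ₗ tensorD Q t.1.leaves X Y) +
    ((PTree.expand t.1).attach.map (fun s =>
      (-1 : k) ^ (1 + s.1.1) •
        (DirectSum.lof k GTree (fun t => TPow k Q.Hom t.1.leaves X Y)
            ⟨s.1.2, (PTree.expand_spec t.1 t.2 s.1 s.2).1⟩ ∘ₗ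
          TPow.cast (PTree.expand_spec t.1 t.2 s.1 s.2).2.symm X Y))).sum)

/-- Tensors on the leaves of forests of `j` trees. -/
abbrev ForestHom (j : ℕ) (X Y : Q.Ob) : Type u :=
  ⨁ F : GForest j, TPow k Q.Hom (PTree.leavesL F.1) X Y

/-- `(z, y) ↦ (-1)^{m deg y} z ⊗ y`, where `z` is in the summand of a forest `F` with `m` internal
vertices and `deg` is the degree in `s𝓕Q`. -/
def graft (j : ℕ) (X Y Z : Q.Ob) :
    ForestHom Q j X Y →ₗ[k] FreeHom Q Y Z →ₗ[k] ForestHom Q (j + 1) X Z :=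
  DirectSum.toModule k (GForest j) _ (fun F =>
    LinearMap.flip
      ((DirectSum.toModule k GTree _ (fun t => LinearMap.flip
        ((TPow.mul (PTree.leavesL F.1) t.1.leaves X Y Z).compr₂
          (DirectSum.lof k (GForest (j + 1)) (fun F => TPow k Q.Hom (PTree.leavesL F.1) X Z)
              (F.snoc t) ∘ₗ
            TPow.cast (by simp [GForest.snoc, PTree.leavesL_append, PTree.leavesL]) X Z)))) ∘ₗ
        (freeSσ Q Y Z ^ PTree.sizeL F.1)))

/-- For `yᵢ` in the summands of `tᵢ`, the tensor
`(y₁ ⊗ ⋯ ⊗ yⱼ)(s^{|t₁|} ⊗ ⋯ ⊗ s^{|tⱼ|}) = (-1)^{∑_{i<l} |tᵢ| deg yₗ} y₁ s^{|t₁|} ⊗ ⋯ ⊗ yⱼ s^{|tⱼ|}` in the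
summand of the forest `t₁ ⊔ ⋯ ⊔ tⱼ`. -/
def graftStr {X : Q.Ob} : {Y : Q.Ob} → (p : Str (FreeHom Q) X Y) → ForestHom Q p.length X Y
  | _, Str.nil =>
      DirectSum.lof k (GForest 0) (fun F => TPow k Q.Hom (PTree.leavesL F.1) X X) GForest.empty
        (TPow.mk Str.nil (by simp [GForest.empty, PTree.leavesL, Str.length]))
  | _, Str.snoc p y => graft Q p.length _ _ _ (graftStr p) y

/-- The identification of the summand of `t₁ ⊔ ⋯ ⊔ tⱼ` with the summand of
`(t₁ ⊔ ⋯ ⊔ tⱼ) · 𝔱ⱼ`, where `j ≥ 2`. -/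
def close {j : ℕ} (hj : 2 ≤ j) (X Y : Q.Ob) : ForestHom Q j X Y →ₗ[k] FreeHom Q X Y :=
  DirectSum.toModule k (GForest j) _ (fun F =>
    DirectSum.lof k GTree (fun t => TPow k Q.Hom t.1.leaves X Y) (F.node hj) ∘ₗ
      TPow.cast (by simp [GForest.node, PTree.leaves]) X Y)

/-- The operations of `s𝓕Q`: `b₁` as above, and for `j ≥ 2` the direct sum of the maps
`bⱼ = s^{|t₁|} ⊗ ⋯ ⊗ s^{|tⱼ₋₁|} ⊗ s^{|tⱼ|-|t|}`, where `t = (t₁ ⊔ ⋯ ⊔ tⱼ) · 𝔱ⱼ`. -/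
def freeB {X : Q.Ob} : {Y : Q.Ob} → Str (FreeHom Q) X Y → FreeHom Q X Y
  | _, Str.nil => 0
  | _, Str.snoc Str.nil y => freeB1 Q _ _ y
  | _, Str.snoc (Str.snoc p x) y =>
      close Q (Nat.le_add_left 2 p.length) _ _ (graftStr Q ((p.snoc x).snoc y))

/-- The graded quiver `𝓕Q` with its operations. -/
def freePre : PreAInf k where
  Ob := Q.Ob
  Hom := FreeHom Q
  gr X Y d := freeSGr Q X Y (d + -1)
  internal X Y := isInternal_shift (freeSGr_internal Q X Y) (-1)
  b := freeB Q

/-- The free A∞-category `𝓕Q`, given that its operations satisfy the axioms. -/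
def free (h : (freePre Q).IsAInf) : AInfCategory k := ⟨freePre Q, h⟩

/-- The embedding of `Q` onto the summand of the trivial tree. -/
def incl (X Y : Q.Ob) : Q.Hom X Y →ₗ[k] FreeHom Q X Y :=
  DirectSum.lof k GTree (fun t => TPow k Q.Hom t.1.leaves X Y) GTree.leaf ∘ₗ
    { toFun := fun x => TPow.mk (Str.one x)
        (by simp [GTree.leaf, PTree.leaves, Str.one, Str.length])
      map_add' := fun x y => TPow.mk_multilinear.map_add Str.nil x y Str.nil _ _ _
      map_smul' := fun c x => TPow.mk_multilinear.map_smul Str.nil c x Str.nil _ _ }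

lemma incl_mem (X Y : Q.Ob) (e : ℤ) (x : Q.Hom X Y) (hx : x ∈ Q.sgr X Y e) :
    incl Q X Y x ∈ freeSGr Q X Y e := by
  refine Submodule.mem_iSup_of_mem GTree.leaf ⟨_, ?_, rfl⟩
  refine Submodule.subset_span ⟨Str.one x, _, ⟨0, e, rfl, hx, ?_⟩, rfl⟩
  simp [GTree.leaf, PTree.size]

lemma freeB1_incl (X Y : Q.Ob) (x : Q.Hom X Y) :
    freeB1 Q X Y (incl Q X Y x) = incl Q X Y (Q.d X Y x) := by
  have h1 : ∀ (t : PTree) (ht : t = PTree.leaf), t.expand = [] := by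
    rintro _ rfl; simp [PTree.expand]
  have h2 : PTree.expand GTree.leaf.1 = [] := h1 _ rfl
  have h3 : GTree.leaf.1.size = 0 := by simp [GTree.leaf, PTree.size]
  have h4 : ∀ (n : ℕ) (h : (Str.one x).length = n), dStr Q (Str.one x) n h =
      TPow.mk (Str.one (Q.d X Y x)) h := by
    rintro n rfl
    simp only [Str.one, Str.length]
    simp [dStr]
  have h5 : ((PTree.expand GTree.leaf.1).attach) = [] := by
    rw [List.attach_eq_nil_iff]; exact h2
  rw [incl, LinearMap.comp_apply, freeB1, DirectSum.toModule_lof, h5, h3]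
  simp only [List.map_nil, List.sum_nil, add_zero, pow_zero, one_smul, LinearMap.comp_apply]
  congr 1
  exact (TPow.lift_mk _ (dStr_multilinear Q) _ _).trans (h4 _ _)

/-- The restriction `g ↦ (Ob g, g₁|_{sQ})` of a strict A∞-functor `g : 𝓕Q → A` to `Q`, as a morphism of
differential graded quivers `Q → (A, m₁)`. -/
def restr (h : (freePre Q).IsAInf) (A : AInfCategory k)
    (g : StrictAInfFunctor (free Q h) A) : DGQuiverHom Q A.toDG where
  obj := g.obj
  map X Y :=
    { toFun := fun x => g.comp (X := X) (Y := Y) (Str.one (incl Q X Y x))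
      map_add' := fun x y => by
        rw [map_add]
        exact (g.comp_multilinear X Y).map_add Str.nil _ _ Str.nil
      map_smul' := fun c x => by
        rw [map_smul]
        exact (g.comp_multilinear X Y).map_smul Str.nil c _ Str.nil }
  map_mem X Y e x hx := by
    have h1 : x ∈ Q.sgr X Y (e - 1) := by simpa [GradedQuiver.sgr] using hx
    have h2 := incl_mem Q X Y (e - 1) x h1
    have h3 := g.comp_mem (X := X) (Y := Y) (Str.one (incl Q X Y x)) (e - 1)
      ⟨0, e - 1, rfl, by
        show _ ∈ freeSGr Q X Y (e - 1 + 1 + -1)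
        rwa [add_neg_cancel_right], by omega⟩
    rw [GradedQuiver.sgr, sub_add_cancel] at h3
    exact h3
  map_d X Y x := by
    have h1 := g.comp_b (X := X) (Y := Y) (Str.one (incl Q X Y x)) le_rfl
    have h2 : (free Q h).b (X := X) (Y := Y) (Str.one (incl Q X Y x)) =
        incl Q X Y (Q.d X Y x) := freeB1_incl Q X Y x
    simp only [Str.one, Str.infixes, Str.splits, Str.blocks, Str.length, Str.append, Str.map,
      List.map_nil, List.map_cons, List.nil_append, List.append_nil, if_true, List.sum_cons,
      List.sum_nil, add_zero] at h1
    exact (h1.trans (congrArg (fun z => g.comp (X := X) (Y := Y) (Str.one z)) h2)).symm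

end Free

end FreeAInf

end

open FreeAInf

noncomputable section

namespace FreeAInf

/-! ### Sums over the splittings of a string -/

namespace Str

variable {O : Type u} {M : O → O → Type u}

-- The free quiver is a cobar-type construction: an element of $s\mathcal F\mathcal Q$ is a
-- combination of trees decorated by tensors, and a string of such elements is a combination of
-- forests decorated by tensors. `forestsMul` concatenates forests and their tensors with the Koszul
-- sign of moving the shift of the left forest past the right factor. It is associative, and
-- `freeB_eq_plant` shows that every $b_n$ with $n\ge2$ is one map `plant` (join all roots to a new
-- lowest vertex) applied to the product `forestsProd` of the entries. After that the signs of the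
-- higher operations no longer have to be treated one arity at a time. Tensors are taken in `TStr`,
-- which has no length index, so that concatenation and expansion of trees need no casts; the number
-- of factors is recorded by membership in `TStr.len`.
--
-- The coderivation with components $b_n$ becomes on forests the sum `forestsD + forestsN`: the
-- differential inside single trees, plus the collection of at least two consecutive trees under a
-- new vertex (`bSum_forestsProd`). Expanding an edge of a planted tree means either expanding an
-- edge of one branch or collecting some of the branches of the root; as the root adds one to all
-- positions, $b_1$ anticommutes past `plant` into the same sum (`freeB1_plant`). These two facts
-- cancel against each other and give the $A_\infty$ identity on strings of length at least two.
--
-- The identity $b_1^2=0$ is not checked on trees. $\mathcal F\mathcal Q$ is generated by $\mathcal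
-- Q$ under the $b_n$ with $n\ge2$ (`mem_of_containsGenerated`), and $b_1^2=d^2=0$ on $\mathcal Q$.
-- The square of an odd coderivation is a coderivation, and its components on longer strings are
-- already known to vanish; hence $\ker b_1^2$ is closed under $b_n$ for $n\ge2$
-- (`bSum_bSum_eq_zero`, `freeB1_freeB1`).
--
-- The extension of $f$ is defined by recursion on trees, a vertex being sent to the operation of
-- $\mathcal A$, so it respects $b_n$ for $n\ge2$ (`hatFree_freeB`). It respects $b_1$ on $\mathcal
-- Q$ because $f$ is a chain map, and then everywhere by generation and the $A_\infty$ identities of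
-- both sides (`DGQuiverHom.hat_freeB1`). Uniqueness is generation once more: the linear part of a
-- strict functor respects all $b_n$ (`hat_restr`).

lemma nil_append {X Y : O} (p : Str M X Y) : (nil : Str M X X).append p = p := by
  induction p with
  | nil => rfl
  | snoc p x ih => simp only [append, ih]

lemma map_append {O' : Type u} {N : O' → O' → Type u} (φ : O → O')
    (f : ∀ X Y, M X Y → N (φ X) (φ Y)) {X Y Z : O} (p : Str M X Y) (q : Str M Y Z) :
    (p.append q).map φ f = (p.map φ f).append (q.map φ f) := by
  induction q with
  | nil => rfl
  | snoc q x ih => simp only [append, map, ih]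

lemma length_map {O' : Type u} {N : O' → O' → Type u} (φ : O → O')
    (f : ∀ X Y, M X Y → N (φ X) (φ Y)) {X Y : O} (p : Str M X Y) :
    (p.map φ f).length = p.length := by
  induction p with
  | nil => rfl
  | snoc p x ih => simp only [length, map, ih]

/-- All entries of the string satisfy `S`. -/
def Forall (S : ∀ X Y, M X Y → Prop) {X : O} : {Y : O} → Str M X Y → Prop
  | _, nil => True
  | _, snoc p x => Forall S p ∧ S _ _ x

lemma forall_append {S : ∀ X Y, M X Y → Prop} {X Y Z : O} (p : Str M X Y) (q : Str M Y Z) :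
    (p.append q).Forall S ↔ p.Forall S ∧ q.Forall S := by
  induction q with
  | nil => simp [append, Forall]
  | snoc q x ih => simp only [append, Forall, ih, and_assoc]

lemma exists_append_of_length {X Y : O} (p : Str M X Y) (m n : ℕ) (h : p.length = m + n) :
    ∃ (Z : O) (l : Str M X Z) (r : Str M Z Y), l.length = m ∧ r.length = n ∧ l.append r = p := by
  induction n generalizing Y with
  | zero => exact ⟨Y, p, nil, h, rfl, rfl⟩
  | succ n ih =>
    cases p with
    | nil => simp only [length] at h; omega
    | snoc p x =>
      obtain ⟨Z, l, r, hl, hr, rfl⟩ := ih p (by simp only [length] at h; omega)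
      exact ⟨Z, l, r.snoc x, hl, by simp only [length, hr], rfl⟩

section splitSum

variable {N : Type u} [AddCommGroup N]

/-- The sum of `ψ l r` over all ways to write a string as `l · r`. -/
def splitSum {X Y : O} (ψ : ∀ Z, Str M X Z → Str M Z Y → N) (p : Str M X Y) : N :=
  (p.splits.map (fun s => ψ s.1 s.2.1 s.2.2)).sum

@[simp]
lemma splitSum_nil {X : O} (ψ : ∀ Z, Str M X Z → Str M Z X → N) :
    splitSum ψ nil = ψ X nil nil := by
  simp [splitSum, splits]

lemma splitSum_snoc {X Y Z : O} (ψ : ∀ W, Str M X W → Str M W Z → N) (p : Str M X Y) (x : M Y Z) :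
    splitSum ψ (p.snoc x) = splitSum (fun W l r => ψ W l (r.snoc x)) p + ψ Z (p.snoc x) nil := by
  simp [splitSum, splits, Function.comp_def]

lemma splitSum_congr {X Y : O} {ψ ψ' : ∀ Z, Str M X Z → Str M Z Y → N} {p : Str M X Y}
    (h : ∀ Z l r, l.append r = p → ψ Z l r = ψ' Z l r) : splitSum ψ p = splitSum ψ' p := by
  induction p with
  | nil => simpa using h _ nil nil rfl
  | snoc p x ih =>
    rw [splitSum_snoc, splitSum_snoc, h _ _ nil rfl,
      ih (fun Z l r hlr => h _ _ _ (by rw [append, hlr]))]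

lemma splitSum_add {X Y : O} (ψ ψ' : ∀ Z, Str M X Z → Str M Z Y → N) (p : Str M X Y) :
    splitSum (fun Z l r => ψ Z l r + ψ' Z l r) p = splitSum ψ p + splitSum ψ' p := by
  simp [splitSum]

lemma splitSum_zero {X Y : O} (p : Str M X Y) :
    splitSum (fun _ _ _ => (0 : N)) p = 0 := by
  simp [splitSum]

lemma map_splitSum {N' F : Type u} [AddCommGroup N'] [FunLike F N N'] [AddMonoidHomClass F N N']
    (f : F) {X Y : O} (ψ : ∀ Z, Str M X Z → Str M Z Y → N) (p : Str M X Y) :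
    f (splitSum ψ p) = splitSum (fun Z l r => f (ψ Z l r)) p := by
  simp [splitSum, map_list_sum, Function.comp_def]

/-- Coassociativity of deconcatenation: both sides run over the cuts of `p` into three pieces. -/
lemma splitSum_coassoc {X Y : O}
    (F : ∀ Z W, Str M X Z → Str M Z W → Str M W Y → N) (p : Str M X Y) :
    splitSum (fun W l r => splitSum (fun Z l' r' => F Z W l' r' r) l) p =
      splitSum (fun Z l r => splitSum (fun W l' r' => F Z W l l' r') r) p := by
  induction p with
  | nil => simp
  | snoc p x ih =>
    simp only [splitSum_snoc, splitSum_nil, splitSum_add, ih, add_assoc]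

lemma splitSum_map {O' : Type u} {M' : O' → O' → Type u} (φ : O → O')
    (f : ∀ X Y, M X Y → M' (φ X) (φ Y)) {X Y : O}
    (ψ : ∀ Z, Str M' (φ X) Z → Str M' Z (φ Y) → N) (p : Str M X Y) :
    splitSum ψ (p.map φ f) = splitSum (fun Z l r => ψ (φ Z) (l.map φ f) (r.map φ f)) p := by
  induction p with
  | nil => simp [map]
  | snoc p x ih => simp only [map, splitSum_snoc, ih]

/-- Only the splitting with empty right part contributes. -/
lemma splitSum_eq_of_right {X Y : O} {ψ : ∀ Z, Str M X Z → Str M Z Y → N} {p : Str M X Y}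
    (h : ∀ Z l r, l.append r = p → 1 ≤ r.length → ψ Z l r = 0) : splitSum ψ p = ψ Y p nil := by
  cases p with
  | nil => simp
  | snoc p x =>
    rw [splitSum_snoc, splitSum_congr (ψ' := fun _ _ _ => 0), splitSum_zero, zero_add]
    exact fun Z l r hlr => h _ _ _ (by rw [append, hlr]) (by simp [length])

/-- Only the splitting with empty left part contributes. -/
lemma splitSum_eq_of_left {X Y : O} {ψ : ∀ Z, Str M X Z → Str M Z Y → N} {p : Str M X Y}
    (h : ∀ Z l r, l.append r = p → 1 ≤ l.length → ψ Z l r = 0) : splitSum ψ p = ψ X nil p := by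
  induction p with
  | nil => simp
  | snoc p x ih =>
    rw [splitSum_snoc, h _ (p.snoc x) nil rfl (by simp [length]), add_zero]
    exact ih (fun Z l r hlr hl => h _ _ _ (by rw [append, hlr]) hl)

/-- Every cut other than the one at the junction lies properly inside `p` or properly inside `q`,
and the two hypotheses kill exactly these. -/
lemma splitSum_append {X Y Z : O} (ψ : ∀ W, Str M X W → Str M W Z → N) (p : Str M X Y)
    (q : Str M Y Z) (h : ∀ W l r, l.append r = p → 1 ≤ r.length → ψ W l (r.append q) = 0)
    (h' : ∀ W l r, l.append r = q → 1 ≤ l.length → ψ W (p.append l) r = 0) :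
    splitSum ψ (p.append q) = ψ Y p q := by
  induction q with
  | nil => exact splitSum_eq_of_right h
  | snoc q x ih =>
    rw [append, splitSum_snoc, ih _ h (fun W l r hlr hl => h' _ _ (r.snoc x) (by rw [append, hlr]) hl)]
    have := h' _ (q.snoc x) nil rfl (by simp [length])
    rw [append] at this
    rw [this, add_zero]

end splitSum

/-- The function of strings which is given by `f` on strings of length one and vanishes on all others. -/
def single {O' : Type u} {M' : O' → O' → Type u} [∀ X Y, AddCommGroup (M' X Y)] (φ : O → O')
    (f : ∀ X Y, M X Y → M' (φ X) (φ Y)) {X : O} : {Y : O} → Str M X Y → M' (φ X) (φ Y)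
  | _, nil => 0
  | _, snoc nil x => f _ _ x
  | _, snoc (snoc _ _) _ => 0

lemma single_eq_zero {O' : Type u} {M' : O' → O' → Type u} [∀ X Y, AddCommGroup (M' X Y)] (φ : O → O')
    (f : ∀ X Y, M X Y → M' (φ X) (φ Y)) {X Y : O} (p : Str M X Y) (hp : p.length ≠ 1) :
    single φ f p = 0 := by
  match p with
  | nil => rfl
  | snoc nil x => exact absurd rfl hp
  | snoc (snoc _ _) _ => rfl

/-! ### Multilinear functions of strings -/

section Multilinear

variable {k : Type u} [CommRing k] [∀ X Y, AddCommGroup (M X Y)] [∀ X Y, Module k (M X Y)]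
variable {N : Type u} [AddCommGroup N] [Module k N]

namespace IsMultilinear

variable {X Y : O} {φ : Str M X Y → N}

lemma compLin (hφ : IsMultilinear k φ) {N' : Type u} [AddCommGroup N'] [Module k N']
    (f : N →ₗ[k] N') : IsMultilinear k (fun p => f (φ p)) where
  map_add l x y r := by rw [hφ.map_add, _root_.map_add]
  map_smul l c x r := by rw [hφ.map_smul, _root_.map_smul]

lemma snoc {Z : O} {φ : Str M X Z → N} (hφ : IsMultilinear k φ) (x : M Y Z) :
    IsMultilinear k (fun p : Str M X Y => φ (p.snoc x)) where
  map_add l y z r := hφ.map_add l y z (r.snoc x)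
  map_smul l c y r := hφ.map_smul l c y (r.snoc x)

lemma append_right {Z : O} {φ : Str M X Z → N} (hφ : IsMultilinear k φ) (q : Str M Y Z) :
    IsMultilinear k (fun p : Str M X Y => φ (p.append q)) where
  map_add l y z r := by simpa only [append_assoc] using hφ.map_add l y z (r.append q)
  map_smul l c y r := by simpa only [append_assoc] using hφ.map_smul l c y (r.append q)

lemma append_left {Z : O} {φ : Str M X Z → N} (hφ : IsMultilinear k φ) (p : Str M X Y) :
    IsMultilinear k (fun q : Str M Y Z => φ (p.append q)) where
  map_add l y z r := by
    simpa only [← append_assoc, append] using hφ.map_add (p.append l) y z r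
  map_smul l c y r := by
    simpa only [← append_assoc, append] using hφ.map_smul (p.append l) c y r

lemma add {φ' : Str M X Y → N} (hφ : IsMultilinear k φ) (hφ' : IsMultilinear k φ') :
    IsMultilinear k (fun p => φ p + φ' p) where
  map_add l x y r := by rw [hφ.map_add, hφ'.map_add]; abel
  map_smul l c x r := by rw [hφ.map_smul, hφ'.map_smul, smul_add]

/-- The linear map in the last entry. -/
def last {Z : O} {φ : Str M X Z → N} (hφ : IsMultilinear k φ) (p : Str M X Y) :
    M Y Z →ₗ[k] N where
  toFun x := φ (p.snoc x)
  map_add' x y := hφ.map_add p x y nil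
  map_smul' c x := hφ.map_smul p c x nil

lemma map_zero {Z W : O} (hφ : IsMultilinear k φ) (l : Str M X Z) (r : Str M W Y) :
    φ ((l.snoc 0).append r) = 0 := by
  simpa using hφ.map_smul l 0 0 r

/-- Changing one entry does not change the length, so all terms fall into the same branch. -/
lemma ite_length {n : ℕ} (hφ : IsMultilinear k φ) :
    IsMultilinear k (fun p => if p.length = n then φ p else 0) where
  map_add l x y r := by
    simp only [length_append, length]
    split_ifs
    · exact hφ.map_add l x y r
    · simp
  map_smul l c x r := by
    simp only [length_append, length]
    split_ifs
    · exact hφ.map_smul l c x r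
    · simp

end IsMultilinear

/-- For each cut the varied entry lies in exactly one of the two halves, so linearity in each half
separately is enough. When the varied entry is the last one, it lies in the right half for all cuts
but the final one. -/
lemma splitSum_multilinear {X Y : O} (ψ : ∀ Z, Str M X Z → Str M Z Y → N)
    (h₁ : ∀ Z r, IsMultilinear k (fun l => ψ Z l r))
    (h₂ : ∀ Z l, IsMultilinear k (fun r => ψ Z l r)) : IsMultilinear k (splitSum ψ) where
  map_add l x y r := by
    induction r with
    | nil =>
      simp only [append, splitSum_snoc]
      rw [show ψ _ (l.snoc (x + y)) nil = _ from (h₁ _ nil).map_add l x y nil,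
        splitSum_congr (ψ := fun W l r => ψ W l (r.snoc (x + y)))
          (fun Z l' r' _ => (h₂ Z l').map_add r' x y nil)]
      simp only [append, splitSum_add]
      abel
    | snoc r z ih =>
      simp only [append, splitSum_snoc]
      rw [ih _ (fun Z r => h₁ Z (r.snoc z)) (fun Z l => (h₂ Z l).snoc z),
        show ψ _ (((l.snoc (x + y)).append r).snoc z) nil = _ from
          (h₁ _ nil).map_add l x y (r.snoc z)]
      simp only [append]
      abel
  map_smul l c x r := by
    have hs : ∀ {W : O} (ψ : ∀ Z, Str M X Z → Str M Z W → N) (p : Str M X W),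
        splitSum (fun Z l r => c • ψ Z l r) p = c • splitSum ψ p := fun ψ p =>
      (map_splitSum (LinearMap.lsmul k N c) ψ p).symm
    induction r with
    | nil =>
      simp only [append, splitSum_snoc]
      rw [show ψ _ (l.snoc (c • x)) nil = _ from (h₁ _ nil).map_smul l c x nil,
        splitSum_congr (ψ := fun W l r => ψ W l (r.snoc (c • x)))
          (fun Z l' r' _ => (h₂ Z l').map_smul r' c x nil)]
      simp only [append, hs, smul_add]
    | snoc r z ih =>
      simp only [append, splitSum_snoc]
      rw [ih _ (fun Z r => h₁ Z (r.snoc z)) (fun Z l => (h₂ Z l).snoc z),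
        show ψ _ (((l.snoc (c • x)).append r).snoc z) nil = _ from
          (h₁ _ nil).map_smul l c x (r.snoc z)]
      simp only [append, smul_add]

lemma single_multilinear {O' : Type u} {M' : O' → O' → Type u} [∀ X Y, AddCommGroup (M' X Y)]
    [∀ X Y, Module k (M' X Y)] (φ : O → O') (f : ∀ X Y, M X Y →ₗ[k] M' (φ X) (φ Y)) {X Y : O} :
    IsMultilinear k (fun p : Str M X Y => single φ (fun X Y => f X Y) p) where
  map_add l x y r := by
    by_cases h : ((l.snoc x).append r).length = 1
    · cases r with
      | snoc r z => simp [append, length, length_append] at h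
      | nil =>
        cases l with
        | snoc l z => simp [append, length] at h
        | nil => exact _root_.map_add (f _ _) _ _
    · rw [single_eq_zero _ _ _ h, single_eq_zero, single_eq_zero, add_zero]
      · simpa only [length_append, length] using h
      · simpa only [length_append, length] using h
  map_smul l c x r := by
    by_cases h : ((l.snoc x).append r).length = 1
    · cases r with
      | snoc r z => simp [append, length, length_append] at h
      | nil =>
        cases l with
        | snoc l z => simp [append, length] at h
        | nil => exact _root_.map_smul (f _ _) _ _
    · rw [single_eq_zero _ _ _ h, single_eq_zero, smul_zero]
      simpa only [length_append, length] using h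

end Multilinear

end Str

/-! ### Tensors of arbitrary length -/

section TStr

variable {k : Type u} [CommRing k] {O : Type u} {M : O → O → Type u}
  [∀ X Y, AddCommGroup (M X Y)] [∀ X Y, Module k (M X Y)]

/-- The relations of multilinearity on formal linear combinations of strings. -/
def strRel (k : Type u) [CommRing k] {O : Type u} (M : O → O → Type u)
    [∀ X Y, AddCommGroup (M X Y)] [∀ X Y, Module k (M X Y)] (X Y : O) :
    Submodule k (Str M X Y →₀ k) :=
  Submodule.span k
    ({ρ | ∃ (Z W : O) (l : Str M X Z) (x y : M Z W) (r : Str M W Y),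
        ρ = Finsupp.single ((l.snoc (x + y)).append r) 1 - Finsupp.single ((l.snoc x).append r) 1
          - Finsupp.single ((l.snoc y).append r) 1} ∪
     {ρ | ∃ (Z W : O) (l : Str M X Z) (c : k) (x : M Z W) (r : Str M W Y),
        ρ = Finsupp.single ((l.snoc (c • x)).append r) 1
          - Finsupp.single ((l.snoc x).append r) c})

/-- The direct sum of all tensor powers of a quiver: combinations of strings of arbitrary length
modulo linearity in each entry. -/
def TStr (k : Type u) [CommRing k] {O : Type u} (M : O → O → Type u)
    [∀ X Y, AddCommGroup (M X Y)] [∀ X Y, Module k (M X Y)] (X Y : O) : Type u :=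
  (Str M X Y →₀ k) ⧸ strRel k M X Y

instance (X Y : O) : AddCommGroup (TStr k M X Y) :=
  inferInstanceAs (AddCommGroup (_ ⧸ strRel k M X Y))

instance (X Y : O) : Module k (TStr k M X Y) :=
  inferInstanceAs (Module k (_ ⧸ strRel k M X Y))

namespace TStr

variable (k) in
/-- The pure tensor. -/
def mk {X Y : O} (p : Str M X Y) : TStr k M X Y :=
  (strRel k M X Y).mkQ (Finsupp.single p 1)

/-- The linear map defined by a multilinear function of strings. -/
def lift {N : Type u} [AddCommGroup N] [Module k N] {X Y : O}
    (φ : Str M X Y → N) (hφ : Str.IsMultilinear k φ) : TStr k M X Y →ₗ[k] N :=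
  (strRel k M X Y).liftQ (Finsupp.linearCombination k φ) (by
    rw [strRel, Submodule.span_le]
    rintro ρ (⟨Z, W, l, x, y, r, rfl⟩ | ⟨Z, W, l, c, x, r, rfl⟩)
    · simp [hφ.map_add l x y r]
    · simp [hφ.map_smul l c x r])

@[simp]
lemma lift_mk {N : Type u} [AddCommGroup N] [Module k N] {X Y : O}
    (φ : Str M X Y → N) (hφ : Str.IsMultilinear k φ) (p : Str M X Y) :
    lift φ hφ (mk k p) = φ p := by
  refine (Submodule.liftQ_apply _ _ _).trans ?_
  simp

lemma mk_multilinear {X Y : O} : Str.IsMultilinear k (fun p : Str M X Y => mk k p) where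
  map_add l x y r := by
    have : (Finsupp.single ((l.snoc (x + y)).append r) 1 - Finsupp.single ((l.snoc x).append r) 1
        - Finsupp.single ((l.snoc y).append r) 1 : Str M X Y →₀ k) ∈ strRel k M X Y :=
      Submodule.subset_span (Or.inl ⟨_, _, l, x, y, r, rfl⟩)
    rw [← Submodule.ker_mkQ (strRel k M X Y), LinearMap.mem_ker, map_sub, map_sub,
      sub_sub, sub_eq_zero] at this
    exact this
  map_smul l c x r := by
    have : (Finsupp.single ((l.snoc (c • x)).append r) 1 - Finsupp.single ((l.snoc x).append r) c :
        Str M X Y →₀ k) ∈ strRel k M X Y :=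
      Submodule.subset_span (Or.inr ⟨_, _, l, c, x, r, rfl⟩)
    rw [← Submodule.ker_mkQ (strRel k M X Y), LinearMap.mem_ker, map_sub,
      sub_eq_zero] at this
    refine Eq.trans this ?_
    have h2 : (Finsupp.single ((l.snoc x).append r) c : Str M X Y →₀ k) =
      c • Finsupp.single ((l.snoc x).append r) 1 := by simp
    rw [h2]
    exact map_smul _ _ _

lemma span_mk {X Y : O} : Submodule.span k (Set.range (mk k (M := M) (X := X) (Y := Y))) = ⊤ := by
  rw [eq_top_iff]
  rintro t -
  obtain ⟨f, rfl⟩ := (strRel k M X Y).mkQ_surjective t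
  induction f using Finsupp.induction_linear with
  | zero => rw [map_zero]; exact Submodule.zero_mem _
  | add f g hf hg => rw [map_add]; exact Submodule.add_mem _ hf hg
  | single p c =>
    have : (Finsupp.single p c : _ →₀ k) = c • Finsupp.single p 1 := by simp
    rw [this, map_smul]
    exact Submodule.smul_mem _ _ (Submodule.subset_span ⟨p, rfl⟩)

@[elab_as_elim]
lemma induction {X Y : O} {P : TStr k M X Y → Prop} (t : TStr k M X Y)
    (mk : ∀ p, P (mk k p)) (zero : P 0) (add : ∀ s t, P s → P t → P (s + t))
    (smul : ∀ (c : k) t, P t → P (c • t)) : P t := by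
  have : t ∈ Submodule.span k (Set.range (TStr.mk k (M := M) (X := X) (Y := Y))) := by
    rw [span_mk]; trivial
  induction this using Submodule.span_induction with
  | mem x h => obtain ⟨p, rfl⟩ := h; exact mk p
  | zero => exact zero
  | add x y _ _ hx hy => exact add _ _ hx hy
  | smul c x _ hx => exact smul _ _ hx

@[ext]
lemma hom_ext {N : Type u} [AddCommGroup N] [Module k N] {X Y : O}
    {f g : TStr k M X Y →ₗ[k] N} (h : ∀ p, f (mk k p) = g (mk k p)) : f = g :=
  LinearMap.ext_on span_mk (by rintro _ ⟨p, rfl⟩; exact h p)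

/-- Concatenation. -/
def mul (X Y Z : O) : TStr k M X Y →ₗ[k] TStr k M Y Z →ₗ[k] TStr k M X Z :=
  lift (fun p => lift (fun q => mk k (p.append q)) (mk_multilinear.append_left p))
    ⟨fun l x y r => hom_ext fun q => by
        simpa using (mk_multilinear (k := k).append_right q).map_add l x y r,
     fun l c x r => hom_ext fun q => by
        simpa using (mk_multilinear (k := k).append_right q).map_smul l c x r⟩

@[simp]
lemma mul_mk {X Y Z : O} (p : Str M X Y) (q : Str M Y Z) :
    mul X Y Z (mk k p) (mk k q) = mk k (p.append q) := by
  simp [mul]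

lemma mul_assoc {X Y Z W : O} (a : TStr k M X Y) (b : TStr k M Y Z) (c : TStr k M Z W) :
    mul _ _ _ (mul _ _ _ a b) c = mul _ _ _ a (mul _ _ _ b c) := by
  induction a using induction with
  | zero => simp
  | add s t hs ht => simp [hs, ht]
  | smul r t ht => simp [ht]
  | mk p =>
    induction b using induction with
    | zero => simp
    | add s t hs ht => simp [hs, ht]
    | smul r t ht => simp [ht]
    | mk q =>
      induction c using induction with
      | zero => simp
      | add s t hs ht => simp only [map_add, hs, ht]
      | smul r t ht => simp only [map_smul, ht]
      | mk r => simp [Str.append_assoc]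

lemma one_mul {X Y : O} (a : TStr k M X Y) : mul _ _ _ (mk k Str.nil) a = a := by
  induction a using induction with
  | zero => simp
  | add s t hs ht => simp [hs, ht]
  | smul r t ht => simp [ht]
  | mk p => simp [Str.nil_append]

lemma mul_one {X Y : O} (a : TStr k M X Y) : mul _ _ _ a (mk k Str.nil) = a := by
  induction a using induction with
  | zero => simp
  | add s t hs ht => simp [hs, ht]
  | smul r t ht => simp [ht]
  | mk p => simp [Str.append]

/-- Tensors of length one. -/
def one (X Y : O) : M X Y →ₗ[k] TStr k M X Y := mk_multilinear.last Str.nil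

lemma one_apply {X Y : O} (x : M X Y) : one X Y x = mk k (Str.one x) := rfl

lemma mk_snoc {X Y Z : O} (p : Str M X Y) (x : M Y Z) :
    mk k (p.snoc x) = mul _ _ _ (mk k p) (one _ _ x) := by
  rw [one_apply, mul_mk]; rfl

/-- The comultiplication, composed with bilinear maps. -/
def cop {N : Type u} [AddCommGroup N] [Module k N] {X Y : O}
    (β : ∀ Z, TStr k M X Z →ₗ[k] TStr k M Z Y →ₗ[k] N) : TStr k M X Y →ₗ[k] N :=
  lift (Str.splitSum (fun Z l r => β Z (mk k l) (mk k r)))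
    (Str.splitSum_multilinear _ (fun Z r => mk_multilinear.compLin ((β Z).flip (mk k r)))
      (fun Z l => mk_multilinear.compLin (β Z (mk k l))))

@[simp]
lemma cop_mk {N : Type u} [AddCommGroup N] [Module k N] {X Y : O}
    (β : ∀ Z, TStr k M X Z →ₗ[k] TStr k M Z Y →ₗ[k] N) (p : Str M X Y) :
    cop β (mk k p) = Str.splitSum (fun Z l r => β Z (mk k l) (mk k r)) p := by
  simp [cop]

/-- The tensors of length `n`. -/
def len (k : Type u) [CommRing k] {O : Type u} (M : O → O → Type u)
    [∀ X Y, AddCommGroup (M X Y)] [∀ X Y, Module k (M X Y)] (n : ℕ) (X Y : O) :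
    Submodule k (TStr k M X Y) :=
  Submodule.span k {t | ∃ p : Str M X Y, p.length = n ∧ t = mk k p}

/-- The projection onto the tensors of length `n`. -/
def proj (n : ℕ) (X Y : O) : TStr k M X Y →ₗ[k] TStr k M X Y :=
  lift (fun p => if p.length = n then mk k p else 0) mk_multilinear.ite_length

@[simp]
lemma proj_mk (n : ℕ) {X Y : O} (p : Str M X Y) :
    proj n X Y (mk k p) = if p.length = n then mk k p else 0 := by
  simp [proj]

lemma mul_mem_len {m n : ℕ} {X Y Z : O} {a : TStr k M X Y} {b : TStr k M Y Z}
    (ha : a ∈ len k M m X Y) (hb : b ∈ len k M n Y Z) :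
    mul X Y Z a b ∈ len k M (m + n) X Z := by
  have := Submodule.apply_mem_map₂ (mul (k := k) (M := M) X Y Z) ha hb
  rw [len, len, Submodule.map₂_span_span] at this
  refine Submodule.span_mono ?_ this
  rintro _ ⟨_, ⟨p, hp, rfl⟩, _, ⟨q, hq, rfl⟩, rfl⟩
  exact ⟨p.append q, by rw [Str.length_append, hp, hq], mul_mk p q⟩

lemma mk_mem_len {X Y : O} (p : Str M X Y) {n : ℕ} (h : p.length = n) :
    mk k p ∈ len k M n X Y := Submodule.subset_span ⟨p, h, rfl⟩

/-- The homogeneous tensors of degree `e`. -/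
def gr (g : ∀ X Y, ℤ → Submodule k (M X Y)) (X Y : O) (e : ℤ) : Submodule k (TStr k M X Y) :=
  Submodule.span k {t | ∃ p : Str M X Y, p.IsHomog g e ∧ t = mk k p}

end TStr

end TStr

/-! ### Signs and parity -/

section Parity

variable {k : Type u} [CommRing k]

variable (k) in
/-- The sign `(-1)^d` in `k`. -/
def sgn (d : ℤ) : k := ((Int.negOnePow d : ℤˣ) : ℤ)

lemma sgn_add (a b : ℤ) : sgn k (a + b) = sgn k a * sgn k b := by
  simp [sgn, Int.negOnePow_add]

lemma sgn_zero : sgn k 0 = 1 := by simp [sgn]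

lemma sgn_one : sgn k 1 = -1 := by simp [sgn]

lemma sgn_mul_self (d : ℤ) : sgn k d * sgn k d = 1 := by
  rw [← sgn_add, sgn, Int.negOnePow_even _ ⟨d, rfl⟩]; simp

lemma sgn_natCast (n : ℕ) : sgn k (n : ℤ) = (-1) ^ n := by
  induction n with
  | zero => simp [sgn_zero]
  | succ n ih => rw [Nat.cast_succ, sgn_add, ih, sgn_one, pow_succ]

lemma neg_one_pow_mul_self (n : ℕ) : (-1 : k) ^ n * (-1) ^ n = 1 := by
  rw [← mul_pow]; simp

variable {M N : Type u} [AddCommGroup M] [Module k M] [AddCommGroup N] [Module k N]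

lemma parity_of_mem {gr : ℤ → Submodule k M} (h : DirectSum.IsInternal gr) {d : ℤ} {x : M}
    (hx : x ∈ gr d) : parity gr h x = sgn k d • x := by
  have : (LinearEquiv.ofBijective (DirectSum.coeLinearMap gr) h).symm x
      = DirectSum.lof k ℤ (fun i => gr i) d ⟨x, hx⟩ := by
    rw [LinearEquiv.symm_apply_eq]
    exact (DirectSum.coeLinearMap_lof gr d ⟨x, hx⟩).symm
  rw [sgn, Int.cast_smul_eq_zsmul]
  simp [parity, this]

lemma linearMap_ext_of_isInternal {gr : ℤ → Submodule k M} (h : DirectSum.IsInternal gr)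
    {f g : M →ₗ[k] N} (hfg : ∀ d, ∀ x ∈ gr d, f x = g x) : f = g := by
  ext x
  have hx : x ∈ ⨆ d, gr d := by rw [h.submodule_iSup_eq_top]; trivial
  induction hx using Submodule.iSup_induction' with
  | mem d x hx => exact hfg d x hx
  | zero => simp
  | add x y _ _ hx hy => rw [map_add, map_add, hx, hy]

/-- On an element of degree `d` the left side is the scalar $(-1)^{d+n}$ times `f x`, the right side
$(-1)^n(-1)^d$. -/
lemma parity_comp {gr : ℤ → Submodule k M} (h : DirectSum.IsInternal gr)
    {gr' : ℤ → Submodule k N} (h' : DirectSum.IsInternal gr') (n : ℤ) (f : M →ₗ[k] N)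
    (hf : ∀ d, ∀ x ∈ gr d, f x ∈ gr' (d + n)) (x : M) :
    parity gr' h' (f x) = sgn k n • f (parity gr h x) := by
  have : parity gr' h' ∘ₗ f = sgn k n • (f ∘ₗ parity gr h) := by
    refine linearMap_ext_of_isInternal h fun d x hx => ?_
    simp only [LinearMap.comp_apply, LinearMap.smul_apply, parity_of_mem h hx,
      parity_of_mem h' (hf d x hx), map_smul, smul_smul, sgn_add, mul_comm]
  exact LinearMap.congr_fun this x

lemma parity_parity {gr : ℤ → Submodule k M} (h : DirectSum.IsInternal gr) (x : M) :
    parity gr h (parity gr h x) = x := by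
  have : parity gr h ∘ₗ parity gr h = LinearMap.id := by
    refine linearMap_ext_of_isInternal h fun d x hx => ?_
    simp [parity_of_mem h hx, smul_smul, sgn_mul_self]
  exact LinearMap.congr_fun this x

end Parity

namespace Str

lemma map_map_eq_self {O : Type u} {M : O → O → Type u} (f : ∀ X Y, M X Y → M X Y) (h : ∀ X Y x, f X Y (f X Y x) = x) {X Y : O}
    (p : Str M X Y) : (p.map id f).map id f = p := by
  induction p with
  | nil => rfl
  | snoc p x ih =>
    simp only [map]
    exact congrArg₂ snoc ih (h _ _ x)

variable {k : Type u} [CommRing k] {O : Type u} {M : O → O → Type u}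
  [∀ X Y, AddCommGroup (M X Y)] [∀ X Y, Module k (M X Y)]

lemma IsMultilinear.comp_map {O' : Type u} {M' : O' → O' → Type u} [∀ X Y, AddCommGroup (M' X Y)]
    [∀ X Y, Module k (M' X Y)] {φ : O → O'} (f : ∀ X Y, M X Y →ₗ[k] M' (φ X) (φ Y))
    {N : Type u} [AddCommGroup N] [Module k N] {X Y : O} {ψ : Str M' (φ X) (φ Y) → N}
    (hψ : IsMultilinear k ψ) : IsMultilinear k (fun p => ψ (p.map φ (fun X Y => f X Y))) where
  map_add l x y r := by
    simpa only [map_append, map, _root_.map_add] using hψ.map_add (l.map φ _) _ _ (r.map φ _)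
  map_smul l c x r := by
    simpa only [map_append, map, _root_.map_smul] using hψ.map_smul (l.map φ _) c _ (r.map φ _)

lemma isHomog_append {gr : ∀ X Y, ℤ → Submodule k (M X Y)} {X Y Z : O} {p : Str M X Y}
    {q : Str M Y Z} {a b : ℤ} (hp : p.IsHomog gr a) (hq : q.IsHomog gr b) :
    (p.append q).IsHomog gr (a + b) := by
  induction q generalizing b with
  | nil => rw [show b = 0 from hq, add_zero]; exact hp
  | snoc q x ih =>
    obtain ⟨c, d, hc, hd, rfl⟩ := hq
    exact ⟨a + c, d, ih hc, hd, by ring⟩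

end Str

namespace TStr

variable {k : Type u} [CommRing k] {O : Type u} {M : O → O → Type u}
  [∀ X Y, AddCommGroup (M X Y)] [∀ X Y, Module k (M X Y)]

/-- The map of tensors induced by a map of quivers. -/
def map {O' : Type u} {M' : O' → O' → Type u} [∀ X Y, AddCommGroup (M' X Y)]
    [∀ X Y, Module k (M' X Y)] (φ : O → O') (f : ∀ X Y, M X Y →ₗ[k] M' (φ X) (φ Y)) (X Y : O) :
    TStr k M X Y →ₗ[k] TStr k M' (φ X) (φ Y) :=
  lift (fun p => mk k (p.map φ (fun X Y => f X Y))) (mk_multilinear.comp_map f)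

@[simp]
lemma map_mk {O' : Type u} {M' : O' → O' → Type u} [∀ X Y, AddCommGroup (M' X Y)]
    [∀ X Y, Module k (M' X Y)] (φ : O → O') (f : ∀ X Y, M X Y →ₗ[k] M' (φ X) (φ Y)) {X Y : O}
    (p : Str M X Y) : map φ f X Y (mk k p) = mk k (p.map φ (fun X Y => f X Y)) := by
  simp [map]

lemma mk_mem_gr {g : ∀ X Y, ℤ → Submodule k (M X Y)} {X Y : O} {p : Str M X Y} {e : ℤ}
    (hp : p.IsHomog g e) : mk k p ∈ gr g X Y e := Submodule.subset_span ⟨p, hp, rfl⟩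

lemma mul_mem_gr {g : ∀ X Y, ℤ → Submodule k (M X Y)} {X Y Z : O} {a b : ℤ} {s : TStr k M X Y}
    {t : TStr k M Y Z} (hs : s ∈ gr g X Y a) (ht : t ∈ gr g Y Z b) :
    mul X Y Z s t ∈ gr g X Z (a + b) := by
  have := Submodule.apply_mem_map₂ (mul (k := k) (M := M) X Y Z) hs ht
  rw [gr, gr, Submodule.map₂_span_span] at this
  refine Submodule.span_mono ?_ this
  rintro _ ⟨_, ⟨p, hp, rfl⟩, _, ⟨q, hq, rfl⟩, rfl⟩
  exact ⟨p.append q, Str.isHomog_append hp hq, mul_mk p q⟩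

lemma one_mem_gr {g : ∀ X Y, ℤ → Submodule k (M X Y)} {X Y : O} {a : ℤ} {x : M X Y}
    (hx : x ∈ g X Y a) : one X Y x ∈ gr g X Y a :=
  mk_mem_gr ⟨0, a, rfl, hx, zero_add a⟩

end TStr

/-! ### Parity and differential on tensors -/

section Diff

variable {k : Type u} [CommRing k]

namespace GradedQuiver

variable (Q : GradedQuiver k)

lemma sσ_of_mem {X Y : Q.Ob} {d : ℤ} {x : Q.Hom X Y} (hx : x ∈ Q.sgr X Y d) :
    Q.sσ X Y x = sgn k d • x := parity_of_mem _ hx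

lemma sσ_sσ {X Y : Q.Ob} (x : Q.Hom X Y) : Q.sσ X Y (Q.sσ X Y x) = x := parity_parity _ x

/-- The parity involution on tensors. -/
def tσ (X Y : Q.Ob) : TStr k Q.Hom X Y →ₗ[k] TStr k Q.Hom X Y := TStr.map id Q.sσ X Y

lemma tσ_mk {X Y : Q.Ob} (p : Str Q.Hom X Y) :
    Q.tσ X Y (TStr.mk k p) = TStr.mk k (p.map id (fun X Y => Q.sσ X Y)) := TStr.map_mk _ _ _

lemma tσ_one {X Y : Q.Ob} (x : Q.Hom X Y) :
    Q.tσ X Y (TStr.one X Y x) = TStr.one X Y (Q.sσ X Y x) := Q.tσ_mk _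

lemma tσ_mul {X Y Z : Q.Ob} (a : TStr k Q.Hom X Y) (b : TStr k Q.Hom Y Z) :
    Q.tσ X Z (TStr.mul _ _ _ a b) = TStr.mul _ _ _ (Q.tσ X Y a) (Q.tσ Y Z b) := by
  induction a using TStr.induction with
  | zero => simp
  | add s t hs ht => simp [hs, ht]
  | smul r t ht => simp [ht]
  | mk p =>
    induction b using TStr.induction with
    | zero => simp
    | add s t hs ht => simp [hs, ht]
    | smul r t ht => simp [ht]
    | mk q => rw [TStr.mul_mk, tσ_mk, tσ_mk, tσ_mk, Str.map_append]; exact (TStr.mul_mk _ _).symm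

lemma tσ_tσ {X Y : Q.Ob} (a : TStr k Q.Hom X Y) : Q.tσ X Y (Q.tσ X Y a) = a := by
  induction a using TStr.induction with
  | zero => simp
  | add s t hs ht => simp [hs, ht]
  | smul r t ht => simp [ht]
  | mk p => rw [tσ_mk, tσ_mk, Str.map_map_eq_self _ (fun X Y => Q.sσ_sσ)]

lemma tσ_of_mem {X Y : Q.Ob} {e : ℤ} {a : TStr k Q.Hom X Y} (ha : a ∈ TStr.gr Q.sgr X Y e) :
    Q.tσ X Y a = sgn k e • a := by
  induction ha using Submodule.span_induction with
  | zero => simp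
  | add s t _ _ hs ht => simp [hs, ht]
  | smul r t _ ht => rw [map_smul, ht, smul_comm]
  | mem x hx =>
    obtain ⟨p, hp, rfl⟩ := hx
    induction p generalizing e with
    | nil => rw [show e = 0 from hp, sgn_zero, one_smul]; exact Q.tσ_mk _
    | snoc p x ih =>
      obtain ⟨a, b, ha, hb, rfl⟩ := hp
      -- The induction hypothesis carries the unused tensor `a` along, because its type mentions the
      -- endpoint of the string; any value fills it.
      rw [TStr.mk_snoc, tσ_mul, ih (a := 0) ha, tσ_one, Q.sσ_of_mem hb]
      simp [smul_smul, sgn_add, mul_comm]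

lemma tσ_mem_len {X Y : Q.Ob} {n : ℕ} {a : TStr k Q.Hom X Y} (ha : a ∈ TStr.len k Q.Hom n X Y) :
    Q.tσ X Y a ∈ TStr.len k Q.Hom n X Y := by
  induction ha using Submodule.span_induction with
  | zero => simp
  | add s t _ _ hs ht => rw [map_add]; exact add_mem hs ht
  | smul r t _ ht => rw [map_smul]; exact Submodule.smul_mem _ _ ht
  | mem x hx =>
    obtain ⟨p, hp, rfl⟩ := hx
    rw [tσ_mk]
    exact TStr.mk_mem_len _ (by rw [Str.length_map, hp])

/-- `((-1)^b σ)^a`, where `σ` is the parity involution. -/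
def tw (a b : ℕ) (X Y : Q.Ob) : TStr k Q.Hom X Y →ₗ[k] TStr k Q.Hom X Y :=
  (-1 : k) ^ (a * b) • (Q.tσ X Y) ^ a

variable {X Y : Q.Ob}

/-- On a tensor of degree `d` the twist is the scalar $(-1)^{a(b+d)}$, the sign of moving `a` shifts
past such a tensor in a summand shifted by `b`. The rules below are identities between these
exponents. -/
lemma tw_apply (a b : ℕ) (s : TStr k Q.Hom X Y) :
    Q.tw a b X Y s = (-1 : k) ^ (a * b) • ((Q.tσ X Y) ^ a) s := rfl

lemma tσ_pow_mul (a : ℕ) {Z : Q.Ob} (s : TStr k Q.Hom X Y) (t : TStr k Q.Hom Y Z) :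
    (Q.tσ X Z ^ a) (TStr.mul _ _ _ s t) =
      TStr.mul _ _ _ ((Q.tσ X Y ^ a) s) ((Q.tσ Y Z ^ a) t) := by
  induction a with
  | zero => simp
  | succ a ih => simp only [pow_succ', Module.End.mul_apply, ih, tσ_mul]

lemma tσ_pow_tσ_pow (a : ℕ) (s : TStr k Q.Hom X Y) :
    (Q.tσ X Y ^ a) ((Q.tσ X Y ^ a) s) = s := by
  rw [← Module.End.mul_apply, ← pow_add, ← two_mul, pow_mul]
  have : Q.tσ X Y ^ 2 = 1 := by ext p; simp [pow_two, tσ_tσ]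
  rw [this, one_pow]; rfl

lemma tσ_tσ_pow (a : ℕ) (s : TStr k Q.Hom X Y) :
    Q.tσ X Y ((Q.tσ X Y ^ a) s) = (Q.tσ X Y ^ a) (Q.tσ X Y s) := by
  rw [← Module.End.mul_apply, ← Module.End.mul_apply, Commute.self_pow]

lemma tσ_tw (a b : ℕ) (s : TStr k Q.Hom X Y) :
    Q.tσ X Y (Q.tw a b X Y s) = Q.tw a b X Y (Q.tσ X Y s) := by
  simp only [tw_apply, map_smul, tσ_tσ_pow]

lemma tw_tw (a b : ℕ) (s : TStr k Q.Hom X Y) : Q.tw a b X Y (Q.tw a b X Y s) = s := by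
  simp only [tw_apply, map_smul, smul_smul, tσ_pow_tσ_pow, neg_one_pow_mul_self, one_smul]

lemma tw_zero_left (b : ℕ) (s : TStr k Q.Hom X Y) : Q.tw 0 b X Y s = s := by simp [tw_apply]

lemma tw_succ_right (a b : ℕ) (s : TStr k Q.Hom X Y) :
    Q.tw a (b + 1) X Y s = (-1 : k) ^ a • Q.tw a b X Y s := by
  simp only [tw_apply, smul_smul, ← pow_add]
  congr 2; ring

lemma tw_succ_left (a b : ℕ) (s : TStr k Q.Hom X Y) :
    Q.tw (a + 1) b X Y s = (-1 : k) ^ b • Q.tw a b X Y (Q.tσ X Y s) := by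
  simp only [tw_apply, smul_smul, ← pow_add, pow_succ, Module.End.mul_apply]
  congr 2; ring

/-- The twists are compatible with iterated concatenation. -/
lemma tw_mul (a b c : ℕ) {Z : Q.Ob} (s : TStr k Q.Hom X Y) (t : TStr k Q.Hom Y Z) :
    Q.tw a (b + c) X Z (TStr.mul _ _ _ s (Q.tw b c Y Z t)) =
      TStr.mul _ _ _ (Q.tw a b X Y s) (Q.tw (a + b) c Y Z t) := by
  simp only [tw_apply, map_smul, tσ_pow_mul, smul_smul, LinearMap.smul_apply, ← pow_add,
    ← Module.End.mul_apply]
  congr 2; ring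

lemma tw_nil (a : ℕ) : Q.tw a 0 X X (TStr.mk k Str.nil) = TStr.mk k Str.nil := by
  rw [tw_apply, Nat.mul_zero, pow_zero, one_smul]
  induction a with
  | zero => simp
  | succ a ih => rw [pow_succ', Module.End.mul_apply, ih]; exact Q.tσ_mk _

lemma tw_mem_len {a b n : ℕ} {s : TStr k Q.Hom X Y} (hs : s ∈ TStr.len k Q.Hom n X Y) :
    Q.tw a b X Y s ∈ TStr.len k Q.Hom n X Y := by
  rw [tw_apply]
  refine Submodule.smul_mem _ _ ?_
  induction a with
  | zero => simpa
  | succ a ih => rw [pow_succ', Module.End.mul_apply]; exact Q.tσ_mem_len ih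

lemma tw_mem_gr {a b : ℕ} {e : ℤ} {s : TStr k Q.Hom X Y} (hs : s ∈ TStr.gr Q.sgr X Y e) :
    Q.tw a b X Y s ∈ TStr.gr Q.sgr X Y e := by
  rw [tw_apply]
  refine Submodule.smul_mem _ _ ?_
  induction a with
  | zero => simpa
  | succ a ih =>
    rw [pow_succ', Module.End.mul_apply, Q.tσ_of_mem ih]; exact Submodule.smul_mem _ _ ih

end GradedQuiver

namespace DGQuiver

variable (Q : DGQuiver k)

lemma sσ_d {X Y : Q.Ob} (x : Q.Hom X Y) : Q.sσ X Y (Q.d X Y x) = -Q.d X Y (Q.sσ X Y x) := by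
  refine (parity_comp (Q.sgr_internal X Y) (Q.sgr_internal X Y) 1 (Q.d X Y) ?_ x).trans ?_
  · intro d x hx
    exact Q.d_mem X Y (d + 1) x hx
  · rw [sgn_one, neg_one_smul]; rfl

/-- The tensor product differential of a string. -/
def dStr' {X : Q.Ob} : {Y : Q.Ob} → Str Q.Hom X Y → TStr k Q.Hom X Y
  | _, Str.nil => 0
  | _, Str.snoc p x => TStr.mul _ _ _ (dStr' p) (TStr.one _ _ (Q.sσ _ _ x)) +
      TStr.mul _ _ _ (TStr.mk k p) (TStr.one _ _ (Q.d _ _ x))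

lemma dStr'_multilinear {X Y : Q.Ob} :
    Str.IsMultilinear k (fun p : Str Q.Hom X Y => Q.dStr' p) where
  map_add l x y r := by
    induction r with
    | nil => simp only [Str.append, dStr', map_add]; abel
    | snoc r z ih =>
      simp only [Str.append, dStr']
      rw [ih, TStr.mk_multilinear.map_add]
      simp only [map_add, LinearMap.add_apply]; abel
  map_smul l c x r := by
    induction r with
    | nil => simp only [Str.append, dStr', map_smul, smul_add]
    | snoc r z ih =>
      simp only [Str.append, dStr']
      rw [ih, TStr.mk_multilinear.map_smul]
      simp only [map_smul, LinearMap.smul_apply, smul_add]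

/-- The tensor product differential. -/
def tD (X Y : Q.Ob) : TStr k Q.Hom X Y →ₗ[k] TStr k Q.Hom X Y :=
  TStr.lift Q.dStr' Q.dStr'_multilinear

lemma tD_mk {X Y : Q.Ob} (p : Str Q.Hom X Y) : Q.tD X Y (TStr.mk k p) = Q.dStr' p :=
  TStr.lift_mk _ _ p

/-- The Leibniz rule for an operator acting from the right. The recursion of `dStr'` is the case of
a second factor of length one; the rest follows by induction on the second factor and associativity.
-/
lemma tD_mul {X Y Z : Q.Ob} (a : TStr k Q.Hom X Y) (b : TStr k Q.Hom Y Z) :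
    Q.tD X Z (TStr.mul _ _ _ a b) =
      TStr.mul _ _ _ (Q.tD X Y a) (Q.tσ Y Z b) + TStr.mul _ _ _ a (Q.tD Y Z b) := by
  induction a using TStr.induction with
  | zero => simp
  | add s t hs ht => simp only [map_add, LinearMap.add_apply, hs, ht]; abel
  | smul r t ht => simp only [map_smul, LinearMap.smul_apply, ht, smul_add]
  | mk p =>
    induction b using TStr.induction with
    | zero => simp
    | add s t hs ht => simp only [map_add, hs, ht]; abel
    | smul r t ht => simp only [map_smul, ht, smul_add]
    | mk q =>
      induction q with
      | nil =>
        rw [TStr.mul_one, tD_mk, tD_mk, dStr', map_zero, add_zero, Q.tσ_mk]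
        exact (TStr.mul_one _).symm
      | snoc q x ih =>
        rw [TStr.mul_mk] at ih
        rw [TStr.mul_mk, Str.append, tD_mk, dStr', ← tD_mk, ih, tD_mk _ (q.snoc x), dStr', ← tD_mk,
          TStr.mk_snoc, Q.tσ_mul, Q.tσ_one, ← TStr.mul_mk]
        simp only [map_add, LinearMap.add_apply, TStr.mul_assoc]
        abel

lemma tD_one {X Y : Q.Ob} (x : Q.Hom X Y) :
    Q.tD X Y (TStr.one _ _ x) = TStr.one _ _ (Q.d X Y x) := by
  rw [TStr.one_apply, tD_mk, Str.one, dStr', dStr', TStr.one_mul]; simp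

lemma tσ_tD {X Y : Q.Ob} (a : TStr k Q.Hom X Y) :
    Q.tσ X Y (Q.tD X Y a) = -Q.tD X Y (Q.tσ X Y a) := by
  induction a using TStr.induction with
  | zero => simp
  | add s t hs ht => simp only [map_add, hs, ht]; abel
  | smul r t ht => simp only [map_smul, ht, smul_neg]
  | mk p =>
    induction p with
    | nil => rw [tD_mk, Q.tσ_mk]; exact (by simp [dStr'] : Q.tσ X X (Q.dStr' Str.nil) = -Q.dStr' Str.nil).trans (by rw [← tD_mk]; rfl)
    | snoc p x ih =>
      rw [TStr.mk_snoc, tD_mul, map_add, Q.tσ_mul, Q.tσ_mul, ih, Q.tσ_mul, tD_mul, Q.tσ_one, tD_one,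
        tD_one, Q.tσ_one, Q.tσ_one, sσ_d]
      simp only [map_neg, LinearMap.neg_apply]
      abel

lemma tD_pow {X Y : Q.Ob} (a : ℕ) (s : TStr k Q.Hom X Y) :
    Q.tD X Y ((Q.tσ X Y ^ a) s) = (-1 : k) ^ a • (Q.tσ X Y ^ a) (Q.tD X Y s) := by
  induction a with
  | zero => simp
  | succ a ih =>
    have h := Q.tσ_tD ((Q.tσ X Y ^ a) s)
    rw [eq_neg_iff_add_eq_zero, add_comm, ← eq_neg_iff_add_eq_zero] at h
    rw [pow_succ', Module.End.mul_apply, Module.End.mul_apply, h, ih, map_smul, pow_succ, mul_neg,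
      mul_one, neg_smul]

lemma tD_mem_gr {X Y : Q.Ob} {e : ℤ} {a : TStr k Q.Hom X Y} (ha : a ∈ TStr.gr Q.sgr X Y e) :
    Q.tD X Y a ∈ TStr.gr Q.sgr X Y (e + 1) := by
  induction ha using Submodule.span_induction with
  | zero => simp
  | add s t _ _ hs ht => rw [map_add]; exact add_mem hs ht
  | smul r t _ ht => rw [map_smul]; exact Submodule.smul_mem _ _ ht
  | mem x hx =>
    obtain ⟨p, hp, rfl⟩ := hx
    induction p generalizing e with
    | nil => rw [tD_mk, dStr']; exact Submodule.zero_mem _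
    | snoc p x ih =>
      obtain ⟨a, b, ha, hb, rfl⟩ := hp
      rw [TStr.mk_snoc, tD_mul, Q.tσ_one, tD_one]
      refine add_mem ?_ ?_
      · rw [show a + b + 1 = (a + 1) + b by ring, Q.sσ_of_mem hb]
        refine TStr.mul_mem_gr (ih (a := 0) ha) ?_
        rw [map_smul]
        exact Submodule.smul_mem _ _ (TStr.one_mem_gr hb)
      · rw [add_assoc]
        exact TStr.mul_mem_gr (TStr.mk_mem_gr ha) (TStr.one_mem_gr (Q.d_mem _ _ _ _ hb))

end DGQuiver

end Diff

/-! ### Sums over cuts and expansions of forests -/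

namespace PTree

section cutSum

variable {α : Type} {N : Type u} [AddCommGroup N]

/-- The sum of `ψ l m` over all ways to write a list as `l ++ m`. -/
def cutSum (ψ : List α → List α → N) (F : List α) : N := ((cuts F).map (fun s => ψ s.1 s.2)).sum

@[simp]
lemma cutSum_nil (ψ : List α → List α → N) : cutSum ψ [] = ψ [] [] := by simp [cutSum, cuts]

lemma cutSum_cons (ψ : List α → List α → N) (a : α) (F : List α) :
    cutSum ψ (a :: F) = ψ [] (a :: F) + cutSum (fun l m => ψ (a :: l) m) F := by
  simp [cutSum, cuts, Function.comp_def]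

/-- Lists grow on the left and strings on the right; with this form, sums over cuts of a forest can
follow an induction on a string. -/
lemma cutSum_concat (ψ : List α → List α → N) (F : List α) (a : α) :
    cutSum ψ (F ++ [a]) = cutSum (fun l m => ψ l (m ++ [a])) F + ψ (F ++ [a]) [] := by
  induction F generalizing ψ with
  | nil => simp [cutSum_cons]
  | cons b F ih => simp only [List.cons_append, cutSum_cons, ih, add_assoc]

lemma cutSum_congr {ψ ψ' : List α → List α → N} {F : List α}
    (h : ∀ l m, l ++ m = F → ψ l m = ψ' l m) : cutSum ψ F = cutSum ψ' F := by
  unfold cutSum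
  rw [List.map_congr_left (fun s hs => h _ _ (mem_cuts hs))]

lemma cutSum_add (ψ ψ' : List α → List α → N) (F : List α) :
    cutSum (fun l m => ψ l m + ψ' l m) F = cutSum ψ F + cutSum ψ' F := by
  simp [cutSum]

lemma cutSum_neg (ψ : List α → List α → N) (F : List α) :
    cutSum (fun l m => -ψ l m) F = -cutSum ψ F := by
  rw [eq_neg_iff_add_eq_zero, ← cutSum_add]
  simp [cutSum]

lemma map_cutSum {N' H : Type u} [AddCommGroup N'] [FunLike H N N'] [AddMonoidHomClass H N N']
    (f : H) (ψ : List α → List α → N) (F : List α) :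
    f (cutSum ψ F) = cutSum (fun l m => f (ψ l m)) F := by
  simp [cutSum, map_list_sum, Function.comp_def]

end cutSum

lemma sizeL_append (l m : List PTree) : sizeL (l ++ m) = sizeL l + sizeL m := by
  induction l with
  | nil => simp [sizeL]
  | cons t l ih => simp only [List.cons_append, sizeL, ih]; omega

lemma sizeL_singleton (t : PTree) : sizeL [t] = size t := by simp [sizeL]

lemma leavesL_singleton (t : PTree) : leavesL [t] = leaves t := by simp [leavesL]

mutual
-- Contracting an internal edge merges its two end vertices into one.
lemma size_expand : (t : PTree) → ∀ s ∈ expand t, s.2.size = t.size + 1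
  | leaf, s, hs => by simp [expand] at hs
  | node ts, s, hs => by
      simp only [expand, List.mem_append, List.mem_map] at hs
      rcases hs with ⟨c, hc, rfl⟩ | ⟨c, hc, rfl⟩
      · obtain ⟨h1, -⟩ := mem_innerCuts hc
        simp only [size, sizeL_append, sizeL, ← h1]; omega
      · have := sizeL_expandL ts c hc
        simp only [size, this]; omega
lemma sizeL_expandL : (ts : List PTree) → ∀ s ∈ expandL ts, sizeL s.2 = sizeL ts + 1
  | [], s, hs => by simp [expandL] at hs
  | t :: ts, s, hs => by
      simp only [expandL, List.mem_append, List.mem_map] at hs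
      rcases hs with ⟨c, hc, rfl⟩ | ⟨c, hc, rfl⟩
      · have := size_expand t c hc
        simp only [sizeL, this]; omega
      · have := sizeL_expandL ts c hc
        simp only [sizeL, this]; omega
end

/-- The edge lies in `F` or in `G`. In the second case all vertices of `F` precede it, which shifts
the position by the size of `F`. -/
lemma expandL_append (F G : List PTree) : expandL (F ++ G) =
    (expandL F).map (fun s => (s.1, s.2 ++ G)) ++
      (expandL G).map (fun s => (sizeL F + s.1, F ++ s.2)) := by
  induction F with
  | nil => simp [expandL, sizeL]
  | cons t F ih =>
    simp [expandL, sizeL, ih, Function.comp_def, add_assoc]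

lemma expandL_singleton (t : PTree) :
    expandL [t] = (expand t).map (fun s => (s.1, [s.2])) := by
  simp [expandL]

lemma sum_attach_map {α : Type} {N : Type u} [AddCommGroup N] {f : α → N} {L : List α}
    {g : {a // a ∈ L} → N} (h : ∀ a, g a = f a.1) : (L.attach.map g).sum = (L.map f).sum := by
  rw [List.map_congr_left (fun a _ => h a)]
  exact congrArg List.sum List.attach_map_val

lemma sum_filter_map {α : Type} {N : Type u} [AddCommGroup N] (P : α → Prop) [DecidablePred P]
    (f : α → N) (L : List α) :
    ((L.filter P).map f).sum = (L.map (fun a => if P a then f a else 0)).sum := by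
  induction L with
  | nil => rfl
  | cons a L ih => by_cases h : P a <;> simp [h, ih]

/-- The filter becomes an indicator, so that the calculus of `cutSum` applies. -/
lemma sum_innerCuts {N : Type u} [AddCommGroup N] (ψ : List PTree → List PTree → List PTree → N)
    (F : List PTree) :
    ((innerCuts F).map (fun s => ψ s.1 s.2.1 s.2.2)).sum =
      cutSum (fun l q => cutSum (fun m r =>
        if 2 ≤ m.length ∧ m.length < F.length then ψ l m r else 0) q) F := by
  unfold innerCuts
  -- The bound refers to the whole forest and has to stay fixed while the list of its cuts is
  -- shortened.
  generalize F.length = n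
  simp only [cutSum]
  induction cuts F with
  | nil => rfl
  | cons a L ih =>
    rw [List.flatMap_cons, List.map_append, List.sum_append, ih, List.map_map, List.map_cons,
      List.sum_cons, ← sum_filter_map (fun s : List PTree × List PTree =>
        2 ≤ s.1.length ∧ s.1.length < n)]
    rfl

end PTree

open PTree

/-! ### Tensors decorated by trees and forests -/

section Forests

variable {k : Type u} [CommRing k]

/-- The inclusion of the tensors of length `n`. -/
def TPow.toTStr {O : Type u} {M : O → O → Type u} [∀ X Y, AddCommGroup (M X Y)]
    [∀ X Y, Module k (M X Y)] (n : ℕ) (X Y : O) : TPow k M n X Y →ₗ[k] TStr k M X Y :=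
  TPow.lift (fun p _ => TStr.mk k p)
    ⟨fun l x y r _ _ _ => TStr.mk_multilinear.map_add l x y r,
     fun l c x r _ _ => TStr.mk_multilinear.map_smul l c x r⟩

@[simp]
lemma TPow.toTStr_mk {O : Type u} {M : O → O → Type u} [∀ X Y, AddCommGroup (M X Y)]
    [∀ X Y, Module k (M X Y)] {n : ℕ} {X Y : O} (p : Str M X Y) (h : p.length = n) :
    TPow.toTStr n X Y (TPow.mk p h) = TStr.mk k p := by simp [TPow.toTStr]

@[elab_as_elim]
lemma TPow.induction {O : Type u} {M : O → O → Type u} [∀ X Y, AddCommGroup (M X Y)]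
    [∀ X Y, Module k (M X Y)] {n : ℕ} {X Y : O} {P : TPow k M n X Y → Prop} (t : TPow k M n X Y)
    (mk : ∀ p h, P (TPow.mk p h)) (zero : P 0) (add : ∀ s t, P s → P t → P (s + t))
    (smul : ∀ (c : k) t, P t → P (c • t)) : P t := by
  have : t ∈ Submodule.span k {t : TPow k M n X Y | ∃ p h, t = TPow.mk p h} := by
    rw [TPow.span_mk]; trivial
  induction this using Submodule.span_induction with
  | mem x h => obtain ⟨p, hp, rfl⟩ := h; exact mk p hp
  | zero => exact zero
  | add x y _ _ hx hy => exact add _ _ hx hy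
  | smul c x _ hx => exact smul _ _ hx

/-- Together with `TPow.toTStr_mem` this allows tensors with a length in their type to be replaced
by members of `TStr.len`. -/
lemma TPow.exists_toTStr {O : Type u} {M : O → O → Type u} [∀ X Y, AddCommGroup (M X Y)]
    [∀ X Y, Module k (M X Y)] {n : ℕ} {X Y : O} {s : TStr k M X Y} (hs : s ∈ TStr.len k M n X Y) :
    ∃ t, TPow.toTStr n X Y t = s := by
  induction hs using Submodule.span_induction with
  | mem x hx => obtain ⟨p, hp, rfl⟩ := hx; exact ⟨TPow.mk p hp, TPow.toTStr_mk p hp⟩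
  | zero => exact ⟨0, map_zero _⟩
  | add x y _ _ hx hy =>
    obtain ⟨a, rfl⟩ := hx
    obtain ⟨b, rfl⟩ := hy
    exact ⟨a + b, map_add _ _ _⟩
  | smul c x _ hx => obtain ⟨a, rfl⟩ := hx; exact ⟨c • a, map_smul _ _ _⟩

lemma TPow.toTStr_mem {O : Type u} {M : O → O → Type u} [∀ X Y, AddCommGroup (M X Y)]
    [∀ X Y, Module k (M X Y)] {n : ℕ} {X Y : O} (t : TPow k M n X Y) :
    TPow.toTStr n X Y t ∈ TStr.len k M n X Y := by
  induction t using TPow.induction with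
  | mk p h => rw [TPow.toTStr_mk]; exact TStr.mk_mem_len p h
  | zero => rw [map_zero]; exact zero_mem _
  | add s t hs ht => rw [map_add]; exact add_mem hs ht
  | smul c t ht => rw [map_smul]; exact Submodule.smul_mem _ _ ht

lemma TPow.toTStr_cast {O : Type u} {M : O → O → Type u} [∀ X Y, AddCommGroup (M X Y)]
    [∀ X Y, Module k (M X Y)] {n m : ℕ} (h : n = m) {X Y : O} (t : TPow k M n X Y) :
    TPow.toTStr m X Y (TPow.cast h X Y t) = TPow.toTStr n X Y t := by
  induction t using TPow.induction with
  | mk p h => simp [TPow.cast]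
  | zero => simp
  | add s t hs ht => simp [hs, ht]
  | smul c t ht => simp [ht]

lemma TPow.toTStr_mul {O : Type u} {M : O → O → Type u} [∀ X Y, AddCommGroup (M X Y)]
    [∀ X Y, Module k (M X Y)] {n m : ℕ} {X Y Z : O} (s : TPow k M n X Y) (t : TPow k M m Y Z) :
    TPow.toTStr (n + m) X Z (TPow.mul n m X Y Z s t) =
      TStr.mul X Y Z (TPow.toTStr n X Y s) (TPow.toTStr m Y Z t) := by
  induction s using TPow.induction with
  | zero => simp
  | add s t hs ht => simp [hs, ht]
  | smul c t ht => simp [ht]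
  | mk p hp =>
    induction t using TPow.induction with
    | zero => simp
    | add s t hs ht => simp [hs, ht]
    | smul c t ht => simp [ht]
    | mk q hq => simp [TPow.mul]

lemma TPow.toTStr_snoc {O : Type u} {M : O → O → Type u} [∀ X Y, AddCommGroup (M X Y)]
    [∀ X Y, Module k (M X Y)] {n : ℕ} {X Y Z : O} (s : TPow k M n X Y) (x : M Y Z) :
    TPow.toTStr (n + 1) X Z (TPow.snoc n X Y Z s x) =
      TStr.mul X Y Z (TPow.toTStr n X Y s) (TStr.one Y Z x) := by
  induction s using TPow.induction with
  | zero => simp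
  | add s t hs ht => simp [hs, ht]
  | smul c t ht => simp [ht]
  | mk p hp =>
    rw [TPow.snoc_mk, TPow.toTStr_mk, ← TStr.mk_snoc]
    exact TPow.toTStr_mk (p.snoc x) _

variable (Q : DGQuiver k)

lemma toTStr_dStr {X Y : Q.Ob} (p : Str Q.Hom X Y) (n : ℕ) (h : p.length = n) :
    TPow.toTStr n X Y (dStr Q p n h) = Q.dStr' p := by
  induction p generalizing n with
  | nil => simp [dStr, DGQuiver.dStr']
  | snoc p x ih =>
    cases n with
    | zero => nomatch h
    | succ n =>
      rw [dStr, map_add, TPow.toTStr_snoc, ih, DGQuiver.dStr', ← TStr.mk_snoc]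
      exact congrArg _ (TPow.toTStr_mk (p.snoc (Q.d _ _ x)) h)

lemma toTStr_tensorD {n : ℕ} {X Y : Q.Ob} (t : TPow k Q.Hom n X Y) :
    TPow.toTStr n X Y (tensorD Q n X Y t) = Q.tD X Y (TPow.toTStr n X Y t) := by
  induction t using TPow.induction with
  | mk p h => rw [tensorD, TPow.lift_mk, toTStr_dStr, TPow.toTStr_mk, Q.tD_mk]
  | zero => simp
  | add s t hs ht => simp [hs, ht]
  | smul c t ht => simp [ht]

/-- Tensors as elements of the summand of `t`; this is zero unless `t` is good and has the correct
number of inputs. -/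
def inTree (t : PTree) (X Y : Q.Ob) : TStr k Q.Hom X Y →ₗ[k] FreeHom Q X Y := by
  classical
  exact TStr.lift (fun p => if h : t.Good ∧ p.length = t.leaves then
      DirectSum.lof k GTree (fun t => TPow k Q.Hom t.1.leaves X Y) ⟨t, h.1⟩ (TPow.mk p h.2) else 0)
    { map_add := fun l x y r => by
        by_cases h : t.Good ∧ ((l.snoc x).append r).length = t.leaves
        · have h1 : t.Good ∧ ((l.snoc y).append r).length = t.leaves := by
            simpa only [Str.length_append, Str.length] using h
          have h2 : t.Good ∧ ((l.snoc (x + y)).append r).length = t.leaves := by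
            simpa only [Str.length_append, Str.length] using h
          rw [dif_pos h, dif_pos h1, dif_pos h2, ← map_add]
          exact congrArg _ (TPow.mk_multilinear.map_add l x y r _ _ _)
        · have h1 : ¬(t.Good ∧ ((l.snoc y).append r).length = t.leaves) := by
            simpa only [Str.length_append, Str.length] using h
          have h2 : ¬(t.Good ∧ ((l.snoc (x + y)).append r).length = t.leaves) := by
            simpa only [Str.length_append, Str.length] using h
          rw [dif_neg h, dif_neg h1, dif_neg h2, add_zero]
      map_smul := fun l c x r => by
        by_cases h : t.Good ∧ ((l.snoc x).append r).length = t.leaves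
        · have h2 : t.Good ∧ ((l.snoc (c • x)).append r).length = t.leaves := by
            simpa only [Str.length_append, Str.length] using h
          rw [dif_pos h, dif_pos h2, ← map_smul]
          exact congrArg _ (TPow.mk_multilinear.map_smul l c x r _ _)
        · have h2 : ¬(t.Good ∧ ((l.snoc (c • x)).append r).length = t.leaves) := by
            simpa only [Str.length_append, Str.length] using h
          rw [dif_neg h, dif_neg h2, smul_zero] }

lemma inTree_mk {t : PTree} {X Y : Q.Ob} (p : Str Q.Hom X Y) (h : t.Good) (h' : p.length = t.leaves) :
    inTree Q t X Y (TStr.mk k p) =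
      DirectSum.lof k GTree (fun t => TPow k Q.Hom t.1.leaves X Y) ⟨t, h⟩ (TPow.mk p h') := by
  rw [inTree, TStr.lift_mk, dif_pos ⟨h, h'⟩]

lemma inTree_of_not_good {t : PTree} {X Y : Q.Ob} (h : ¬t.Good) (s : TStr k Q.Hom X Y) :
    inTree Q t X Y s = 0 := by
  induction s using TStr.induction with
  | mk p => rw [inTree, TStr.lift_mk, dif_neg (fun h' => h h'.1)]
  | zero => simp
  | add s t hs ht => simp [hs, ht]
  | smul c t ht => simp [ht]

lemma inTree_toTStr (t : GTree) {X Y : Q.Ob} (s : TPow k Q.Hom t.1.leaves X Y) :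
    inTree Q t.1 X Y (TPow.toTStr _ X Y s) = DirectSum.lof k GTree _ t s := by
  induction s using TPow.induction with
  | mk p h => exact (congrArg _ (TPow.toTStr_mk p h)).trans (inTree_mk Q p t.2 h)
  | zero => simp
  | add s t hs ht => simp [hs, ht]
  | smul c t ht => simp [ht]

@[elab_as_elim]
lemma free_induction {X Y : Q.Ob} {P : FreeHom Q X Y → Prop} (y : FreeHom Q X Y)
    (inTree : ∀ t p, t.Good → p.length = t.leaves → P (inTree Q t X Y (TStr.mk k p)))
    (zero : P 0) (add : ∀ s t, P s → P t → P (s + t))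
    (smul : ∀ (c : k) t, P t → P (c • t)) : P y := by
  induction y using DirectSum.induction_on with
  | zero => exact zero
  | add x y hx hy => exact add _ _ hx hy
  | of t s =>
    rw [← DirectSum.lof_eq_of k]
    induction s using TPow.induction with
    | mk p h => have := inTree t.1 p t.2 h; rw [inTree_mk Q p t.2 h] at this; exact this
    | zero => rw [map_zero]; exact zero
    | add s t hs ht => rw [map_add]; exact add _ _ hs ht
    | smul c t ht => rw [map_smul]; exact smul _ _ ht

lemma freeB1_toTStr (t : GTree) {X Y : Q.Ob} (s : TPow k Q.Hom t.1.leaves X Y) :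
    freeB1 Q X Y (DirectSum.lof k GTree _ t s) =
      (-1 : k) ^ t.1.size • inTree Q t.1 X Y (Q.tD X Y (TPow.toTStr _ X Y s)) +
      ((expand t.1).map (fun c => (-1 : k) ^ (1 + c.1) •
        inTree Q c.2 X Y (TPow.toTStr _ X Y s))).sum := by
  rw [freeB1, DirectSum.toModule_lof, LinearMap.add_apply, ← toTStr_tensorD, inTree_toTStr Q t]
  refine congrArg (_ + ·) ?_
  -- Evaluation at `s` is linear in the map, hence passes through the list sum.
  rw [← LinearMap.applyₗ_apply_apply (R := k) s, map_list_sum, List.map_map]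
  refine sum_attach_map (fun c => ?_)
  rw [← TPow.toTStr_cast (expand_spec t.1 t.2 c.1 c.2).2.symm]
  exact congrArg ((-1 : k) ^ (1 + c.1.1) • ·)
    (inTree_toTStr Q ⟨c.1.2, (expand_spec t.1 t.2 c.1 c.2).1⟩ _).symm

/-- The operation `b₁` on the summand of a tree. -/
lemma freeB1_inTree {t : PTree} (ht : t.Good) {X Y : Q.Ob} {s : TStr k Q.Hom X Y}
    (hs : s ∈ TStr.len k Q.Hom t.leaves X Y) :
    freeB1 Q X Y (inTree Q t X Y s) = (-1 : k) ^ t.size • inTree Q t X Y (Q.tD X Y s) +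
      ((expand t).map (fun c => (-1 : k) ^ (1 + c.1) • inTree Q c.2 X Y s)).sum := by
  obtain ⟨s, rfl⟩ := TPow.exists_toTStr hs
  have := freeB1_toTStr Q ⟨t, ht⟩ s
  rwa [← inTree_toTStr Q ⟨t, ht⟩] at this

/-- Tensors on the leaves of forests. -/
abbrev Forests (X Y : Q.Ob) : Type u := List PTree →₀ TStr k Q.Hom X Y

/-- Elements of `s𝓕Q` as tensors on the leaves of forests with one tree. -/
def toForests (X Y : Q.Ob) : FreeHom Q X Y →ₗ[k] Forests Q X Y :=
  DirectSum.toModule k GTree _ (fun t => Finsupp.lsingle [t.1] ∘ₗ TPow.toTStr _ X Y)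

lemma toForests_inTree {t : PTree} (ht : t.Good) {X Y : Q.Ob} {s : TStr k Q.Hom X Y}
    (hs : s ∈ TStr.len k Q.Hom t.leaves X Y) :
    toForests Q X Y (inTree Q t X Y s) = Finsupp.single [t] s := by
  obtain ⟨s, rfl⟩ := TPow.exists_toTStr hs
  rw [inTree_toTStr Q ⟨t, ht⟩, toForests]
  exact DirectSum.toModule_lof k (ι := GTree) _ _

/-- The projection of forests onto trees. -/
def ofForests (X Y : Q.Ob) : Forests Q X Y →ₗ[k] FreeHom Q X Y :=
  Finsupp.lsum k (fun F => match F with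
    | [t] => inTree Q t X Y
    | _ => 0)

lemma ofForests_single {X Y : Q.Ob} (t : PTree) (s : TStr k Q.Hom X Y) :
    ofForests Q X Y (Finsupp.single [t] s) = inTree Q t X Y s := by
  simp [ofForests]

lemma ofForests_toForests {X Y : Q.Ob} (y : FreeHom Q X Y) :
    ofForests Q X Y (toForests Q X Y y) = y := by
  induction y using free_induction with
  | inTree t p ht hp => rw [toForests_inTree Q ht (TStr.mk_mem_len p hp), ofForests_single]
  | zero => simp
  | add s t hs ht => simp only [map_add, hs, ht]
  | smul c t ht => simp only [map_smul, ht]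

/-- The combinations of tensors on the leaves of good forests of `n` trees. -/
def goodForests (n : ℕ) (X Y : Q.Ob) : Submodule k (Forests Q X Y) :=
  Submodule.span k {w | ∃ F s, F.length = n ∧ GoodL F ∧ s ∈ TStr.len k Q.Hom (leavesL F) X Y ∧
    w = Finsupp.single F s}

lemma toForests_mem_good {X Y : Q.Ob} (y : FreeHom Q X Y) :
    toForests Q X Y y ∈ goodForests Q 1 X Y := by
  induction y using free_induction with
  | inTree t p ht hp =>
    rw [toForests_inTree Q ht (TStr.mk_mem_len p hp)]
    refine Submodule.subset_span ⟨[t], _, rfl, by simpa [GoodL] using ht, ?_, rfl⟩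
    rw [leavesL_singleton]
    exact TStr.mk_mem_len p hp
  | zero => rw [map_zero]; exact zero_mem _
  | add s t hs ht => rw [map_add]; exact add_mem hs ht
  | smul c t ht => rw [map_smul]; exact Submodule.smul_mem _ _ ht

/-- The homogeneous elements of degree `e`; the summand of a forest is shifted by its size. -/
def forestsGr (X Y : Q.Ob) (e : ℤ) : Submodule k (Forests Q X Y) :=
  Submodule.span k {w | ∃ F s, s ∈ TStr.gr Q.sgr X Y (e - sizeL F) ∧ w = Finsupp.single F s}

lemma toTStr_mem_gr {X Y : Q.Ob} {n : ℕ} {e : ℤ} {t : TPow k Q.Hom n X Y}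
    (ht : t ∈ TPow.gr Q.sgr n X Y e) : TPow.toTStr n X Y t ∈ TStr.gr Q.sgr X Y e := by
  induction ht using Submodule.span_induction with
  | mem x hx => obtain ⟨p, h, hp, rfl⟩ := hx; rw [TPow.toTStr_mk]; exact TStr.mk_mem_gr hp
  | zero => rw [map_zero]; exact zero_mem _
  | add s t _ _ hs ht => rw [map_add]; exact add_mem hs ht
  | smul c t _ ht => rw [map_smul]; exact Submodule.smul_mem _ _ ht

lemma toForests_mem_gr {X Y : Q.Ob} {e : ℤ} {y : FreeHom Q X Y} (hy : y ∈ freeSGr Q X Y e) :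
    toForests Q X Y y ∈ forestsGr Q X Y e := by
  induction hy using Submodule.iSup_induction' with
  | mem t y hy =>
    obtain ⟨s, hs, rfl⟩ := hy
    rw [toForests, DirectSum.toModule_lof]
    exact Submodule.subset_span ⟨[t.1], _, by
      rw [sizeL_singleton]; exact toTStr_mem_gr Q hs, rfl⟩
  | zero => rw [map_zero]; exact zero_mem _
  | add s t _ _ hs ht => rw [map_add]; exact add_mem hs ht

lemma inTree_mem_gr {t : PTree} {X Y : Q.Ob} {e : ℤ} {s : TStr k Q.Hom X Y}
    (hs : s ∈ TStr.gr Q.sgr X Y (e - t.size)) : inTree Q t X Y s ∈ freeSGr Q X Y e := by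
  induction hs using Submodule.span_induction with
  | zero => rw [map_zero]; exact zero_mem _
  | add s t _ _ hs ht => rw [map_add]; exact add_mem hs ht
  | smul c t _ ht => rw [map_smul]; exact Submodule.smul_mem _ _ ht
  | mem x hx =>
    obtain ⟨p, hp, rfl⟩ := hx
    by_cases h : t.Good ∧ p.length = t.leaves
    · rw [inTree_mk Q p h.1 h.2]
      exact Submodule.mem_iSup_of_mem ⟨t, h.1⟩ ⟨_, Submodule.subset_span ⟨p, h.2, hp, rfl⟩, rfl⟩
    · rw [inTree, TStr.lift_mk, dif_neg h]; exact zero_mem _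

/-- The parity involution. -/
def forestsσ (X Y : Q.Ob) : Forests Q X Y →ₗ[k] Forests Q X Y :=
  Finsupp.lsum k (fun F => (-1 : k) ^ sizeL F • (Finsupp.lsingle F ∘ₗ Q.tσ X Y))

lemma forestsσ_single {X Y : Q.Ob} (F : List PTree) (s : TStr k Q.Hom X Y) :
    forestsσ Q X Y (Finsupp.single F s) = (-1 : k) ^ sizeL F • Finsupp.single F (Q.tσ X Y s) := by
  simp [forestsσ]

lemma forestsσ_of_mem {X Y : Q.Ob} {e : ℤ} {w : Forests Q X Y} (hw : w ∈ forestsGr Q X Y e) :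
    forestsσ Q X Y w = sgn k e • w := by
  induction hw using Submodule.span_induction with
  | zero => simp
  | add s t _ _ hs ht => simp only [map_add, hs, ht, smul_add]
  | smul c t _ ht => rw [map_smul, ht, smul_comm]
  | mem x hx =>
    obtain ⟨F, s, hs, rfl⟩ := hx
    rw [forestsσ_single, Q.tσ_of_mem hs, ← Finsupp.smul_single, smul_smul, ← sgn_natCast,
      ← sgn_add, add_sub_cancel]

/-- Both sides are $(-1)^d$ in degree `d`. This replaces the parity of $s\mathcal F\mathcal Q$,
defined through homogeneous components, by an explicit formula: on the summand of $t$ the degree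
exceeds the tensor degree by $|t|$. -/
lemma toForests_freeSσ {X Y : Q.Ob} (y : FreeHom Q X Y) :
    toForests Q X Y (freeSσ Q X Y y) = forestsσ Q X Y (toForests Q X Y y) := by
  have : toForests Q X Y ∘ₗ freeSσ Q X Y = forestsσ Q X Y ∘ₗ toForests Q X Y := by
    refine linearMap_ext_of_isInternal (freeSGr_internal Q X Y) fun d x hx => ?_
    rw [LinearMap.comp_apply, LinearMap.comp_apply, forestsσ_of_mem Q (toForests_mem_gr Q hx),
      freeSσ, parity_of_mem _ hx, map_smul]
  exact LinearMap.congr_fun this y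

lemma freeSσ_inTree {t : PTree} (ht : t.Good) {X Y : Q.Ob} {s : TStr k Q.Hom X Y}
    (hs : s ∈ TStr.len k Q.Hom t.leaves X Y) :
    freeSσ Q X Y (inTree Q t X Y s) = (-1 : k) ^ t.size • inTree Q t X Y (Q.tσ X Y s) := by
  rw [← ofForests_toForests Q (freeSσ Q X Y _), toForests_freeSσ, toForests_inTree Q ht hs,
    forestsσ_single, map_smul, ofForests_single, sizeL_singleton]

lemma freeSσ_pow_inTree {t : PTree} (ht : t.Good) {X Y : Q.Ob} {s : TStr k Q.Hom X Y}
    (hs : s ∈ TStr.len k Q.Hom t.leaves X Y) (m : ℕ) :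
    (freeSσ Q X Y ^ m) (inTree Q t X Y s) = inTree Q t X Y (Q.tw m t.size X Y s) := by
  induction m with
  | zero => simp [Q.tw_zero_left]
  | succ m ih =>
    rw [pow_succ', Module.End.mul_apply, ih, freeSσ_inTree Q ht (Q.tw_mem_len hs), Q.tw_succ_left,
      Q.tσ_tw, map_smul]

/-- The product of tensors on the leaves of forests. On the summands of `F` and `G` it is the
concatenation of tensors with sign `(-1)` to the size of `F` times the degree of the second factor. -/
def forestsMul (X Y Z : Q.Ob) : Forests Q X Y →ₗ[k] Forests Q Y Z →ₗ[k] Forests Q X Z :=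
  Finsupp.lsum k (fun F => (Finsupp.lsum k (fun G =>
    (((TStr.mul X Y Z).compl₂ (Q.tw (sizeL F) (sizeL G) Y Z)).compr₂
      (Finsupp.lsingle (F ++ G))).flip)).flip)

lemma forestsMul_single {X Y Z : Q.Ob} (F G : List PTree) (s : TStr k Q.Hom X Y)
    (t : TStr k Q.Hom Y Z) :
    forestsMul Q X Y Z (Finsupp.single F s) (Finsupp.single G t) =
      Finsupp.single (F ++ G) (TStr.mul X Y Z s (Q.tw (sizeL F) (sizeL G) Y Z t)) := by
  simp [forestsMul]

/-- Both signs have the exponent $|F|\deg b+(|F|+|G|)\deg c$; this is `tw_mul`. -/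
lemma forestsMul_assoc {X Y Z W : Q.Ob} (a : Forests Q X Y) (b : Forests Q Y Z) (c : Forests Q Z W) :
    forestsMul Q _ _ _ (forestsMul Q _ _ _ a b) c =
      forestsMul Q _ _ _ a (forestsMul Q _ _ _ b c) := by
  induction a using Finsupp.induction_linear with
  | zero => simp
  | add s t hs ht => simp only [map_add, LinearMap.add_apply, hs, ht]
  | single F s =>
    induction b using Finsupp.induction_linear with
    | zero => simp
    | add s t hs ht => simp only [map_add, LinearMap.add_apply, hs, ht]
    | single G t =>
      induction c using Finsupp.induction_linear with
      | zero => simp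
      | add s t hs ht => simp only [map_add, hs, ht]
      | single H r =>
        simp only [forestsMul_single, sizeL_append, List.append_assoc, Q.tw_mul, TStr.mul_assoc]

lemma forestsMul_one {X Y : Q.Ob} (a : Forests Q X Y) :
    forestsMul Q _ _ _ a (Finsupp.single [] (TStr.mk k Str.nil)) = a := by
  induction a using Finsupp.induction_linear with
  | zero => simp
  | add s t hs ht => simp only [map_add, LinearMap.add_apply, hs, ht]
  | single F s =>
    rw [forestsMul_single, List.append_nil, sizeL, Q.tw_nil, TStr.mul_one]

lemma one_forestsMul {X Y : Q.Ob} (a : Forests Q X Y) :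
    forestsMul Q _ _ _ (Finsupp.single [] (TStr.mk k Str.nil)) a = a := by
  induction a using Finsupp.induction_linear with
  | zero => simp
  | add s t hs ht => simp only [map_add, hs, ht]
  | single F s => rw [forestsMul_single, sizeL, Q.tw_zero_left, TStr.one_mul, List.nil_append]

lemma forestsMul_mem_good {X Y Z : Q.Ob} {a : Forests Q X Y} {b : Forests Q Y Z}
    {m n : ℕ} (ha : a ∈ goodForests Q m X Y) (hb : b ∈ goodForests Q n Y Z) :
    forestsMul Q X Y Z a b ∈ goodForests Q (m + n) X Z := by
  have := Submodule.apply_mem_map₂ (forestsMul Q X Y Z) ha hb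
  rw [goodForests, goodForests, Submodule.map₂_span_span] at this
  refine Submodule.span_mono ?_ this
  rintro _ ⟨_, ⟨F, s, hFn, hF, hs, rfl⟩, _, ⟨G, t, hGn, hG, ht, rfl⟩, rfl⟩
  refine ⟨F ++ G, _, by rw [List.length_append, hFn, hGn], (goodL_append F G).2 ⟨hF, hG⟩, ?_, forestsMul_single Q F G s t⟩
  rw [leavesL_append]
  exact TStr.mul_mem_len hs (Q.tw_mem_len ht)

lemma forestsMul_mem_gr {X Y Z : Q.Ob} {a : Forests Q X Y} {b : Forests Q Y Z} {d e : ℤ}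
    (ha : a ∈ forestsGr Q X Y d) (hb : b ∈ forestsGr Q Y Z e) :
    forestsMul Q X Y Z a b ∈ forestsGr Q X Z (d + e) := by
  have := Submodule.apply_mem_map₂ (forestsMul Q X Y Z) ha hb
  rw [forestsGr, forestsGr, Submodule.map₂_span_span] at this
  refine Submodule.span_mono ?_ this
  rintro _ ⟨_, ⟨F, s, hs, rfl⟩, _, ⟨G, t, ht, rfl⟩, rfl⟩
  refine ⟨F ++ G, _, ?_, forestsMul_single Q F G s t⟩
  rw [sizeL_append, show d + e - ((sizeL F + sizeL G : ℕ) : ℤ) =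
    (d - sizeL F) + (e - sizeL G) by push_cast; ring]
  exact TStr.mul_mem_gr hs (Q.tw_mem_gr ht)

/-- The product of the entries of a string. -/
def forestsProd {X : Q.Ob} : {Y : Q.Ob} → Str (FreeHom Q) X Y → Forests Q X Y
  | _, Str.nil => Finsupp.single [] (TStr.mk k Str.nil)
  | _, Str.snoc p y => forestsMul Q _ _ _ (forestsProd p) (toForests Q _ _ y)

lemma forestsProd_multilinear {X Y : Q.Ob} :
    Str.IsMultilinear k (fun p : Str (FreeHom Q) X Y => forestsProd Q p) where
  map_add l x y r := by
    induction r with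
    | nil => simp only [Str.append, forestsProd, map_add]
    | snoc r z ih =>
      simp only [Str.append, forestsProd]
      rw [ih]
      simp only [map_add, LinearMap.add_apply]
  map_smul l c x r := by
    induction r with
    | nil => simp only [Str.append, forestsProd, map_smul]
    | snoc r z ih =>
      simp only [Str.append, forestsProd]
      rw [ih]
      simp only [map_smul, LinearMap.smul_apply]

lemma forestsProd_append {X Y Z : Q.Ob} (p : Str (FreeHom Q) X Y) (q : Str (FreeHom Q) Y Z) :
    forestsProd Q (p.append q) = forestsMul Q _ _ _ (forestsProd Q p) (forestsProd Q q) := by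
  induction q with
  | nil => rw [forestsProd, forestsMul_one]; rfl
  | snoc q y ih => rw [Str.append, forestsProd, ih, forestsProd, forestsMul_assoc]

lemma forestsProd_mem_good {X Y : Q.Ob} (p : Str (FreeHom Q) X Y) :
    forestsProd Q p ∈ goodForests Q p.length X Y := by
  induction p with
  | nil =>
    refine Submodule.subset_span ⟨[], _, rfl, by simp [GoodL], ?_, rfl⟩
    exact TStr.mk_mem_len _ (by simp [Str.length, leavesL])
  | snoc p y ih => exact forestsMul_mem_good Q ih (toForests_mem_good Q y)

lemma forestsProd_mem_gr {X Y : Q.Ob} {p : Str (FreeHom Q) X Y} {e : ℤ}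
    (hp : p.IsHomog (freeSGr Q) e) : forestsProd Q p ∈ forestsGr Q X Y e := by
  induction p generalizing e with
  | nil =>
    refine Submodule.subset_span ⟨[], _, ?_, rfl⟩
    rw [show e = 0 from hp]
    exact TStr.mk_mem_gr (by simp [sizeL, Str.IsHomog])
  | snoc p y ih =>
    obtain ⟨a, b, ha, hb, rfl⟩ := hp
    exact forestsMul_mem_gr Q (ih ha) (toForests_mem_gr Q hb)

/-- Grafting the trees of a forest onto a new lowest vertex. -/
def plant (X Y : Q.Ob) : Forests Q X Y →ₗ[k] FreeHom Q X Y :=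
  Finsupp.lsum k (fun F => inTree Q (PTree.node F) X Y)

lemma plant_single {X Y : Q.Ob} (F : List PTree) (s : TStr k Q.Hom X Y) :
    plant Q X Y (Finsupp.single F s) = inTree Q (PTree.node F) X Y s := by simp [plant]

/-- The new vertex would have fewer than two inputs. Thus `plant` contributes nothing to $b_0$ and
$b_1$. -/
lemma plant_single_of_length {X Y : Q.Ob} {F : List PTree} (hF : F.length < 2)
    (s : TStr k Q.Hom X Y) : plant Q X Y (Finsupp.single F s) = 0 := by
  rw [plant_single, inTree_of_not_good]
  rw [PTree.Good]
  omega

/-- Forests of `j` good trees among all forests. -/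
def forestHomToForests (j : ℕ) (X Y : Q.Ob) : ForestHom Q j X Y →ₗ[k] Forests Q X Y :=
  DirectSum.toModule k (GForest j) _ (fun F => Finsupp.lsingle F.1 ∘ₗ TPow.toTStr _ X Y)

lemma graft_lof {j : ℕ} {X Y Z : Q.Ob} (F : GForest j) (t : GTree)
    (z : TPow k Q.Hom (leavesL F.1) X Y) (y : FreeHom Q Y Z) (s : TPow k Q.Hom t.1.leaves Y Z)
    (h : (freeSσ Q Y Z ^ sizeL F.1) y = DirectSum.lof k GTree _ t s) :
    forestHomToForests Q (j + 1) X Z (graft Q j X Y Z (DirectSum.lof k (GForest j) _ F z) y) =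
      Finsupp.single (F.1 ++ [t.1]) (TStr.mul X Y Z (TPow.toTStr _ X Y z) (TPow.toTStr _ Y Z s)) := by
  rw [graft, DirectSum.toModule_lof, LinearMap.flip_apply, LinearMap.comp_apply, h,
    DirectSum.toModule_lof, LinearMap.flip_apply]
  simp only [forestHomToForests, LinearMap.compr₂_apply, LinearMap.comp_apply,
    DirectSum.toModule_lof, TPow.toTStr_cast, TPow.toTStr_mul, Finsupp.lsingle_apply]
  rfl

/-- The power of the parity in `graft` acts on the summand of a tree as the twist in `forestsMul`,
by `freeSσ_pow_inTree`. -/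
lemma forestHomToForests_graft {j : ℕ} {X Y Z : Q.Ob} (z : ForestHom Q j X Y) (y : FreeHom Q Y Z) :
    forestHomToForests Q (j + 1) X Z (graft Q j X Y Z z y) =
      forestsMul Q X Y Z (forestHomToForests Q j X Y z) (toForests Q Y Z y) := by
  induction z using DirectSum.induction_on with
  | zero => simp
  | add a b ha hb => simp only [map_add, LinearMap.add_apply, ha, hb]
  | of F z =>
    rw [← DirectSum.lof_eq_of k]
    induction y using free_induction with
    | zero => simp
    | add a b ha hb => simp only [map_add, ha, hb]
    | smul c b hb => simp only [map_smul, hb]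
    | inTree t p ht hp =>
      have hp := TStr.mk_mem_len (k := k) p hp
      -- `s` is the twisted tensor, taken in the tensor power of the right length so that it lies in
      -- the summand of `t`.
      obtain ⟨s, hs⟩ := TPow.exists_toTStr (Q.tw_mem_len (a := sizeL F.1) (b := t.size) hp)
      refine (graft_lof Q F ⟨t, ht⟩ z _ s ?_).trans ?_
      · rw [freeSσ_pow_inTree Q ht hp, ← hs, inTree_toTStr Q ⟨t, ht⟩]
      · rw [toForests_inTree Q ht hp, forestHomToForests, DirectSum.toModule_lof,
          LinearMap.comp_apply, Finsupp.lsingle_apply, forestsMul_single, sizeL_singleton, hs]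

lemma forestHomToForests_graftStr {X Y : Q.Ob} (p : Str (FreeHom Q) X Y) :
    forestHomToForests Q p.length X Y (graftStr Q p) = forestsProd Q p := by
  induction p with
  | nil =>
    rw [graftStr, forestHomToForests]
    refine (DirectSum.toModule_lof k _ _).trans ?_
    exact congrArg (Finsupp.single []) (TPow.toTStr_mk Str.nil _)
  | snoc p y ih =>
    rw [graftStr, forestsProd, ← ih]
    exact forestHomToForests_graft Q _ _

lemma close_eq_plant {j : ℕ} (hj : 2 ≤ j) {X Y : Q.Ob} (w : ForestHom Q j X Y) :
    close Q hj X Y w = plant Q X Y (forestHomToForests Q j X Y w) := by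
  induction w using DirectSum.induction_on with
  | zero => simp
  | add a b ha hb => simp only [map_add, ha, hb]
  | of F z =>
    rw [← DirectSum.lof_eq_of k, close, DirectSum.toModule_lof, forestHomToForests,
      DirectSum.toModule_lof, LinearMap.comp_apply, LinearMap.comp_apply, Finsupp.lsingle_apply,
      plant_single, ← inTree_toTStr, TPow.toTStr_cast]
    rfl

/-- The signs of all higher operations are those of the associative product, so `plant` does not
depend on the arity. -/
lemma freeB_eq_plant {X Y : Q.Ob} (p : Str (FreeHom Q) X Y) (hp : 2 ≤ p.length) :
    freeB Q p = plant Q X Y (forestsProd Q p) := by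
  match p with
  | Str.nil => simp [Str.length] at hp
  | Str.snoc Str.nil y => simp [Str.length] at hp
  | Str.snoc (Str.snoc p x) y =>
    rw [← forestHomToForests_graftStr]
    exact close_eq_plant Q _ _

end Forests

/-! ### Sums over the infixes of a string -/

namespace Str

section bSum

variable {O : Type u} {M : O → O → Type u} {N : Type u} [AddCommGroup N]
  (b : ∀ X Y, Str M X Y → M X Y) (σ : ∀ X Y, M X Y → M X Y)

/-- The sum of `φ (l · b(m) · σ(r))` over all ways to write a string as `l · m · r` with `m` non-empty. -/
def bSum {X Y : O} (φ : Str M X Y → N) (p : Str M X Y) : N :=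
  (p.infixes.map (fun s =>
    φ ((s.2.2.1.snoc (b _ _ s.2.2.2.1)).append (s.2.2.2.2.map id σ)))).sum

@[simp]
lemma bSum_nil {X : O} (φ : Str M X X → N) : bSum b σ φ nil = 0 := by simp [bSum, infixes]

/-- Either the infix ends before `x`, and then the operation passes over `x` and leaves its parity
sign, or `x` is its last entry. -/
lemma bSum_snoc {X Y Z : O} (φ : Str M X Z → N) (p : Str M X Y) (x : M Y Z) :
    bSum b σ φ (p.snoc x) = bSum b σ (fun q => φ (q.snoc (σ Y Z x))) p +
      splitSum (fun _ l r => φ (l.snoc (b _ _ (r.snoc x)))) p := by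
  simp only [bSum, infixes, splitSum, List.map_append, List.map_map, List.sum_append]
  rfl

lemma bSum_add {X Y : O} (φ φ' : Str M X Y → N) (p : Str M X Y) :
    bSum b σ (fun q => φ q + φ' q) p = bSum b σ φ p + bSum b σ φ' p := by
  simp [bSum]

lemma map_bSum {N' F : Type u} [AddCommGroup N'] [FunLike F N N'] [AddMonoidHomClass F N N']
    (f : F) {X Y : O} (φ : Str M X Y → N) (p : Str M X Y) :
    f (bSum b σ φ p) = bSum b σ (fun q => f (φ q)) p := by
  simp [bSum, map_list_sum, Function.comp_def]

lemma bSum_zero {X Y : O} (p : Str M X Y) : bSum b σ (fun _ => (0 : N)) p = 0 := by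
  simp [bSum]

/-- An infix other than the whole string leaves a string of length at least two, so only the term
$b(p)$ survives. -/
lemma bSum_eq_of_length {X Y : O} {φ : Str M X Y → N} (hφ : ∀ q, 2 ≤ q.length → φ q = 0)
    {p : Str M X Y} (hp : 1 ≤ p.length) : bSum b σ φ p = φ (one (b _ _ p)) := by
  cases p with
  | nil => simp [length] at hp
  | snoc p x =>
    rw [bSum_snoc, splitSum_eq_of_left]
    -- Replacing an infix by its value always leaves a non-empty string, so a function vanishing on
    -- non-empty strings has `bSum` zero.
    · have : ∀ {Z : O} (p : Str M X Z) (φ : Str M X Z → N) (_ : ∀ q, 1 ≤ q.length → φ q = 0),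
          bSum b σ φ p = 0 := by
        intro Z p
        induction p with
        | nil => simp
        | snoc p x ih =>
          intro φ hφ
          rw [bSum_snoc, ih _ (fun q _ => hφ _ (by simp [length])), zero_add,
            splitSum_congr (ψ' := fun _ _ _ => 0) (fun Z l r _ => hφ _ (by simp [length])),
            splitSum_zero]
      rw [this p _ (fun q hq => hφ _ (by simp only [length]; omega)), zero_add]
      rfl
    · exact fun Z l r _ hl => hφ _ (by simp only [length]; omega)

end bSum

lemma splitSum_sub {O : Type u} {M : O → O → Type u} {N : Type u} [AddCommGroup N] {X Y : O}
    (ψ ψ' : ∀ Z, Str M X Z → Str M Z Y → N) (p : Str M X Y) :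
    splitSum (fun Z l r => ψ Z l r - ψ' Z l r) p = splitSum ψ p - splitSum ψ' p := by
  rw [eq_sub_iff_add_eq, ← splitSum_add]
  simp

end Str

open PTree

/-! ### The operations on forests -/

section Forests

variable {k : Type u} [CommRing k] (Q : DGQuiver k)

/-- Collecting the branches `m` of `l ++ m ++ r` in a new vertex, with sign. -/
def nest (l m r : List PTree) (X Y : Q.Ob) : TStr k Q.Hom X Y →ₗ[k] Forests Q X Y :=
  if 2 ≤ m.length then (-1 : k) ^ sizeL l • Finsupp.lsingle (l ++ PTree.node m :: r) else 0

lemma nest_of_length {m : List PTree} (hm : m.length < 2) (l r : List PTree) (X Y : Q.Ob) :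
    nest Q l m r X Y = 0 := if_neg (by omega)

/-- The new vertex enlarges the left forest by one, so one more shift moves past the right factor.
-/
lemma nest_mul (l m r G : List PTree) {X Y Z : Q.Ob} (s : TStr k Q.Hom X Y) (t : TStr k Q.Hom Y Z) :
    forestsMul Q X Y Z (nest Q l m r X Y s) (Finsupp.single G t) =
      nest Q l m (r ++ G) X Z (TStr.mul X Y Z s (Q.tw (sizeL (l ++ (m ++ r)) + 1) (sizeL G) Y Z t)) := by
  unfold nest
  split_ifs
  · simp only [LinearMap.smul_apply, Finsupp.lsingle_apply, map_smul, forestsMul_single,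
      List.append_assoc, List.cons_append, sizeL_append, sizeL, PTree.size]
    rw [show sizeL l + (1 + sizeL m + sizeL r) = sizeL l + (sizeL m + sizeL r) + 1 by omega]
  · simp

/-- The new vertex raises the shift of the right factor by one. By `tw_succ_right` this costs
$(-1)^{|F|}$, which is the sign of `nest` when `F` stands to the left of the block. -/
lemma mul_nest (F G : List PTree) {X Y Z : Q.Ob} (s : TStr k Q.Hom X Y) (t : TStr k Q.Hom Y Z) :
    forestsMul Q X Y Z (Finsupp.single F s) (nest Q [] G [] Y Z t) =
      nest Q F G [] X Z (TStr.mul X Y Z s (Q.tw (sizeL F) (sizeL G) Y Z t)) := by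
  unfold nest
  split_ifs
  · simp only [LinearMap.smul_apply, Finsupp.lsingle_apply, forestsMul_single, sizeL, pow_zero,
      one_smul, List.nil_append, PTree.size, add_zero, add_comm 1, Q.tw_succ_right, map_smul,
      Finsupp.smul_single]
  · simp

lemma cutSum_apply {X Y : Q.Ob} (ψ : List PTree → List PTree → TStr k Q.Hom X Y →ₗ[k] Forests Q X Y)
    (F : List PTree) (s : TStr k Q.Hom X Y) :
    cutSum ψ F s = cutSum (fun l m => ψ l m s) F :=
  map_cutSum (LinearMap.applyₗ (R := k) s) ψ F

/-- The part of the differential which inserts an edge above a root of a forest. -/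
def forestsN (X Y : Q.Ob) : Forests Q X Y →ₗ[k] Forests Q X Y :=
  Finsupp.lsum k (fun F => cutSum (fun l q => cutSum (fun m r => nest Q l m r X Y) q) F)

lemma forestsN_single (F : List PTree) {X Y : Q.Ob} (s : TStr k Q.Hom X Y) :
    forestsN Q X Y (Finsupp.single F s) =
      cutSum (fun l q => cutSum (fun m r => nest Q l m r X Y s) q) F := by
  simp only [forestsN, Finsupp.lsum_single, cutSum_apply]

/-- The part of the differential which comes from the single trees of a forest. -/
def forestsD (X Y : Q.Ob) : Forests Q X Y →ₗ[k] Forests Q X Y :=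
  Finsupp.lsum k (fun F => (-1 : k) ^ sizeL F • (Finsupp.lsingle F ∘ₗ Q.tD X Y) +
    ((expandL F).map (fun c => (-1 : k) ^ (1 + c.1) • Finsupp.lsingle c.2)).sum)

lemma forestsD_single (F : List PTree) {X Y : Q.Ob} (s : TStr k Q.Hom X Y) :
    forestsD Q X Y (Finsupp.single F s) = (-1 : k) ^ sizeL F • Finsupp.single F (Q.tD X Y s) +
      ((expandL F).map (fun c => (-1 : k) ^ (1 + c.1) •
        (Finsupp.single c.2 s : Forests Q X Y))).sum := by
  rw [forestsD, Finsupp.lsum_single, LinearMap.add_apply]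
  congr 1
  rw [← LinearMap.applyₗ_apply_apply (R := k) s, map_list_sum, List.map_map]
  rfl

/-- Collecting the last trees of a forest together with all trees of another one in a new vertex. -/
def nestLast (X Y Z : Q.Ob) : Forests Q X Y →ₗ[k] Forests Q Y Z →ₗ[k] Forests Q X Z :=
  Finsupp.lsum k (fun F => (Finsupp.lsum k (fun G =>
    (((TStr.mul X Y Z).compl₂ (Q.tw (sizeL F) (sizeL G) Y Z)).compr₂
      (cutSum (fun l m => nest Q l (m ++ G) [] X Z) F)).flip)).flip)

lemma nestLast_single {X Y Z : Q.Ob} (F G : List PTree) (s : TStr k Q.Hom X Y)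
    (t : TStr k Q.Hom Y Z) :
    nestLast Q X Y Z (Finsupp.single F s) (Finsupp.single G t) =
      cutSum (fun l m => nest Q l (m ++ G) [] X Z
        (TStr.mul X Y Z s (Q.tw (sizeL F) (sizeL G) Y Z t))) F := by
  simp [nestLast, cutSum_apply]

/-- Collecting all trees of a forest in a new vertex. -/
def nestAll (X Y : Q.Ob) : Forests Q X Y →ₗ[k] Forests Q X Y :=
  Finsupp.lsum k (fun F => nest Q [] F [] X Y)

lemma nestAll_single (F : List PTree) {X Y : Q.Ob} (s : TStr k Q.Hom X Y) :
    nestAll Q X Y (Finsupp.single F s) = nest Q [] F [] X Y s := by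
  simp [nestAll]

lemma nestAll_toForests {X Y : Q.Ob} (y : FreeHom Q X Y) :
    nestAll Q X Y (toForests Q X Y y) = 0 := by
  induction y using free_induction with
  | inTree t p ht hp =>
    rw [toForests_inTree Q ht (TStr.mk_mem_len p hp), nestAll_single, nest_of_length _ (by simp)]
    rfl
  | zero => simp
  | add s t hs ht => simp only [map_add, hs, ht, add_zero]
  | smul c t ht => simp only [map_smul, ht, smul_zero]

/-- Planting gives a one-tree forest, the block being everything; both sides vanish on forests of
fewer than two trees. -/
lemma toForests_plant {X Y : Q.Ob} {w : Forests Q X Y} {n : ℕ}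
    (hw : w ∈ goodForests Q n X Y) :
    toForests Q X Y (plant Q X Y w) = nestAll Q X Y w := by
  induction hw using Submodule.span_induction with
  | zero => simp
  | add s t _ _ hs ht => simp only [map_add, hs, ht]
  | smul c t _ ht => simp only [map_smul, ht]
  | mem x hx =>
    obtain ⟨F, s, hn, hF, hs, rfl⟩ := hx
    by_cases h : F.length < 2
    · rw [plant_single_of_length Q h, nestAll_single, nest_of_length Q h, map_zero]; rfl
    · rw [plant_single, toForests_inTree, nestAll_single, nest, if_pos (by omega)]
      · simp [sizeL]
      · rw [PTree.Good]; exact ⟨by omega, hF⟩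
      · rwa [PTree.leaves]

lemma toForests_freeB1_inTree {t : PTree} (ht : t.Good) {X Y : Q.Ob} {s : TStr k Q.Hom X Y}
    (hs : s ∈ TStr.len k Q.Hom t.leaves X Y) (hs' : Q.tD X Y s ∈ TStr.len k Q.Hom t.leaves X Y) :
    toForests Q X Y (freeB1 Q X Y (inTree Q t X Y s)) = forestsD Q X Y (Finsupp.single [t] s) := by
  rw [freeB1_inTree Q ht hs, map_add, map_smul, toForests_inTree Q ht hs', forestsD_single,
    sizeL_singleton, map_list_sum, List.map_map, expandL_singleton, List.map_map]
  congr 2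
  refine List.map_congr_left fun c hc => ?_
  obtain ⟨h1, h2⟩ := expand_spec t ht c hc
  simp only [Function.comp_apply, map_smul]
  rw [toForests_inTree Q h1 (h2 ▸ hs)]

lemma tD_mem_len {X Y : Q.Ob} {n : ℕ} {s : TStr k Q.Hom X Y} (hs : s ∈ TStr.len k Q.Hom n X Y) :
    Q.tD X Y s ∈ TStr.len k Q.Hom n X Y := by
  obtain ⟨t, rfl⟩ := TPow.exists_toTStr hs
  rw [← toTStr_tensorD]
  exact TPow.toTStr_mem _

lemma forestsMul_list_sum_left {X Y Z : Q.Ob} (L : List (Forests Q X Y)) (w : Forests Q Y Z) :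
    forestsMul Q X Y Z L.sum w = (L.map (fun v => forestsMul Q X Y Z v w)).sum :=
  map_list_sum ((forestsMul Q X Y Z).flip w) L

/-- `forestsD` is a derivation of degree one acting from the right. The cases are the tensor
differential, an edge expanded in `F`, and an edge expanded in the last tree. -/
lemma forestsD_mul {X Y Z : Q.Ob} (w : Forests Q X Y) (y : FreeHom Q Y Z) :
    forestsD Q X Z (forestsMul Q X Y Z w (toForests Q Y Z y)) =
      forestsMul Q X Y Z (forestsD Q X Y w) (toForests Q Y Z (freeSσ Q Y Z y)) +
      forestsMul Q X Y Z w (toForests Q Y Z (freeB1 Q Y Z y)) := by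
  induction w using Finsupp.induction_linear with
  | zero => simp
  | add a b ha hb => simp only [map_add, LinearMap.add_apply, ha, hb]; abel
  | single F s =>
    induction y using free_induction with
    | zero => simp
    | add a b ha hb => simp only [map_add, ha, hb]; abel
    | smul c b hb => simp only [map_smul, hb, smul_add]
    | inTree t p ht hp =>
      have hp := TStr.mk_mem_len (k := k) p hp
      generalize (TStr.mk k p) = s' at hp
      rw [toForests_freeSσ, toForests_freeB1_inTree Q ht hp (tD_mem_len Q hp),
        toForests_inTree Q ht hp, forestsσ_single, sizeL_singleton, forestsMul_single,
        sizeL_singleton, forestsD_single, forestsD_single, forestsD_single, sizeL_append,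
        sizeL_singleton, Q.tD_mul, expandL_append, expandL_singleton]
      -- The differential anticommutes with the tensor parity, which occurs $|F|$ times in the
      -- twist.
      have h1 : Q.tD Y Z (Q.tw (sizeL F) t.size Y Z s') =
          (-1 : k) ^ sizeL F • Q.tw (sizeL F) t.size Y Z (Q.tD Y Z s') := by
        simp only [Q.tw_apply, map_smul, Q.tD_pow, smul_smul, mul_comm]
      -- The enlarged forest has one more vertex; its extra shift produces the parity of the right
      -- factor, which cancels the parity applied to `y`.
      have h2 : ∀ c ∈ expandL F, (-1 : k) ^ (1 + c.1) •
            (Finsupp.single (c.2 ++ [t]) (TStr.mul X Y Z s (Q.tw (sizeL F) t.size Y Z s')) :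
              Forests Q X Z) =
          forestsMul Q X Y Z ((-1 : k) ^ (1 + c.1) • Finsupp.single c.2 s)
            ((-1 : k) ^ t.size • Finsupp.single [t] (Q.tσ Y Z s')) := by
        intro c hc
        simp only [map_smul, LinearMap.smul_apply, forestsMul_single, sizeL_expandL F c hc,
          sizeL_singleton, Q.tw_succ_left, Q.tσ_tσ, ← Finsupp.smul_single, smul_smul]
        congr 1
        linear_combination -(-1 : k) ^ (1 + c.1) * neg_one_pow_mul_self (k := k) t.size
      -- The position of the edge grows by $|F|$, and the same sign comes from the one additional
      -- shift in the right factor.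
      have h3 : ∀ c ∈ expand t, (-1 : k) ^ (1 + (sizeL F + c.1)) •
            (Finsupp.single (F ++ [c.2]) (TStr.mul X Y Z s (Q.tw (sizeL F) t.size Y Z s')) :
              Forests Q X Z) =
          forestsMul Q X Y Z (Finsupp.single F s)
            ((-1 : k) ^ (1 + c.1) • Finsupp.single [c.2] s') := by
        intro c hc
        rw [map_smul, forestsMul_single, sizeL_singleton, size_expand t c hc, Q.tw_succ_right,
          map_smul, ← Finsupp.smul_single, smul_smul, ← pow_add]
        congr 2; ring
      simp only [List.map_append, List.map_map, List.sum_append, Function.comp_def]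
      rw [List.map_congr_left h2, List.map_congr_left h3, h1,
        ← Function.comp_def (fun v => forestsMul Q X Y Z v _), ← List.map_map,
        ← forestsMul_list_sum_left, ← Function.comp_def (forestsMul Q X Y Z (Finsupp.single F s)),
        ← List.map_map, ← map_list_sum]
      simp only [map_add, map_smul, LinearMap.add_apply, LinearMap.smul_apply, forestsMul_single,
        sizeL_singleton, Q.tσ_tw, Finsupp.single_add, ← Finsupp.smul_single, smul_add, smul_smul,
        ← pow_add]
      rw [show (-1 : k) ^ (sizeL F + t.size + sizeL F) = (-1) ^ t.size by
        rw [add_assoc, add_comm t.size, ← add_assoc, pow_add, pow_add, neg_one_pow_mul_self, one_mul],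
        add_comm t.size]
      abel

lemma forestsMul_cutSum_left {X Y Z : Q.Ob} (ψ : List PTree → List PTree → Forests Q X Y)
    (F : List PTree) (w : Forests Q Y Z) :
    forestsMul Q X Y Z (cutSum ψ F) w = cutSum (fun l m => forestsMul Q X Y Z (ψ l m) w) F :=
  map_cutSum ((forestsMul Q X Y Z).flip w) ψ F

/-- A block of consecutive trees either avoids the last tree or ends with it. The second kind makes
up `nestLast`; there the block consisting of the last tree alone vanishes, having only one branch.
-/
lemma forestsN_mul {X Y Z : Q.Ob} (w : Forests Q X Y) (y : FreeHom Q Y Z) :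
    forestsN Q X Z (forestsMul Q X Y Z w (toForests Q Y Z y)) =
      forestsMul Q X Y Z (forestsN Q X Y w) (toForests Q Y Z (freeSσ Q Y Z y)) +
      nestLast Q X Y Z w (toForests Q Y Z y) := by
  induction w using Finsupp.induction_linear with
  | zero => simp
  | add a b ha hb => simp only [map_add, LinearMap.add_apply, ha, hb]; abel
  | single F s =>
    induction y using free_induction with
    | zero => simp
    | add a b ha hb => simp only [map_add, ha, hb]; abel
    | smul c b hb => simp only [map_smul, hb, smul_add]
    | inTree t p ht hp =>
      have hp := TStr.mk_mem_len (k := k) p hp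
      generalize (TStr.mk k p) = s' at hp
      rw [toForests_freeSσ, toForests_inTree Q ht hp, forestsσ_single, sizeL_singleton,
        forestsMul_single, sizeL_singleton, forestsN_single, forestsN_single, cutSum_concat,
        cutSum_nil, nest_of_length Q (by simp), LinearMap.zero_apply, add_zero, nestLast_single,
        sizeL_singleton, forestsMul_cutSum_left, ← cutSum_add]
      refine cutSum_congr fun l q hlq => ?_
      rw [cutSum_concat, forestsMul_cutSum_left]
      refine congrArg (· + _) (cutSum_congr fun m r hmr => ?_)
      rw [map_smul, nest_mul, hmr, hlq, sizeL_singleton, Q.tw_succ_left,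
        Q.tσ_tσ, map_smul, map_smul, smul_smul, neg_one_pow_mul_self, one_smul]

/-- The block either contains the tree of `y`, and then `y` may be moved into the right factor, or
consists of the trees of `v` only. -/
lemma nestLast_mul {X Y Z W : Q.Ob} (w : Forests Q X Y) (y : FreeHom Q Y Z) (v : Forests Q Z W) :
    nestLast Q X Z W (forestsMul Q X Y Z w (toForests Q Y Z y)) v =
      nestLast Q X Y W w (forestsMul Q Y Z W (toForests Q Y Z y) v) +
      forestsMul Q X Z W (forestsMul Q X Y Z w (toForests Q Y Z y)) (nestAll Q Z W v) := by
  induction w using Finsupp.induction_linear with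
  | zero => simp
  | add a b ha hb => simp only [map_add, LinearMap.add_apply, ha, hb]; abel
  | single F s =>
    induction v using Finsupp.induction_linear with
    | zero => simp
    | add a b ha hb => simp only [map_add, ha, hb]; abel
    | single G s'' =>
      induction y using free_induction with
      | zero => simp
      | add a b ha hb => simp only [map_add, LinearMap.add_apply, ha, hb]; abel
      | smul c b hb => simp only [map_smul, LinearMap.smul_apply, hb, smul_add]
      | inTree t p ht hp =>
        have hp := TStr.mk_mem_len (k := k) p hp
        generalize (TStr.mk k p) = s' at hp
        rw [toForests_inTree Q ht hp, forestsMul_single, forestsMul_single, nestLast_single,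
          nestLast_single, cutSum_concat, nestAll_single, mul_nest, sizeL_append, sizeL_append,
          Q.tw_mul, TStr.mul_assoc]
        simp only [List.append_assoc, List.nil_append]

/-- Iterating `nestLast_mul` sorts the terms by the entry of the string at which the block begins,
which is a sum over splittings. -/
lemma nestLast_forestsProd {X Y Z : Q.Ob} (p : Str (FreeHom Q) X Y) (v : Forests Q Y Z) :
    nestLast Q X Y Z (forestsProd Q p) v = Str.splitSum (fun W l r => forestsMul Q X W Z
      (forestsProd Q l) (nestAll Q W Z (forestsMul Q W Y Z (forestsProd Q r) v))) p := by
  induction p with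
  | nil =>
    rw [Str.splitSum_nil, forestsProd, one_forestsMul, one_forestsMul]
    induction v using Finsupp.induction_linear with
    | zero => simp
    | add a b ha hb => simp only [map_add, ha, hb]
    | single G s =>
      rw [nestLast_single, cutSum_nil, nestAll_single, sizeL, Q.tw_zero_left, TStr.one_mul,
        List.nil_append]
  | snoc p y ih =>
    rw [forestsProd, nestLast_mul, ih, Str.splitSum_snoc, forestsProd, forestsProd, one_forestsMul]
    simp only [forestsProd, forestsMul_assoc]

lemma forestsProd_one {X Y : Q.Ob} (y : FreeHom Q X Y) :
    forestsProd Q (Str.one y) = toForests Q X Y y := by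
  rw [Str.one, forestsProd, forestsProd, one_forestsMul]

lemma plant_toForests {X Y : Q.Ob} (y : FreeHom Q X Y) : plant Q X Y (toForests Q X Y y) = 0 := by
  induction y using free_induction with
  | inTree t p ht hp =>
    rw [toForests_inTree Q ht (TStr.mk_mem_len p hp), plant_single_of_length _ (by simp)]
  | zero => simp
  | add s t hs ht => simp only [map_add, hs, ht, add_zero]
  | smul c t ht => simp only [map_smul, ht, smul_zero]

/-- The differential of forests is the coderivation with components `bₙ`. -/
lemma bSum_forestsProd {X Y : Q.Ob} (p : Str (FreeHom Q) X Y) :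
    Str.bSum (fun _ _ => freeB Q) (fun X Y => freeSσ Q X Y) (forestsProd Q) p =
      forestsD Q X Y (forestsProd Q p) + forestsN Q X Y (forestsProd Q p) := by
  induction p with
  | nil =>
    rw [Str.bSum_nil, forestsProd, forestsD_single, forestsN_single, cutSum_nil, cutSum_nil,
      nest_of_length Q (by simp), Q.tD_mk]
    simp [DGQuiver.dStr', expandL]
  | @snoc Y Z p y ih =>
    have h1 : Str.bSum (fun _ _ => freeB Q) (fun X Y => freeSσ Q X Y)
          (fun q => forestsProd Q (q.snoc (freeSσ Q Y Z y))) p =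
        forestsMul Q X Y Z (Str.bSum (fun _ _ => freeB Q) (fun X Y => freeSσ Q X Y)
          (forestsProd Q) p) (toForests Q Y Z (freeSσ Q Y Z y)) :=
      (Str.map_bSum _ _ ((forestsMul Q X Y Z).flip (toForests Q Y Z (freeSσ Q Y Z y))) _ p).symm
    -- These are the infixes that end with `y`. With at least two entries the value is a planted
    -- forest, that is, a block; for empty `r` the operation is $b_1$ and the corresponding block is
    -- zero.
    have h2 : Str.splitSum (fun W l r => forestsProd Q (l.snoc (freeB Q (r.snoc y)))) p =
        nestLast Q X Y Z (forestsProd Q p) (toForests Q Y Z y) +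
          forestsMul Q X Y Z (forestsProd Q p) (toForests Q Y Z (freeB1 Q Y Z y)) := by
      rw [nestLast_forestsProd, ← sub_eq_iff_eq_add', ← Str.splitSum_sub,
        Str.splitSum_eq_of_right]
      · simp only [forestsProd, one_forestsMul, nestAll_toForests, freeB, map_zero, sub_zero]
      · intro W l r _ hr
        rw [forestsProd, freeB_eq_plant Q _ (by simp only [Str.length]; omega),
          toForests_plant Q (forestsProd_mem_good Q _), forestsProd, sub_self]
    rw [Str.bSum_snoc, h1, h2, ih, forestsProd, forestsD_mul, forestsN_mul]
    simp only [map_add, LinearMap.add_apply]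
    abel

/-- Edges that contract to the root correspond to blocks of branches (`forestsN`), the others lie in
a branch (`forestsD`). The root is the first vertex, so it increases all positions and the size by
one; this is the minus sign. The block of all branches would leave a root with one input:
`innerCuts` excludes it and `plant` kills it. -/
lemma freeB1_plant {X Y : Q.Ob} {w : Forests Q X Y} {n : ℕ}
    (hw : w ∈ goodForests Q n X Y) :
    freeB1 Q X Y (plant Q X Y w) = -plant Q X Y (forestsD Q X Y w + forestsN Q X Y w) := by
  induction hw using Submodule.span_induction with
  | zero => simp
  | add s t _ _ hs ht => simp only [map_add, hs, ht]; abel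
  | smul c t _ ht => rw [map_smul, map_smul, ht]; simp only [map_smul, ← smul_add, smul_neg]
  | mem x hx =>
    obtain ⟨F, s, hn, hF, hs, rfl⟩ := hx
    by_cases h : F.length < 2
    -- Fewer than two trees: expanding an edge keeps the number of trees and no block has two
    -- members, so every term is zero.
    · rw [plant_single_of_length Q h, map_zero, map_add, forestsD_single, map_add, map_smul,
        plant_single_of_length Q h, smul_zero, map_list_sum, List.map_map, forestsN_single,
        cutSum_congr (ψ' := fun _ _ => 0)]
      · rw [List.map_congr_left (g := fun _ => 0)]
        · simp [cutSum]
        · intro c hc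
          rw [Function.comp_apply, map_smul, plant_single_of_length, smul_zero]
          rwa [(expandL_spec F hF c hc).2.2]
      · intro l q hlq
        rw [cutSum_congr (ψ' := fun _ _ => 0)]
        · simp [cutSum]
        · intro m r hmr
          rw [nest_of_length]; · rfl
          simp only [← hlq, ← hmr, List.length_append] at h
          omega
    · have hg : (PTree.node F).Good := by rw [PTree.Good]; exact ⟨by omega, hF⟩
      rw [plant_single, freeB1_inTree Q hg (by rwa [PTree.leaves]), expand, List.map_append,
        List.map_map, List.map_map, List.sum_append, map_add, forestsD_single, map_add, map_smul,
        plant_single, map_list_sum, List.map_map, forestsN_single, map_cutSum, Function.comp_def,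
        sum_innerCuts (fun l m r => (-1 : k) ^ (1 + (1 + sizeL l + 1)) •
          inTree Q (PTree.node (l ++ PTree.node m :: r)) X Y s)]
      -- The new vertex has position $1+|l|+1$, after the root and the vertices of `l`, so its sign
      -- $(-1)^{1+h}$ is the opposite of the sign $(-1)^{|l|}$ of `nest`.
      have h1 : ∀ l m r, l ++ (m ++ r) = F → (if 2 ≤ m.length ∧ m.length < F.length then
            (-1 : k) ^ (1 + (1 + sizeL l + 1)) •
              inTree Q (PTree.node (l ++ PTree.node m :: r)) X Y s else 0) =
          -plant Q X Y (nest Q l m r X Y s) := by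
        rintro l m r rfl
        unfold nest
        by_cases hm : 2 ≤ m.length
        · rw [if_pos hm, LinearMap.smul_apply, map_smul, Finsupp.lsingle_apply]
          -- This length is below two exactly when `l` and `r` are empty, that is, when the block is
          -- the whole forest.
          by_cases hr : (l ++ PTree.node m :: r).length < 2
          · rw [plant_single_of_length Q hr, smul_zero, neg_zero, if_neg]
            simp only [List.length_append, List.length_cons] at hr ⊢
            omega
          · rw [plant_single, if_pos, ← neg_smul]
            · congr 1; ring
            · simp only [List.length_append, List.length_cons] at hr ⊢
              omega
        · rw [if_neg hm, if_neg (fun h => hm h.1), LinearMap.zero_apply, map_zero, neg_zero]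
      rw [cutSum_congr (fun l q hlq => (cutSum_congr (fun m r hmr => h1 l m r (by rw [hmr, hlq])))),
        neg_add, neg_add, add_assoc, add_comm (cutSum _ _)]
      congr 1
      · rw [← neg_smul]
        congr 1
        rw [PTree.size]; ring
      · congr 1
        · rw [List.sum_neg, List.map_map]
          congr 1
          refine List.map_congr_left fun c _ => ?_
          simp only [Function.comp_apply, map_smul, plant_single, ← neg_smul]
          congr 1; ring
        · rw [← cutSum_neg]
          refine cutSum_congr fun l q _ => ?_
          rw [map_cutSum, ← cutSum_neg]

end Forests

-- The square of an odd coderivation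

namespace Str

section bSum

variable {O : Type u} {M : O → O → Type u} {N : Type u} [AddCommGroup N]
  (b : ∀ X Y, Str M X Y → M X Y) (σ : ∀ X Y, M X Y → M X Y)

/-- The operator `bSum` is a coderivation. -/
lemma bSum_splitSum {X Y : O} (ψ : ∀ Z, Str M X Z → Str M Z Y → N) (p : Str M X Y) :
    bSum b σ (fun q => splitSum ψ q) p =
      splitSum (fun Z l r => bSum b σ (fun l' => ψ Z l' (r.map id σ)) l +
        bSum b σ (fun r' => ψ Z l r') r) p := by
  induction p with
  | nil => simp
  | snoc p x ih =>
    simp only [bSum_snoc, splitSum_snoc, bSum_add, bSum_nil, add_zero, ih, splitSum_add, map]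
    rw [splitSum_coassoc (fun Z W l r' r => ψ Z l (r'.snoc (b _ _ (r.snoc x))))]
    abel

variable {k : Type u} [CommRing k] [∀ X Y, AddCommGroup (M X Y)] [∀ X Y, Module k (M X Y)]
  [Module k N]

/-- The square of the coderivation is a coderivation without signs. Pairs of disjoint infixes occur
in both orders and cancel because `b` is odd (`h1`); nested pairs combine to `b` applied after
`bSum` (`h2`). -/
lemma bSum_bSum_snoc (hσ : ∀ X Y x, σ X Y (σ X Y x) = x)
    (hb : ∀ {X Y} (p : Str M X Y), b X Y (p.map id σ) = -σ X Y (b X Y p)) {X Y Z : O}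
    {φ : Str M X Z → N} (hφ : IsMultilinear k φ) (p : Str M X Y) (x : M Y Z) :
    bSum b σ (bSum b σ φ) (p.snoc x) = bSum b σ (bSum b σ (fun q => φ (q.snoc x))) p +
      splitSum (fun _ l r => φ (l.snoc (bSum b σ (b _ _) (r.snoc x)))) p := by
  have h1 : ∀ W (l : Str M X W) (r : Str M W Y),
      bSum b σ (fun l' => φ (l'.snoc (b W Z (snoc (Y := Y) (r.map id σ) (σ Y Z x))))) l =
        -bSum b σ (fun l' => φ (l'.snoc (σ W Z (b W Z (r.snoc x))))) l := by
    intro W l r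
    have h : ∀ l' : Str M X W, φ (l'.snoc (b W Z (snoc (Y := Y) (r.map id σ) (σ Y Z x)))) +
        φ (l'.snoc (σ W Z (b W Z (r.snoc x)))) = 0 := by
      intro l'
      have := (hφ.last l').map_neg (σ W Z (b W Z (r.snoc x)))
      rw [← hb] at this
      exact (congrArg (· + _) this).trans (neg_add_cancel _)
    rw [eq_neg_iff_add_eq_zero, ← bSum_add]
    simp only [h, bSum_zero]
  have h2 : ∀ W (l : Str M X W) (r : Str M W Y),
      φ (l.snoc (bSum b σ (b _ _) (r.snoc x))) =
        bSum b σ (fun r' => φ (l.snoc (b _ _ (r'.snoc (σ _ _ x))))) r +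
        splitSum (fun _ l' r' => φ (l.snoc (b _ _ (l'.snoc (b _ _ (r'.snoc x)))))) r := by
    intro W l r
    rw [bSum_snoc]
    refine ((hφ.last l).map_add _ _).trans ?_
    rw [map_bSum, map_splitSum]
    rfl
  rw [splitSum_congr (p := p) (fun W l r _ => h2 W l r)]
  simp only [bSum_snoc, hσ, bSum_add, splitSum_add, bSum_splitSum]
  rw [splitSum_coassoc (fun Z W l r' r => φ (l.snoc (b _ _ (r'.snoc (b _ _ (r.snoc x)))))),
    splitSum_congr (p := p) (fun W l r _ => h1 W l r)]
  have h3 : splitSum (fun W l r =>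
      -bSum b σ (fun l' => φ (l'.snoc (σ _ _ (b _ _ (r.snoc x))))) l) p =
      -splitSum (fun W l r => bSum b σ (fun l' => φ (l'.snoc (σ _ _ (b _ _ (r.snoc x))))) l) p := by
    rw [eq_neg_iff_add_eq_zero, ← splitSum_add]
    simp [splitSum_zero]
  rw [h3]
  abel

/-- All components of the square vanish on `p`: those of arity at least two by `hbb`, the unary one
because it is assumed to kill the entries of `p`. Asking this of the entries only is what makes the
argument usable in an induction on generation. -/
lemma bSum_bSum_eq_zero (hσ : ∀ X Y x, σ X Y (σ X Y x) = x)
    (hb : ∀ {X Y} (p : Str M X Y), b X Y (p.map id σ) = -σ X Y (b X Y p))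
    (hbb : ∀ {X Y} (p : Str M X Y), 2 ≤ p.length → bSum b σ (b _ _) p = 0)
    {X Y : O} (p : Str M X Y) (hp : p.Forall (fun X Y x => b X Y (one (b X Y (one x))) = 0))
    {φ : Str M X Y → N} (hφ : IsMultilinear k φ) : bSum b σ (bSum b σ φ) p = 0 := by
  induction p with
  | nil => simp
  | @snoc Y Z p x ih =>
    -- Of the infixes that end with `x`, only `x` alone is not covered by `hbb`.
    rw [bSum_bSum_snoc b σ hσ hb hφ, ih hp.1 (hφ.snoc x), zero_add, splitSum_eq_of_right]
    · have : bSum b σ (b _ _) ((nil : Str M Y Y).snoc x) = 0 := by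
        simpa [bSum_snoc, one] using hp.2
      rw [this]
      exact (hφ.last p).map_zero
    · intro W l r _ hr
      rw [hbb _ (by simp only [length]; omega)]
      exact (hφ.last l).map_zero

end bSum

end Str

-- Generation of $\mathcal F\mathcal Q$ by $\mathcal Q$

section Generation

open PTree

variable {k : Type u} [CommRing k] (Q : DGQuiver k)

lemma inTree_leaf {X Y : Q.Ob} (x : Q.Hom X Y) :
    inTree Q PTree.leaf X Y (TStr.mk k (Str.one x)) = incl Q X Y x :=
  inTree_mk Q (Str.one x) (by simp [PTree.Good]) (by simp [Str.one, Str.length, PTree.leaves])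

lemma exists_one_of_length {O : Type u} {M : O → O → Type u} {X Y : O} (p : Str M X Y)
    (hp : p.length = 1) : ∃ x, p = Str.one x := by
  match p with
  | Str.nil => simp [Str.length] at hp
  | Str.snoc Str.nil x => exact ⟨x, rfl⟩
  | Str.snoc (Str.snoc _ _) _ => simp [Str.length] at hp

/-- The span of the products of `n` elements of `S`. -/
def prodSpan (S : ∀ X Y, Submodule k (FreeHom Q X Y)) (n : ℕ) (X Y : Q.Ob) :
    Submodule k (Forests Q X Y) :=
  Submodule.span k {w | ∃ p : Str (FreeHom Q) X Y, p.length = n ∧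
    p.Forall (fun X Y y => y ∈ S X Y) ∧ w = forestsProd Q p}

lemma toForests_mul_mem_prodSpan (S : ∀ X Y, Submodule k (FreeHom Q X Y)) {n : ℕ} {X Y Z : Q.Ob}
    {y : FreeHom Q X Y} (hy : y ∈ S X Y) {w : Forests Q Y Z} (hw : w ∈ prodSpan Q S n Y Z) :
    forestsMul Q X Y Z (toForests Q X Y y) w ∈ prodSpan Q S (n + 1) X Z := by
  induction hw using Submodule.span_induction with
  | zero => rw [map_zero]; exact zero_mem _
  | add s t _ _ hs ht => rw [map_add]; exact add_mem hs ht
  | smul c t _ ht => rw [map_smul]; exact Submodule.smul_mem _ _ ht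
  | mem w hw =>
    obtain ⟨p, hn, hp, rfl⟩ := hw
    refine Submodule.subset_span ⟨(Str.one y).append p, ?_, ?_, ?_⟩
    · rw [Str.length_append, hn, add_comm]; rfl
    · exact (Str.forall_append _ _).2 ⟨⟨trivial, hy⟩, hp⟩
    · rw [forestsProd_append, forestsProd_one]

/-- `S` contains `Q` and is closed under the operations `bₙ` with `n ≥ 2`. -/
structure ContainsGenerated (S : ∀ X Y, Submodule k (FreeHom Q X Y)) : Prop where
  incl_mem : ∀ X Y x, incl Q X Y x ∈ S X Y
  freeB_mem : ∀ {X Y} (p : Str (FreeHom Q) X Y), 2 ≤ p.length →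
    p.Forall (fun X Y y => y ∈ S X Y) → freeB Q p ∈ S X Y

mutual
-- A decorated tree with root is `plant` of the forest of its branches, and that forest is a sum of
-- products of decorated trees that belong to `S` by induction; `plant` of such a product is a value
-- of some $b_n$ with $n\ge2$.
lemma inTree_mem_of_containsGenerated
    {S : ∀ X Y, Submodule k (FreeHom Q X Y)} (hS : ContainsGenerated Q S) :
    (t : PTree) → t.Good → ∀ {X Y : Q.Ob} (s : TStr k Q.Hom X Y),
    s ∈ TStr.len k Q.Hom t.leaves X Y → inTree Q t X Y s ∈ S X Y
  | PTree.leaf, _, X, Y, s, hs => by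
      induction hs using Submodule.span_induction with
      | zero => rw [map_zero]; exact zero_mem _
      | add s t _ _ hs ht => rw [map_add]; exact add_mem hs ht
      | smul c t _ ht => rw [map_smul]; exact Submodule.smul_mem _ _ ht
      | mem s hs =>
        obtain ⟨p, hp, rfl⟩ := hs
        obtain ⟨x, rfl⟩ := exists_one_of_length p (by rw [hp, PTree.leaves])
        rw [inTree_leaf]
        exact hS.incl_mem _ _ _
  | PTree.node F, ht, X, Y, s, hs => by
      rw [PTree.Good] at ht
      rw [PTree.leaves] at hs
      have h := single_mem_of_containsGenerated hS F ht.2 s hs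
      rw [← plant_single]
      generalize (Finsupp.single F s) = w at h
      induction h using Submodule.span_induction with
      | zero => rw [map_zero]; exact zero_mem _
      | add s t _ _ hs ht => rw [map_add]; exact add_mem hs ht
      | smul c t _ ht => rw [map_smul]; exact Submodule.smul_mem _ _ ht
      | mem w hw =>
        obtain ⟨p, hn, hp, rfl⟩ := hw
        rw [← freeB_eq_plant Q p (by omega)]
        exact hS.freeB_mem p (by omega) hp
lemma single_mem_of_containsGenerated
    {S : ∀ X Y, Submodule k (FreeHom Q X Y)} (hS : ContainsGenerated Q S) :
    (F : List PTree) → GoodL F → ∀ {X Y : Q.Ob} (s : TStr k Q.Hom X Y),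
    s ∈ TStr.len k Q.Hom (leavesL F) X Y →
      (Finsupp.single F s : Forests Q X Y) ∈ prodSpan Q S F.length X Y
  | [], _, X, Y, s, hs => by
      induction hs using Submodule.span_induction with
      | zero => rw [Finsupp.single_zero]; exact zero_mem _
      | add s t _ _ hs ht => rw [Finsupp.single_add]; exact add_mem hs ht
      | smul c t _ ht => rw [← Finsupp.smul_single]; exact Submodule.smul_mem _ _ ht
      | mem s hs =>
        obtain ⟨p, hp, rfl⟩ := hs
        cases p with
        | nil => exact Submodule.subset_span ⟨Str.nil, rfl, trivial, rfl⟩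
        | snoc p x => simp [Str.length, leavesL] at hp
  | t :: F, hF, X, Y, s, hs => by
      rw [GoodL] at hF
      induction hs using Submodule.span_induction with
      | zero => rw [Finsupp.single_zero]; exact zero_mem _
      | add s t _ _ hs ht => rw [Finsupp.single_add]; exact add_mem hs ht
      | smul c t _ ht => rw [← Finsupp.smul_single]; exact Submodule.smul_mem _ _ ht
      | mem s hs =>
        obtain ⟨p, hp, rfl⟩ := hs
        rw [leavesL] at hp
        obtain ⟨Z, l, r, hl, hr, rfl⟩ := Str.exists_append_of_length p _ _ hp
        have h1 := inTree_mem_of_containsGenerated hS t hF.1 _ (TStr.mk_mem_len (k := k) l hl)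
        -- The rest of the string is twisted in advance: the product twists it again, and the twist
        -- is an involution.
        have h2 := single_mem_of_containsGenerated hS F hF.2 _
          (Q.tw_mem_len (a := t.size) (b := sizeL F) (TStr.mk_mem_len (k := k) r hr))
        have h3 := toForests_mul_mem_prodSpan Q S h1 h2
        rw [toForests_inTree Q hF.1 (TStr.mk_mem_len l hl), forestsMul_single, sizeL_singleton,
          Q.tw_tw, TStr.mul_mk] at h3
        exact h3
end

/-- `𝓕Q` is generated by `Q` under the operations `bₙ` with `n ≥ 2`. -/
lemma mem_of_containsGenerated
    {S : ∀ X Y, Submodule k (FreeHom Q X Y)} (hS : ContainsGenerated Q S) {X Y : Q.Ob} (y : FreeHom Q X Y) : y ∈ S X Y := by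
  induction y using free_induction with
  | inTree t p ht hp => exact inTree_mem_of_containsGenerated Q hS t ht _ (TStr.mk_mem_len p hp)
  | zero => exact zero_mem _
  | add s t hs ht => exact add_mem hs ht
  | smul c t ht => exact Submodule.smul_mem _ _ ht

/-! ### `𝓕Q` is an A∞-category -/

/-- `plant` after the product vanishes on strings of length at most one, so adding $b_1$ there gives
all the operations at once. -/
lemma freeB_multilinear {X Y : Q.Ob} :
    Str.IsMultilinear k (fun p : Str (FreeHom Q) X Y => freeB Q p) := by
  have h : (fun p : Str (FreeHom Q) X Y => freeB Q p) = fun p =>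
      Str.single (M' := FreeHom Q) (fun X => X) (fun X Y y => freeB1 Q X Y y) p +
        plant Q X Y (forestsProd Q p) := by
    funext p
    match p with
    | Str.nil =>
      change 0 = 0 + plant Q X X (forestsProd Q Str.nil)
      rw [forestsProd, plant_single_of_length Q (by simp), add_zero]
    | Str.snoc Str.nil y =>
      change freeB1 Q _ _ y = freeB1 Q _ _ y + plant Q _ _ (forestsProd Q (Str.one y))
      rw [forestsProd_one, plant_toForests, add_zero]
    | Str.snoc (Str.snoc p x) y =>
      rw [freeB_eq_plant Q _ (by simp [Str.length])]
      exact (zero_add _).symm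
  rw [h]
  exact (Str.single_multilinear (M' := FreeHom Q) (fun X => X) (freeB1 Q)).add
    ((forestsProd_multilinear Q).compLin (plant Q X Y))

lemma freeB1_mem {X Y : Q.Ob} {e : ℤ} {y : FreeHom Q X Y} (hy : y ∈ freeSGr Q X Y e) :
    freeB1 Q X Y y ∈ freeSGr Q X Y (e + 1) := by
  induction hy using Submodule.iSup_induction' with
  | zero => rw [map_zero]; exact zero_mem _
  | add s t _ _ hs ht => rw [map_add]; exact add_mem hs ht
  | mem t y hy =>
    obtain ⟨s, hs, rfl⟩ := hy
    have hs' := toTStr_mem_gr Q hs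
    rw [← inTree_toTStr, freeB1_inTree Q t.2 (TPow.toTStr_mem _)]
    refine add_mem (Submodule.smul_mem _ _ (inTree_mem_gr Q ?_)) (list_sum_mem ?_)
    · rw [show e + 1 - (t.1.size : ℤ) = e - t.1.size + 1 by ring]
      exact Q.tD_mem_gr hs'
    · intro z hz
      obtain ⟨c, hc, rfl⟩ := List.mem_map.1 hz
      refine Submodule.smul_mem _ _ (inTree_mem_gr Q ?_)
      rw [PTree.size_expand t.1 c hc, Nat.cast_succ, add_sub_add_right_eq_sub]
      exact hs'

lemma plant_mem {X Y : Q.Ob} {e : ℤ} {w : Forests Q X Y} (hw : w ∈ forestsGr Q X Y e) :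
    plant Q X Y w ∈ freeSGr Q X Y (e + 1) := by
  induction hw using Submodule.span_induction with
  | zero => rw [map_zero]; exact zero_mem _
  | add s t _ _ hs ht => rw [map_add]; exact add_mem hs ht
  | smul c t _ ht => rw [map_smul]; exact Submodule.smul_mem _ _ ht
  | mem w hw =>
    obtain ⟨F, s, hs, rfl⟩ := hw
    rw [plant_single]
    refine inTree_mem_gr Q ?_
    rw [PTree.size, Nat.cast_add, Nat.cast_one, add_comm 1, add_sub_add_right_eq_sub]
    exact hs

lemma freeB_mem {X Y : Q.Ob} {e : ℤ} {p : Str (FreeHom Q) X Y} (hp : p.IsHomog (freeSGr Q) e) :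
    freeB Q p ∈ freeSGr Q X Y (e + 1) := by
  match p with
  | Str.nil => exact zero_mem _
  | Str.snoc Str.nil y =>
    obtain ⟨a, b, ha, hb, h⟩ := hp
    rw [show a = 0 from ha, zero_add] at h
    exact freeB1_mem Q (h ▸ hb)
  | Str.snoc (Str.snoc p x) y =>
    rw [freeB_eq_plant Q _ (by simp [Str.length])]
    exact plant_mem Q (forestsProd_mem_gr Q hp)

/-- Write `freeB` as `plant` after the product plus a remainder vanishing on length at least two.
The first part gives `plant` of `forestsD + forestsN`; the remainder contributes only $b_1(b(p))$,
which is the negative of that by `freeB1_plant`. -/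
lemma bSum_freeB_of_two_le {X Y : Q.Ob} (p : Str (FreeHom Q) X Y) (hp : 2 ≤ p.length) :
    Str.bSum (fun _ _ => freeB Q) (fun X Y => freeSσ Q X Y) (freeB Q) p = 0 := by
  have h1 : ∀ q : Str (FreeHom Q) X Y,
      freeB Q q = plant Q X Y (forestsProd Q q) + (freeB Q q - plant Q X Y (forestsProd Q q)) :=
    fun q => by abel
  have h2 := Str.bSum_add (fun _ _ => freeB Q) (fun X Y => freeSσ Q X Y)
    (fun q => plant Q X Y (forestsProd Q q)) (fun q => freeB Q q - plant Q X Y (forestsProd Q q)) p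
  simp only [← h1] at h2
  refine h2.trans ?_
  rw [← Str.map_bSum _ _ (plant Q X Y), bSum_forestsProd,
    Str.bSum_eq_of_length (hφ := fun q hq => by rw [freeB_eq_plant Q q hq, sub_self])
      (hp := by omega), forestsProd_one, plant_toForests, sub_zero, freeB_eq_plant Q p hp]
  refine (congrArg (_ + ·) (freeB1_plant Q (forestsProd_mem_good Q p))).trans ?_
  exact add_neg_cancel _

lemma freeSσ_freeSσ {X Y : Q.Ob} (y : FreeHom Q X Y) : freeSσ Q X Y (freeSσ Q X Y y) = y :=
  parity_parity _ y

lemma freeSσ_freeB1 {X Y : Q.Ob} (y : FreeHom Q X Y) :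
    freeSσ Q X Y (freeB1 Q X Y y) = -freeB1 Q X Y (freeSσ Q X Y y) := by
  refine (parity_comp (freeSGr_internal Q X Y) (freeSGr_internal Q X Y) 1 (freeB1 Q X Y)
    (fun d x hx => freeB1_mem Q hx) y).trans ?_
  rw [sgn_one, neg_one_smul]; rfl

lemma forestsσ_mul {X Y Z : Q.Ob} (a : Forests Q X Y) (b : Forests Q Y Z) :
    forestsσ Q X Z (forestsMul Q X Y Z a b) =
      forestsMul Q X Y Z (forestsσ Q X Y a) (forestsσ Q Y Z b) := by
  induction a using Finsupp.induction_linear with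
  | zero => simp
  | add s t hs ht => simp only [map_add, LinearMap.add_apply, hs, ht]
  | single F s =>
    induction b using Finsupp.induction_linear with
    | zero => simp
    | add s t hs ht => simp only [map_add, hs, ht]
    | single G t =>
      simp only [forestsMul_single, forestsσ_single, map_smul, LinearMap.smul_apply, smul_smul,
        sizeL_append, pow_add, Q.tσ_mul, Q.tσ_tw, mul_comm]

lemma forestsProd_map_freeSσ {X Y : Q.Ob} (p : Str (FreeHom Q) X Y) :
    forestsProd Q (p.map id (fun X Y => freeSσ Q X Y)) = forestsσ Q X Y (forestsProd Q p) := by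
  induction p with
  | nil =>
    rw [forestsProd, forestsσ_single, sizeL, pow_zero, one_smul, Q.tσ_mk]
    rfl
  | snoc p y ih =>
    rw [forestsProd, forestsσ_mul, ← ih, ← toForests_freeSσ]
    rfl

/-- The new vertex raises the degree by one. -/
lemma freeSσ_plant {X Y : Q.Ob} {w : Forests Q X Y} {n : ℕ}
    (hw : w ∈ goodForests Q n X Y) :
    freeSσ Q X Y (plant Q X Y w) = -plant Q X Y (forestsσ Q X Y w) := by
  induction hw using Submodule.span_induction with
  | zero => simp
  | add s t _ _ hs ht => simp only [map_add, hs, ht]; abel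
  | smul c t _ ht => simp only [map_smul, ht, smul_neg]
  | mem x hx =>
    obtain ⟨F, s, hn, hF, hs, rfl⟩ := hx
    rw [forestsσ_single, map_smul]
    by_cases h : F.length < 2
    · rw [plant_single_of_length Q h, plant_single_of_length Q h, map_zero, smul_zero, neg_zero]
    · rw [plant_single, plant_single, freeSσ_inTree Q (by rw [PTree.Good]; exact ⟨by omega, hF⟩)
        (by rwa [PTree.leaves]), PTree.size, ← neg_smul]
      congr 1; ring

lemma freeB_map_freeSσ {X Y : Q.Ob} (p : Str (FreeHom Q) X Y) :
    freeB Q (p.map id (fun X Y => freeSσ Q X Y)) = -freeSσ Q X Y (freeB Q p) := by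
  match p with
  | Str.nil => exact (by rw [map_zero, neg_zero] : (0 : FreeHom Q X X) = -freeSσ Q X X 0)
  | Str.snoc Str.nil y =>
    change freeB1 Q _ _ (freeSσ Q _ _ y) = -freeSσ Q _ _ (freeB1 Q _ _ y)
    rw [freeSσ_freeB1, neg_neg]
  | Str.snoc (Str.snoc p x) y =>
    rw [freeB_eq_plant Q ((p.snoc x).snoc y) (by simp [Str.length]),
      freeSσ_plant Q (forestsProd_mem_good Q _), neg_neg, ← forestsProd_map_freeSσ]
    exact freeB_eq_plant Q _ (by rw [Str.length_map]; simp [Str.length])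

/-- The kernel of $b_1^2$ contains $\mathcal Q$ and is closed under the higher operations, by two
evaluations of the same iterated sum. -/
lemma freeB1_freeB1 {X Y : Q.Ob} (y : FreeHom Q X Y) : freeB1 Q X Y (freeB1 Q X Y y) = 0 := by
  have hS : ContainsGenerated Q (fun X Y => LinearMap.ker (freeB1 Q X Y ∘ₗ freeB1 Q X Y)) :=
    { incl_mem := fun X Y x => by
        rw [LinearMap.mem_ker, LinearMap.comp_apply, freeB1_incl, freeB1_incl, Q.d_d, map_zero]
      freeB_mem := fun {X Y} p hp hp' => by
        -- The sum is zero since the entries lie in the kernel. On the other hand `bSum` of `freeB`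
        -- vanishes on length at least two, so the same sum equals its value on the single entry
        -- $b(p)$, which is $b_1^2(b(p))$.
        have h := Str.bSum_bSum_eq_zero (fun _ _ => freeB Q) (fun X Y => freeSσ Q X Y)
          (fun _ _ => freeSσ_freeSσ Q) (freeB_map_freeSσ Q) (bSum_freeB_of_two_le Q) p hp'
          (freeB_multilinear Q)
        rw [Str.bSum_eq_of_length (hφ := bSum_freeB_of_two_le Q) (hp := by omega)] at h
        rw [LinearMap.mem_ker, LinearMap.comp_apply]
        simpa [Str.one, Str.bSum_snoc, freeB] using h }
  exact mem_of_containsGenerated Q hS y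

lemma bSum_freeB {X Y : Q.Ob} (p : Str (FreeHom Q) X Y) :
    Str.bSum (fun _ _ => freeB Q) (fun X Y => freeSσ Q X Y) (freeB Q) p = 0 := by
  match p with
  | Str.nil => simp
  | Str.snoc Str.nil y => simpa [Str.bSum_snoc, freeB] using freeB1_freeB1 Q y
  | Str.snoc (Str.snoc p x) y => exact bSum_freeB_of_two_le Q _ (by simp [Str.length])

lemma freePre_sgr : (freePre Q).sgr = freeSGr Q := by
  funext X Y d
  change freeSGr Q X Y (d + 1 + -1) = _
  rw [add_neg_cancel_right]

lemma freePre_sσ (X Y : Q.Ob) (x : FreeHom Q X Y) :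
    (freePre Q).sσ X Y x = freeSσ Q X Y x := by
  have h : (freePre Q).sσ X Y = freeSσ Q X Y := by
    refine linearMap_ext_of_isInternal (M := FreeHom Q X Y) (N := FreeHom Q X Y)
      (freeSGr_internal Q X Y) fun d x hx => ?_
    refine Eq.trans ?_ (parity_of_mem (freeSGr_internal Q X Y) hx).symm
    refine (freePre Q).sσ_of_mem (X := X) (Y := Y) ?_
    change x ∈ freeSGr Q X Y (d + 1 + -1)
    rwa [add_neg_cancel_right]
  exact congrArg (fun f : FreeHom Q X Y →ₗ[k] FreeHom Q X Y => f x) h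

lemma freePre_isAInf : (freePre Q).IsAInf where
  b_nil X := rfl
  b_multilinear X Y := freeB_multilinear Q
  b_mem {X Y} p e hp := by
    rw [freePre_sgr] at hp ⊢
    exact freeB_mem Q hp
  b_b {X Y} p := by
    have h : (fun X Y x => (freePre Q).sσ X Y x) = fun X Y x => freeSσ Q X Y x := by
      funext X Y x
      exact freePre_sσ Q X Y x
    rw [h]
    exact bSum_freeB Q p

end Generation

-- Degrees and lengths under comultiplication

section Strings

variable {O : Type u} {M : O → O → Type u}

lemma Str.splitSum_mem {k : Type u} [CommRing k] {N : Type u} [AddCommGroup N] [Module k N]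
    {X Y : O} {ψ : ∀ Z, Str M X Z → Str M Z Y → N} {p : Str M X Y} {S : Submodule k N}
    (h : ∀ Z l r, l.append r = p → ψ Z l r ∈ S) : Str.splitSum ψ p ∈ S := by
  induction p with
  | nil => simpa using h _ Str.nil Str.nil rfl
  | snoc p x ih =>
    rw [Str.splitSum_snoc]
    exact add_mem (ih fun Z l r hlr => h _ _ _ (by rw [Str.append, hlr])) (h _ _ Str.nil rfl)

variable {k : Type u} [CommRing k] [∀ X Y, AddCommGroup (M X Y)] [∀ X Y, Module k (M X Y)]

lemma Str.exists_isHomog_of_append {gr : ∀ X Y, ℤ → Submodule k (M X Y)} {X Y Z : O}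
    {p : Str M X Y} {q : Str M Y Z} {e : ℤ} (h : (p.append q).IsHomog gr e) :
    ∃ a b, p.IsHomog gr a ∧ q.IsHomog gr b ∧ a + b = e := by
  induction q generalizing e with
  | nil => exact ⟨e, 0, h, rfl, add_zero e⟩
  | snoc q x ih =>
    obtain ⟨c, d, hc, hd, rfl⟩ := h
    obtain ⟨a, b, ha, hb, rfl⟩ := ih hc
    exact ⟨a, b + d, ha, ⟨b, d, hb, hd, rfl⟩, (add_assoc a b d).symm⟩

/-- The comultiplication of a product whose first factor has length `n`, projected to length `n` on
the left. -/
lemma TStr.cop_proj_mul {N : Type u} [AddCommGroup N] [Module k N] {X Y Z : O} {n : ℕ}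
    (β : ∀ W, TStr k M X W →ₗ[k] TStr k M W Z →ₗ[k] N) {s : TStr k M X Y}
    (hs : s ∈ TStr.len k M n X Y) (t : TStr k M Y Z) :
    TStr.cop (fun W => β W ∘ₗ TStr.proj n X W) (TStr.mul X Y Z s t) = β Y s t := by
  induction hs using Submodule.span_induction with
  | zero => simp
  | add a b _ _ ha hb => simp only [map_add, LinearMap.add_apply, ha, hb]
  | smul c a _ ha => simp only [map_smul, LinearMap.smul_apply, ha]
  | mem s hs =>
    obtain ⟨p, hp, rfl⟩ := hs
    induction t using TStr.induction with
    | zero => simp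
    | add a b ha hb => simp only [map_add, ha, hb]
    | smul c a ha => simp only [map_smul, ha]
    | mk q =>
      rw [TStr.mul_mk, TStr.cop_mk, Str.splitSum_append]
      · rw [LinearMap.comp_apply, TStr.proj_mk, if_pos hp]
      · intro W l r h hr
        have := congrArg Str.length h
        rw [Str.length_append] at this
        rw [LinearMap.comp_apply, TStr.proj_mk, if_neg (by omega), map_zero, LinearMap.zero_apply]
      · intro W l r h hl
        rw [LinearMap.comp_apply, TStr.proj_mk, if_neg (by rw [Str.length_append]; omega), map_zero,
          LinearMap.zero_apply]

lemma TStr.proj_mem_gr {g : ∀ X Y, ℤ → Submodule k (M X Y)} {X Y : O} {e : ℤ} {n : ℕ}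
    {p : Str M X Y} (hp : p.IsHomog g e) :
    TStr.proj n X Y (TStr.mk k p) ∈ TStr.gr g X Y e := by
  rw [TStr.proj_mk]
  split_ifs
  · exact TStr.mk_mem_gr hp
  · exact zero_mem _

lemma TStr.cop_mem {N : Type u} [AddCommGroup N] [Module k N] {X Y : O}
    {g : ∀ X Y, ℤ → Submodule k (M X Y)} {e : ℤ} {S : Submodule k N}
    {β : ∀ W, TStr k M X W →ₗ[k] TStr k M W Y →ₗ[k] N}
    (h : ∀ W a b, a + b = e → ∀ (l : Str M X W) (r : Str M W Y), l.IsHomog g a → r.IsHomog g b →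
      β W (TStr.mk k l) (TStr.mk k r) ∈ S) {s : TStr k M X Y} (hs : s ∈ TStr.gr g X Y e) :
    TStr.cop β s ∈ S := by
  induction hs using Submodule.span_induction with
  | zero => rw [map_zero]; exact zero_mem _
  | add s t _ _ hs ht => rw [map_add]; exact add_mem hs ht
  | smul c t _ ht => rw [map_smul]; exact Submodule.smul_mem _ _ ht
  | mem s hs =>
    obtain ⟨p, hp, rfl⟩ := hs
    rw [TStr.cop_mk]
    refine Str.splitSum_mem fun W l r hlr => ?_
    subst hlr
    obtain ⟨a, b, ha, hb, hab⟩ := Str.exists_isHomog_of_append hp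
    exact h W a b hab l r ha hb

lemma TStr.lift_mem {N : Type u} [AddCommGroup N] [Module k N] {X Y : O}
    {g : ∀ X Y, ℤ → Submodule k (M X Y)} {e : ℤ} {S : Submodule k N} {φ : Str M X Y → N}
    (hφ : Str.IsMultilinear k φ) (h : ∀ p : Str M X Y, p.IsHomog g e → φ p ∈ S)
    {s : TStr k M X Y} (hs : s ∈ TStr.gr g X Y e) : TStr.lift φ hφ s ∈ S := by
  induction hs using Submodule.span_induction with
  | zero => rw [map_zero]; exact zero_mem _
  | add s t _ _ hs ht => rw [map_add]; exact add_mem hs ht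
  | smul c t _ ht => rw [map_smul]; exact Submodule.smul_mem _ _ ht
  | mem s hs =>
    obtain ⟨p, hp, rfl⟩ := hs
    rw [TStr.lift_mk]
    exact h p hp

/-- The function which is `1` on the empty string and vanishes on non-empty strings. -/
def Str.counit (k : Type u) [CommRing k] {O : Type u} {M : O → O → Type u} {O' : Type u}
    (M' : O' → O' → Type u) [∀ X Y, AddCommGroup (M' X Y)] [∀ X Y, Module k (M' X Y)]
    (φ : O → O') {X : O} : {Y : O} → Str M X Y → TStr k M' (φ X) (φ Y)
  | _, Str.nil => TStr.mk k Str.nil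
  | _, Str.snoc _ _ => 0

lemma Str.counit_multilinear {O' : Type u} (M' : O' → O' → Type u)
    [∀ X Y, AddCommGroup (M' X Y)] [∀ X Y, Module k (M' X Y)] (φ : O → O') {X Y : O} :
    Str.IsMultilinear k (fun p : Str M X Y => Str.counit k M' φ p) where
  map_add l x y r := by
    cases r <;> exact (add_zero _).symm
  map_smul l c x r := by
    cases r <;> exact (smul_zero _).symm

end Strings

-- The extension of a map of quivers to trees and forests

section Hat

open PTree

variable {k : Type u} [CommRing k] (Q : DGQuiver k) (A : AInfCategory k)

/-- The operations of an A∞-category as a linear map. -/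
def bLin (X Y : A.Ob) : TStr k A.Hom X Y →ₗ[k] A.Hom X Y :=
  TStr.lift _ (A.isAInf.b_multilinear X Y)

lemma bLin_mk {X Y : A.Ob} (p : Str A.Hom X Y) : bLin A X Y (TStr.mk k p) = A.b p :=
  TStr.lift_mk _ _ p

variable {Q A} (φ : Q.Ob → A.Ob) (f : ∀ X Y, Q.Hom X Y →ₗ[k] A.Hom (φ X) (φ Y))

mutual
/-- The extension of `f` to the summand of a tree. -/
def hat : PTree → ∀ X Y, TStr k Q.Hom X Y →ₗ[k] A.Hom (φ X) (φ Y)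
  | PTree.leaf, _, _ => TStr.lift _ (Str.single_multilinear φ f)
  | PTree.node F, X, Y => bLin A (φ X) (φ Y) ∘ₗ hatL F X Y
/-- The tensor product of the extensions of `f` to the summands of several trees. -/
def hatL : List PTree → ∀ X Y, TStr k Q.Hom X Y →ₗ[k] TStr k A.Hom (φ X) (φ Y)
  | [], _, _ => TStr.lift _ (Str.counit_multilinear A.Hom φ)
  | t :: F, X, Y => TStr.cop (fun Z =>
      ((TStr.mul (φ X) (φ Z) (φ Y) ∘ₗ TStr.one (φ X) (φ Z) ∘ₗ hat t X Z).compl₂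
        (hatL F Z Y ∘ₗ Q.tw t.size (sizeL F) Z Y)) ∘ₗ TStr.proj t.leaves X Z)
end

lemma hatL_cons_mul (t : PTree) (F : List PTree) {X Y Z : Q.Ob} {s : TStr k Q.Hom X Y}
    (hs : s ∈ TStr.len k Q.Hom t.leaves X Y) (r : TStr k Q.Hom Y Z) :
    hatL φ f (t :: F) X Z (TStr.mul X Y Z s r) =
      TStr.mul (φ X) (φ Y) (φ Z) (TStr.one _ _ (hat φ f t X Y s))
        (hatL φ f F Y Z (Q.tw t.size (sizeL F) Y Z r)) := by
  rw [hatL, TStr.cop_proj_mul _ hs]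
  rfl

lemma hatL_nil (X : Q.Ob) : hatL φ f [] X X (TStr.mk k Str.nil) = TStr.mk k Str.nil := by
  rw [hatL, TStr.lift_mk]
  rfl

lemma TStr.exists_mul_of_len {O : Type u} {M : O → O → Type u} [∀ X Y, AddCommGroup (M X Y)]
    [∀ X Y, Module k (M X Y)] {m n : ℕ} {X Y : O} {P : TStr k M X Y → Prop} (zero : P 0)
    (add : ∀ s t, P s → P t → P (s + t)) (smul : ∀ (c : k) t, P t → P (c • t))
    (mul : ∀ Z s t, s ∈ TStr.len k M m X Z → t ∈ TStr.len k M n Z Y → P (TStr.mul X Z Y s t))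
    {s : TStr k M X Y} (hs : s ∈ TStr.len k M (m + n) X Y) : P s := by
  induction hs using Submodule.span_induction with
  | zero => exact zero
  | add s t _ _ hs ht => exact add s t hs ht
  | smul c t _ ht => exact smul c t ht
  | mem s hs =>
    obtain ⟨p, hp, rfl⟩ := hs
    obtain ⟨Z, l, r, hl, hr, rfl⟩ := Str.exists_append_of_length p _ _ hp
    rw [← TStr.mul_mk]
    exact mul Z _ _ (TStr.mk_mem_len l hl) (TStr.mk_mem_len r hr)

/-- The extension is multiplicative: the twists in the recursion of `hatL` undo those in the product
of forests, again by `tw_mul` and because twists are involutions. -/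
lemma hatL_append_mul (F G : List PTree) {X Y Z : Q.Ob} {s : TStr k Q.Hom X Y}
    (hs : s ∈ TStr.len k Q.Hom (leavesL F) X Y) (r : TStr k Q.Hom Y Z) :
    hatL φ f (F ++ G) X Z (TStr.mul X Y Z s (Q.tw (sizeL F) (sizeL G) Y Z r)) =
      TStr.mul (φ X) (φ Y) (φ Z) (hatL φ f F X Y s) (hatL φ f G Y Z r) := by
  induction F generalizing X with
  | nil =>
    induction hs using Submodule.span_induction with
    | zero => simp
    | add a b _ _ ha hb => simp only [map_add, LinearMap.add_apply, ha, hb]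
    | smul c a _ ha => simp only [map_smul, LinearMap.smul_apply, ha]
    | mem s hs =>
      obtain ⟨p, hp, rfl⟩ := hs
      cases p with
      | nil => rw [hatL_nil, TStr.one_mul, TStr.one_mul, sizeL, Q.tw_zero_left]; rfl
      | snoc p x => simp [Str.length, leavesL] at hp
  | cons t F ih =>
    rw [leavesL] at hs
    refine TStr.exists_mul_of_len (k := k) (P := fun s =>
      hatL φ f (t :: F ++ G) X Z (TStr.mul X Y Z s (Q.tw (sizeL (t :: F)) (sizeL G) Y Z r)) =
      TStr.mul (φ X) (φ Y) (φ Z) (hatL φ f (t :: F) X Y s) (hatL φ f G Y Z r)) ?_ ?_ ?_ ?_ hs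
    · simp
    · intro a b ha hb; simp only [map_add, LinearMap.add_apply, ha, hb]
    · intro c a ha; simp only [map_smul, LinearMap.smul_apply, ha]
    · intro W a b ha hb
      rw [List.cons_append, TStr.mul_assoc, hatL_cons_mul φ f t _ ha, hatL_cons_mul φ f t _ ha,
        TStr.mul_assoc, ← ih (Q.tw_mem_len hb)]
      congr 2
      rw [sizeL_append, sizeL]
      -- Twisting `b` twice brings the left side to the form to which `tw_mul` applies.
      conv_lhs => rw [← Q.tw_tw t.size (sizeL F) b]
      rw [← Q.tw_mul, Q.tw_tw]

lemma hatL_singleton (t : PTree) {X Y : Q.Ob} {s : TStr k Q.Hom X Y}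
    (hs : s ∈ TStr.len k Q.Hom t.leaves X Y) :
    hatL φ f [t] X Y s = TStr.one _ _ (hat φ f t X Y s) := by
  have h := hatL_cons_mul φ f t [] hs (TStr.mk k Str.nil)
  rwa [sizeL, Q.tw_nil, hatL_nil, TStr.mul_one, TStr.mul_one] at h

mutual
-- Each vertex applies an operation of degree one, so the degree grows by $|t|$. This is the shift
-- of the summand of $t$, so the extension has degree zero on $s\mathcal F\mathcal Q$.
lemma hat_mem_gr (hf : ∀ X Y e, ∀ x ∈ Q.sgr X Y e, f X Y x ∈ A.sgr (φ X) (φ Y) e) : (t : PTree) → ∀ {X Y : Q.Ob} {e : ℤ} {s : TStr k Q.Hom X Y},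
    s ∈ TStr.gr Q.sgr X Y e → hat φ f t X Y s ∈ A.sgr (φ X) (φ Y) (e + t.size)
  | PTree.leaf, X, Y, e, s, hs => by
      rw [hat, size, Nat.cast_zero, add_zero]
      refine TStr.lift_mem _ (fun p hp => ?_) hs
      match p with
      | Str.nil => exact zero_mem _
      | Str.snoc Str.nil x =>
        obtain ⟨a, b, ha, hb, h⟩ := hp
        rw [show a = 0 from ha, zero_add] at h
        exact hf _ _ _ _ (h ▸ hb)
      | Str.snoc (Str.snoc _ _) _ => exact zero_mem _
  | PTree.node F, X, Y, e, s, hs => by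
      rw [hat, size, LinearMap.comp_apply, Nat.cast_add, Nat.cast_one, add_comm 1, ← add_assoc]
      exact TStr.lift_mem _ (fun p hp => A.isAInf.b_mem p _ hp) (hatL_mem_gr hf F hs)
lemma hatL_mem_gr (hf : ∀ X Y e, ∀ x ∈ Q.sgr X Y e, f X Y x ∈ A.sgr (φ X) (φ Y) e) : (F : List PTree) → ∀ {X Y : Q.Ob} {e : ℤ} {s : TStr k Q.Hom X Y},
    s ∈ TStr.gr Q.sgr X Y e → hatL φ f F X Y s ∈ TStr.gr A.sgr (φ X) (φ Y) (e + sizeL F)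
  | [], X, Y, e, s, hs => by
      rw [hatL, sizeL, Nat.cast_zero, add_zero]
      refine TStr.lift_mem _ (fun p hp => ?_) hs
      match p with
      | Str.nil =>
        rw [show e = 0 from hp]
        exact TStr.mk_mem_gr rfl
      | Str.snoc _ _ => exact zero_mem _
  | t :: F, X, Y, e, s, hs => by
      rw [hatL]
      refine TStr.cop_mem (fun Z a b hab l r hl hr => ?_) hs
      rw [sizeL, show e + ((t.size + sizeL F : ℕ) : ℤ) = (a + t.size) + (b + sizeL F) by
        rw [← hab]; push_cast; ring]
      exact TStr.mul_mem_gr (TStr.one_mem_gr (hat_mem_gr hf t (TStr.proj_mem_gr hl)))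
        (hatL_mem_gr hf F (Q.tw_mem_gr (TStr.mk_mem_gr hr)))
end

/-- The extension of `f` to tensors on the leaves of forests. -/
def hatForests (X Y : Q.Ob) : Forests Q X Y →ₗ[k] TStr k A.Hom (φ X) (φ Y) :=
  Finsupp.lsum k (fun F => hatL φ f F X Y)

lemma hatForests_single {X Y : Q.Ob} (F : List PTree) (s : TStr k Q.Hom X Y) :
    hatForests φ f X Y (Finsupp.single F s) = hatL φ f F X Y s := by
  simp [hatForests]

/-- The extension of `f` to `s𝓕Q`. -/
def hatFree (X Y : Q.Ob) : FreeHom Q X Y →ₗ[k] A.Hom (φ X) (φ Y) :=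
  DirectSum.toModule k GTree _ (fun t => hat φ f t.1 X Y ∘ₗ TPow.toTStr _ X Y)

lemma hatFree_inTree {t : PTree} (ht : t.Good) {X Y : Q.Ob} {s : TStr k Q.Hom X Y}
    (hs : s ∈ TStr.len k Q.Hom t.leaves X Y) :
    hatFree φ f X Y (inTree Q t X Y s) = hat φ f t X Y s := by
  obtain ⟨s, rfl⟩ := TPow.exists_toTStr hs
  rw [inTree_toTStr Q ⟨t, ht⟩, hatFree]
  exact DirectSum.toModule_lof k (ι := GTree) _ _

lemma hatForests_toForests {X Y : Q.Ob} (y : FreeHom Q X Y) :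
    hatForests φ f X Y (toForests Q X Y y) = TStr.one _ _ (hatFree φ f X Y y) := by
  induction y using free_induction with
  | inTree t p ht hp =>
    have hs := TStr.mk_mem_len (k := k) p hp
    rw [toForests_inTree Q ht hs, hatForests_single, hatFree_inTree φ f ht hs,
      hatL_singleton φ f t hs]
  | zero => simp
  | add s t hs ht => simp only [map_add, hs, ht]
  | smul c t ht => simp only [map_smul, ht]

lemma hatForests_mul {X Y Z : Q.Ob} {n : ℕ} {w : Forests Q X Y} (hw : w ∈ goodForests Q n X Y)
    (v : Forests Q Y Z) :
    hatForests φ f X Z (forestsMul Q X Y Z w v) =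
      TStr.mul (φ X) (φ Y) (φ Z) (hatForests φ f X Y w) (hatForests φ f Y Z v) := by
  induction hw using Submodule.span_induction with
  | zero => simp
  | add a b _ _ ha hb => simp only [map_add, LinearMap.add_apply, ha, hb]
  | smul c a _ ha => simp only [map_smul, LinearMap.smul_apply, ha]
  | mem w hw =>
    obtain ⟨F, s, hn, hF, hs, rfl⟩ := hw
    induction v using Finsupp.induction_linear with
    | zero => simp
    | add a b ha hb => simp only [map_add, ha, hb]
    | single G r =>
      simp only [forestsMul_single, hatForests_single]
      exact hatL_append_mul φ f F G hs r

lemma hatForests_forestsProd {X Y : Q.Ob} (p : Str (FreeHom Q) X Y) :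
    hatForests φ f X Y (forestsProd Q p) =
      TStr.mk k (p.map φ (fun X Y => hatFree φ f X Y)) := by
  induction p with
  | nil => rw [forestsProd, hatForests_single, hatL_nil]; rfl
  | snoc p y ih =>
    rw [forestsProd, hatForests_mul φ f (forestsProd_mem_good Q p), ih, hatForests_toForests,
      ← TStr.mk_snoc]
    rfl

/-- This is the recursion of `hat` at a root. It needs `n` at least two because `plant` kills
shorter forests, whereas the operation $b_1$ of the target need not vanish. -/
lemma hatFree_plant {X Y : Q.Ob} {n : ℕ} (hn : 2 ≤ n) {w : Forests Q X Y}
    (hw : w ∈ goodForests Q n X Y) :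
    hatFree φ f X Y (plant Q X Y w) = bLin A _ _ (hatForests φ f X Y w) := by
  induction hw using Submodule.span_induction with
  | zero => simp
  | add a b _ _ ha hb => simp only [map_add, ha, hb]
  | smul c a _ ha => simp only [map_smul, ha]
  | mem w hw =>
    obtain ⟨F, s, h, hF, hs, rfl⟩ := hw
    rw [plant_single, hatForests_single,
      hatFree_inTree φ f (by rw [PTree.Good]; exact ⟨by omega, hF⟩) (by rwa [PTree.leaves]), hat]
    rfl

lemma hatFree_freeB {X Y : Q.Ob} {p : Str (FreeHom Q) X Y} (hp : 2 ≤ p.length) :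
    hatFree φ f X Y (freeB Q p) = A.b (p.map φ (fun X Y => hatFree φ f X Y)) := by
  rw [freeB_eq_plant Q p hp, hatFree_plant φ f hp (forestsProd_mem_good Q p),
    hatForests_forestsProd, bLin_mk]

lemma hatFree_incl {X Y : Q.Ob} (x : Q.Hom X Y) : hatFree φ f X Y (incl Q X Y x) = f X Y x := by
  rw [← inTree_leaf, hatFree_inTree φ f (by simp [PTree.Good])
    (TStr.mk_mem_len _ (by simp [Str.one, Str.length, PTree.leaves])), hat, TStr.lift_mk]
  rfl

lemma hatFree_mem (hf : ∀ X Y e, ∀ x ∈ Q.sgr X Y e, f X Y x ∈ A.sgr (φ X) (φ Y) e) {X Y : Q.Ob}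
    {e : ℤ} {y : FreeHom Q X Y} (hy : y ∈ freeSGr Q X Y e) :
    hatFree φ f X Y y ∈ A.sgr (φ X) (φ Y) e := by
  induction hy using Submodule.iSup_induction' with
  | zero => rw [map_zero]; exact zero_mem _
  | add s t _ _ hs ht => rw [map_add]; exact add_mem hs ht
  | mem t y hy =>
    obtain ⟨s, hs, rfl⟩ := hy
    have h := hat_mem_gr φ f hf t.1 (toTStr_mem_gr Q hs)
    rw [sub_add_cancel] at h
    rw [hatFree, DirectSum.toModule_lof]
    exact h

lemma hatFree_freeSσ (hf : ∀ X Y e, ∀ x ∈ Q.sgr X Y e, f X Y x ∈ A.sgr (φ X) (φ Y) e)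
    {X Y : Q.Ob} (y : FreeHom Q X Y) :
    hatFree φ f X Y (freeSσ Q X Y y) = A.sσ (φ X) (φ Y) (hatFree φ f X Y y) := by
  refine Eq.symm ((parity_comp (freeSGr_internal Q X Y) (A.sgr_internal (φ X) (φ Y)) 0
    (hatFree φ f X Y) (fun d x hx => ?_) y).trans ?_)
  · rw [add_zero]; exact hatFree_mem φ f hf hx
  · rw [sgn_zero, one_smul]; rfl

end Hat

-- Strict maps and sums over blocks and infixes

namespace Str

variable {O O' : Type u} {M : O → O → Type u} {M' : O' → O' → Type u} {N : Type u} [AddCommGroup N]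

lemma bSum_sub (b : ∀ X Y, Str M X Y → M X Y) (σ : ∀ X Y, M X Y → M X Y) {X Y : O}
    (ψ ψ' : Str M X Y → N) (p : Str M X Y) :
    bSum b σ (fun q => ψ q - ψ' q) p = bSum b σ ψ p - bSum b σ ψ' p := by
  rw [eq_sub_iff_add_eq, ← bSum_add]
  simp

/-- Compatibility of `bSum` with a map of quivers which respects the operations on `S`. -/
lemma bSum_map {b : ∀ X Y, Str M X Y → M X Y} {σ : ∀ X Y, M X Y → M X Y}
    {b' : ∀ X Y, Str M' X Y → M' X Y} {σ' : ∀ X Y, M' X Y → M' X Y} (φ : O → O')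
    (g : ∀ X Y, M X Y → M' (φ X) (φ Y)) (S : ∀ X Y, M X Y → Prop)
    (hσ : ∀ X Y x, g X Y (σ X Y x) = σ' (φ X) (φ Y) (g X Y x))
    (hb : ∀ {X Y} (q : Str M X Y), 1 ≤ q.length → q.Forall S →
      b' (φ X) (φ Y) (q.map φ g) = g X Y (b X Y q))
    {X Y : O} (ψ : Str M' (φ X) (φ Y) → N) {p : Str M X Y} (hp : p.Forall S) :
    bSum b' σ' ψ (p.map φ g) = bSum b σ (fun q => ψ (q.map φ g)) p := by
  induction p with
  | nil => simp [map]
  | snoc p x ih =>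
    rw [map, bSum_snoc, bSum_snoc, splitSum_map, ih _ hp.1]
    refine congrArg₂ (· + ·) ?_ (splitSum_congr fun Z l r hlr => ?_)
    · simp only [map, hσ]
    · subst hlr
      rw [map, ← hb (r.snoc x) (by simp [length]) ⟨((forall_append _ _).1 hp.1).2, hp.2⟩]
      rfl

lemma length_pos_of_mem_blocks {φ : O → O'} {f : ∀ {X Y : O}, Str M X Y → M' (φ X) (φ Y)}
    {X Y : O} {p : Str M X Y} (hp : 1 ≤ p.length) {s} (hs : s ∈ p.blocks φ f) :
    1 ≤ s.2.2.length := by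
  cases p with
  | nil => simp [length] at hp
  | snoc p x =>
    rw [blocks, List.mem_append] at hs
    rcases hs with hs | hs
    · obtain ⟨s, -, rfl⟩ := List.mem_map.1 hs
      simp [length]
    · split_ifs at hs with h
      · simp at hs
      · obtain ⟨s, -, rfl⟩ := List.mem_map.1 hs
        simp [length, one]

/-- A piece of length at least two is killed by `f`, so only the cut into single entries
contributes. In the induction, attaching `x` to the last piece makes that piece too long. -/
lemma sum_blocks_of_strict {k : Type u} [CommRing k] [∀ X Y, AddCommGroup (M' X Y)]
    [∀ X Y, Module k (M' X Y)] [Module k N] {φ : O → O'}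
    {f : ∀ {X Y : O}, Str M X Y → M' (φ X) (φ Y)}
    (hf : ∀ {X Y : O} (p : Str M X Y), 2 ≤ p.length → f p = 0) {X Y : O}
    {ψ : Str M' (φ X) (φ Y) → N} (hψ : IsMultilinear k ψ) {p : Str M X Y} (hp : 1 ≤ p.length) :
    ((p.blocks φ f).map (fun s => ψ (s.2.1.snoc (f s.2.2)))).sum =
      ψ (p.map φ (fun _ _ x => f (one x))) := by
  induction p with
  | nil => simp [length] at hp
  | snoc p x ih =>
    rw [blocks, List.map_append, List.sum_append, List.map_map]
    by_cases h : p.length = 0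
    · cases p with
      | nil => simp [blocks, length, map, one]
      | snoc p y => simp [length] at h
    · rw [if_neg h, List.map_map]
      have h1 : ((p.blocks φ f).map (fun s => ψ (s.2.1.snoc (f (s.2.2.snoc x))))).sum = 0 := by
        refine List.sum_eq_zero fun y hy => ?_
        obtain ⟨s, hs, rfl⟩ := List.mem_map.1 hy
        have := length_pos_of_mem_blocks (by omega) hs
        rw [hf _ (by simp only [length]; omega)]
        exact hψ.map_zero s.2.1 nil
      refine (congrArg₂ (· + ·) h1 (ih (hψ.snoc (f (one x))) (by omega))).trans ?_
      exact zero_add _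

end Str

-- Existence and uniqueness of the strict functor

section Extension

variable {k : Type u} [CommRing k] {Q : DGQuiver k} {A : AInfCategory k}

lemma DGQuiverHom.map_mem_sgr (f : DGQuiverHom Q A.toDG) (X Y : Q.Ob) (e : ℤ) (x : Q.Hom X Y)
    (hx : x ∈ Q.sgr X Y e) : f.map X Y x ∈ A.sgr (f.obj X) (f.obj Y) e :=
  f.map_mem X Y (e + 1) x hx

/-- The extension of a morphism `Q → (A, m₁)` to `s𝓕Q`. -/
def DGQuiverHom.hat (f : DGQuiverHom Q A.toDG) (X Y : Q.Ob) :
    FreeHom Q X Y →ₗ[k] A.Hom (f.obj X) (f.obj Y) := hatFree (A := A) f.obj f.map X Y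

/-- The elements on which the extension commutes with $b_1$ include $\mathcal Q$, as `f` is a chain
map. If the entries of `p` are such elements, the extension respects every operation on infixes of
`p`, so the $A_\infty$ identities of both sides can be compared at `p`. -/
lemma DGQuiverHom.hat_freeB1 (f : DGQuiverHom Q A.toDG) {X Y : Q.Ob} (y : FreeHom Q X Y) :
    f.hat X Y (freeB1 Q X Y y) = A.b (Str.one (f.hat X Y y)) := by
  have hS : ContainsGenerated Q (fun X Y => LinearMap.ker
      (f.hat X Y ∘ₗ freeB1 Q X Y - A.toDG.d (f.obj X) (f.obj Y) ∘ₗ f.hat X Y)) :=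
    { incl_mem := fun X Y x => by
        rw [LinearMap.mem_ker, LinearMap.sub_apply, LinearMap.comp_apply, LinearMap.comp_apply,
          freeB1_incl, sub_eq_zero]
        refine (hatFree_incl (A := A) f.obj f.map _).trans ((f.map_d X Y x).trans ?_)
        exact congrArg _ (hatFree_incl (A := A) f.obj f.map x).symm
      freeB_mem := fun {X Y} p hp hp' => by
        rw [LinearMap.mem_ker, LinearMap.sub_apply]
        have h1 := Str.map_bSum (fun _ _ => freeB Q) (fun X Y => freeSσ Q X Y) (f.hat X Y)
          (freeB Q) p
        rw [bSum_freeB, map_zero] at h1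
        have h2 := Str.bSum_map (b := fun _ _ => freeB Q) (σ := fun X Y => freeSσ Q X Y)
          (b' := fun _ _ => A.b) (σ' := fun X Y => A.sσ X Y) f.obj (fun X Y y => f.hat X Y y)
          (fun X Y y => y ∈ LinearMap.ker
            (f.hat X Y ∘ₗ freeB1 Q X Y - A.toDG.d (f.obj X) (f.obj Y) ∘ₗ f.hat X Y))
          (fun X Y y => hatFree_freeSσ (A := A) f.obj f.map f.map_mem_sgr y)
          (fun q hq hq' => by
            match q with
            | Str.nil => simp [Str.length] at hq
            | Str.snoc Str.nil y => exact (sub_eq_zero.1 hq'.2).symm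
            | Str.snoc (Str.snoc q x) y =>
              exact (hatFree_freeB (A := A) f.obj f.map (by simp [Str.length])).symm)
          (fun q => A.b q) hp'
        have h3 := Str.bSum_sub (fun _ _ => freeB Q) (fun X Y => freeSσ Q X Y)
          (fun q => f.hat X Y (freeB Q q)) (fun q => A.b (q.map f.obj (fun X Y y => f.hat X Y y))) p
        rw [← h1, ← h2, zero_sub] at h3
        -- The difference between extending after `b` and applying `b` after extending vanishes on
        -- length at least two. Hence its `bSum` at `p` is its value at the single entry $b(p)$, the
        -- required equation; this sum is zero by the $A_\infty$ identities of source and target.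
        refine (Str.bSum_eq_of_length (fun _ _ => freeB Q) (fun X Y => freeSσ Q X Y)
          (φ := fun q => f.hat X Y (freeB Q q) - A.b (q.map f.obj (fun X Y y => f.hat X Y y)))
          (fun q hq => sub_eq_zero.2 (hatFree_freeB (A := A) f.obj f.map hq))
          (p := p) (by omega)).symm.trans ?_
        exact h3.trans (neg_eq_zero.2 (A.isAInf.b_b _)) }
  exact sub_eq_zero.1 (mem_of_containsGenerated Q hS y)

lemma DGQuiverHom.hat_freeB (f : DGQuiverHom Q A.toDG) {X Y : Q.Ob} {p : Str (FreeHom Q) X Y}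
    (hp : 1 ≤ p.length) :
    A.b (p.map f.obj (fun X Y y => f.hat X Y y)) = f.hat X Y (freeB Q p) := by
  match p with
  | Str.nil => simp [Str.length] at hp
  | Str.snoc Str.nil y => exact (f.hat_freeB1 y).symm
  | Str.snoc (Str.snoc p x) y =>
    exact (hatFree_freeB (A := A) f.obj f.map (by simp [Str.length])).symm

/-- The extension of a morphism `Q → (A, m₁)` to a strict A∞-functor `𝓕Q → A`. -/
def extFunctor (h : (freePre Q).IsAInf) (f : DGQuiverHom Q A.toDG) :
    StrictAInfFunctor (free Q h) A where
  obj := f.obj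
  comp {X Y} p := Str.single (M := FreeHom Q) f.obj (fun X Y y => f.hat X Y y) p
  comp_nil X := rfl
  comp_multilinear X Y := Str.single_multilinear (M := FreeHom Q) f.obj f.hat
  comp_mem {X Y} p e hp := by
    match p with
    | Str.nil => exact zero_mem _
    | Str.snoc Str.nil y =>
      obtain ⟨a, b, ha, hb, hab⟩ := hp
      rw [show a = 0 from ha, zero_add] at hab
      have hb' : y ∈ (freePre Q).sgr _ _ e := hab ▸ hb
      rw [freePre_sgr] at hb'
      exact hatFree_mem (A := A) f.obj f.map f.map_mem_sgr hb'
    | Str.snoc (Str.snoc _ _) _ => exact zero_mem _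
  comp_b {X Y} p hp := by
    have h1 := Str.sum_blocks_of_strict (M := FreeHom Q) (M' := A.Hom)
      (f := fun {X Y} p => Str.single (M := FreeHom Q) f.obj (fun X Y y => f.hat X Y y) p)
      (fun p hp => Str.single_eq_zero f.obj _ p (by omega))
      (A.isAInf.b_multilinear (f.obj X) (f.obj Y)) hp
    have h2 := Str.bSum_eq_of_length (fun _ _ => freeB Q) (fun X Y => (freePre Q).sσ X Y)
      (φ := fun q : Str (FreeHom Q) X Y =>
        Str.single (M := FreeHom Q) f.obj (fun X Y y => f.hat X Y y) q)
      (fun q hq => Str.single_eq_zero f.obj _ q (by omega)) hp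
    exact h1.trans ((f.hat_freeB hp).trans h2.symm)
  strict p hp := Str.single_eq_zero (M := FreeHom Q) f.obj _ p (Nat.ne_of_gt hp)

lemma DGQuiverHom.ext_map {R : DGQuiver k} {f g : DGQuiverHom Q R} (h : f.obj = g.obj)
    (h' : ∀ X Y x, f.map X Y x ≍ g.map X Y x) : f = g := by
  obtain ⟨obj, map, _, _⟩ := f
  obtain ⟨obj', map', _, _⟩ := g
  obtain rfl : obj = obj' := h
  obtain rfl : map = map' := by
    funext X Y
    exact LinearMap.ext fun x => eq_of_heq (h' X Y x)
  rfl

lemma StrictAInfFunctor.ext_comp {A B : AInfCategory k} {f g : StrictAInfFunctor A B}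
    (h : f.obj = g.obj) (h' : ∀ (X Y : A.Ob) (p : Str A.Hom X Y), f.comp p ≍ g.comp p) :
    f = g := by
  obtain ⟨⟨obj, comp, _, _, _, _⟩, _⟩ := f
  obtain ⟨⟨obj', comp', _, _, _, _⟩, _⟩ := g
  obtain rfl : obj = obj' := h
  obtain rfl : @comp = @comp' := by
    funext X Y p
    exact eq_of_heq (h' X Y p)
  rfl

lemma restr_extFunctor (h : (freePre Q).IsAInf) (f : DGQuiverHom Q A.toDG) :
    restr Q h A (extFunctor h f) = f := by
  exact DGQuiverHom.ext_map rfl fun X Y x => heq_of_eq (hatFree_incl (A := A) f.obj f.map x)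

/-- For a strict functor the functor equation reduces to one term on each side: the cut into single
entries and the infix that is the whole string. -/
lemma StrictAInfFunctor.b_map (h : (freePre Q).IsAInf) (g : StrictAInfFunctor (free Q h) A)
    {X Y : Q.Ob} {p : Str (FreeHom Q) X Y} (hp : 1 ≤ p.length) :
    A.b (p.map g.obj (fun X Y y => g.comp (X := X) (Y := Y) (Str.one y))) =
      g.comp (X := X) (Y := Y) (Str.one (freeB Q p)) := by
  have h1 := Str.sum_blocks_of_strict (M := FreeHom Q) (M' := A.Hom)
    (f := fun {X Y} p => g.comp (X := X) (Y := Y) p) g.strict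
    (A.isAInf.b_multilinear (g.obj X) (g.obj Y)) hp
  have h2 := Str.bSum_eq_of_length (fun _ _ => freeB Q) (fun X Y => (freePre Q).sσ X Y)
    (φ := fun q : Str (FreeHom Q) X Y => g.comp (X := X) (Y := Y) q) g.strict hp
  exact h1.symm.trans ((g.comp_b (X := X) (Y := Y) p hp).trans h2)

lemma Str.map_congr {O O' : Type u} {M : O → O → Type u} {M' : O' → O' → Type u} {φ : O → O'}
    {g g' : ∀ X Y, M X Y → M' (φ X) (φ Y)} {X Y : O} {p : Str M X Y}
    (hp : p.Forall (fun X Y y => g X Y y = g' X Y y)) : p.map φ g = p.map φ g' := by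
  induction p with
  | nil => rfl
  | snoc p x ih => rw [map, map, ih hp.1, hp.2]

/-- The component `g₁` of a strict A∞-functor `g : 𝓕Q → A` as a linear map. -/
def StrictAInfFunctor.lin (h : (freePre Q).IsAInf) (g : StrictAInfFunctor (free Q h) A)
    (X Y : Q.Ob) : FreeHom Q X Y →ₗ[k] A.Hom (g.obj X) (g.obj Y) :=
  (g.comp_multilinear X Y).last Str.nil

/-- Both maps respect $b_n$ for $n\ge2$ and agree on $\mathcal Q$, so the submodules where they
coincide contain everything generated by $\mathcal Q$. -/
lemma hat_restr (h : (freePre Q).IsAInf) (g : StrictAInfFunctor (free Q h) A) {X Y : Q.Ob}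
    (y : FreeHom Q X Y) :
    (restr Q h A g).hat X Y y = g.comp (X := X) (Y := Y) (Str.one y) := by
  have hS : ContainsGenerated Q (fun X Y =>
      LinearMap.eqLocus ((restr Q h A g).hat X Y) (g.lin h X Y)) :=
    { incl_mem := fun X Y x => hatFree_incl (A := A) (restr Q h A g).obj (restr Q h A g).map x
      freeB_mem := fun {X Y} p hp hp' => by
        refine (hatFree_freeB (A := A) (restr Q h A g).obj (restr Q h A g).map hp).trans
          (Eq.trans ?_ (g.b_map h (p := p) (by omega)))
        exact congrArg A.b (Str.map_congr hp') }
  exact mem_of_containsGenerated Q hS y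

lemma extFunctor_restr (h : (freePre Q).IsAInf) (g : StrictAInfFunctor (free Q h) A) :
    extFunctor h (restr Q h A g) = g := by
  have key : ∀ {X Y : Q.Ob} (p : Str (FreeHom Q) X Y),
      (extFunctor h (restr Q h A g)).comp (X := X) (Y := Y) p = g.comp (X := X) (Y := Y) p := by
    intro X Y p
    match p with
    | Str.nil => exact (g.comp_nil X).symm
    | Str.snoc Str.nil y => exact hat_restr h g y
    | Str.snoc (Str.snoc p x) y =>
      exact (g.strict (X := X) (Y := Y) ((p.snoc x).snoc y) (by simp [Str.length])).symm
  exact StrictAInfFunctor.ext_comp rfl fun X Y p => heq_of_eq (key (X := X) (Y := Y) p)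

end Extension

end FreeAInf

end

-- The universal property

theorem mainTheorem3 {k : Type u} [CommRing k] (Q : DGQuiver k) :
    ∃ h : (freePre Q).IsAInf, ∀ A : AInfCategory k,
      ∃ ext : DGQuiverHom Q A.toDG → StrictAInfFunctor (free Q h) A,
        (∀ f : DGQuiverHom Q A.toDG, restr Q h A (ext f) = f ∧
          ∀ g : StrictAInfFunctor (free Q h) A, restr Q h A g = f → g = ext f) ∧
        Function.LeftInverse ext (restr Q h A) ∧ Function.RightInverse ext (restr Q h A) := by
  exact ⟨freePre_isAInf Q, fun A => ⟨extFunctor (freePre_isAInf Q),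
    fun f => ⟨restr_extFunctor _ f, fun g hg => by rw [← hg]; exact (extFunctor_restr _ g).symm⟩,
    extFunctor_restr _, restr_extFunctor _⟩⟩
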